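/- Let $d>2$ and let $W=\langle s\rangle\subset \mathrm{GL}(\mathbb{C})=\mathbb{C}^{\times}$ be cyclic of order $d$, acting on $V=\mathbb{C}$. Let $R=\mathcal{O}(V)=\mathbb{C}[X]$, graded with $\deg X=2$, and consider graded $R$-bimodules (with the same action of $\mathbb{C}$ on both sides), with bimodule maps of degree $0$ as morphisms; $[n]$ denotes the grading shift, $M[n]_i=M_{i+n}$. For $x\in W$ let $\mathrm{Gr}(x)=\{(xv,v) : v\in V\}\subset V\times V$, and for $A\subseteq W$ let $\mathcal{O}(A)$ be the ring of regular functions on $\bigcup_{x\in A}\mathrm{Gr}(x)$, viewed as a graded $R$-bimodule via the two projections to $V$. Let $\mathcal{B}_W$ be the full subcategory of graded $R$-bimodules generated by $\mathcal{O}(e,s)$ as an additive, monoidal (for $\otimes_R$, with unit $R$), Karoubian category stable by grading shifts: its objects form the smallest class containing $R$ and $\mathcal{O}(e,s)$ and closed under $\otimes_R$, finite direct sums, grading shifts, direct summands and isomorphism. Call $A\subseteq W$ cyclically connected if $A=\{s^i,s^{i+1},\dots,s^{i+j}\}$ for some $0\le i,j\le d-1$ (so $A\neq\emptyset$). Then: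 1. The indecomposable objects of $\mathcal{B}_W$ are, up to isomorphism and grading shift, exactly the $\mathcal{O}(A)$ with $A$ cyclically connected, and these are pairwise distinct: every $\mathcal{O}(A)$ with $A$ cyclically connected lies in $\mathcal{B}_W$; an object of $\mathcal{B}_W$ is indecomposable if and only if it is isomorphic to $\mathcal{O}(A)[n]$ for some cyclically connected $A$ and some $n\in\mathbb{Z}$; and $\mathcal{O}(A)[n]\cong\mathcal{O}(A')[n']$ with $A,A'$ cyclically connected implies $A=A'$ and $n=n'$. 2. The split Grothendieck ring $A_W$ of $\mathcal{B}_W$ (generated as an abelian group by the isomorphism classes $[M]$ of objects, with relations $[M\oplus N]=[M]+[N]$, product $[M][N]=[M\otimes_R N]$, and $\mathbb{Z}[v,v^{-1}]$-algebra structure $v\cdot[M]=[M[1]]$) is a free $\mathbb{Z}[v,v^{-1}]$-module of rank $d(d-1)+1$. -/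

import Mathlib

open CategoryTheory CategoryTheory.Limits
open scoped TensorProduct LaurentPolynomial

noncomputable section

namespace CyclicSoergel

/-! ### Criterion for internal gradings -/

section Gradings

variable {M : Type*} [AddCommGroup M] [Module ℂ M]

lemma isInternal_of_dec (gr : ℤ → Submodule ℂ M) (δ : M →ₗ[ℂ] (ℤ →₀ M))
    (h1 : ∀ i, ∀ m ∈ gr i, δ m = Finsupp.single i m) (h2 : ⨆ i, gr i = ⊤) :
    DirectSum.IsInternal gr := by
  rw [DirectSum.isInternal_submodule_iff_iSupIndep_and_iSup_eq_top]
  refine ⟨?_, h2⟩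
  rw [iSupIndep_def]
  intro i
  rw [Submodule.disjoint_def]
  intro x hx hx'
  have key : ∀ y ∈ ⨆ j, ⨆ (_ : j ≠ i), gr j, δ y i = 0 := by
    have : (⨆ j, ⨆ (_ : j ≠ i), gr j) ≤
        LinearMap.ker ((Finsupp.lapply i : (ℤ →₀ M) →ₗ[ℂ] M) ∘ₗ δ) := by
      refine iSup_le fun j => iSup_le fun hj => ?_
      intro y hy
      simp [h1 j y hy, hj]
    intro y hy
    exact this hy
  have := key x hx'
  rwa [h1 i x hx, Finsupp.single_eq_same] at this

lemma exists_dec (gr : ℤ → Submodule ℂ M) (h : DirectSum.IsInternal gr) :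
    ∃ δ : M →ₗ[ℂ] (ℤ →₀ M), ∀ i, ∀ m ∈ gr i, δ m = Finsupp.single i m := by
  classical
  let e := LinearEquiv.ofBijective (DirectSum.coeLinearMap gr) h
  refine ⟨(DirectSum.toModule ℂ ℤ (ℤ →₀ M)
    (fun i => (Finsupp.lsingle i : M →ₗ[ℂ] (ℤ →₀ M)) ∘ₗ (gr i).subtype)) ∘ₗ e.symm.toLinearMap, ?_⟩
  intro i m hm
  have : e.symm m = DirectSum.lof ℂ ℤ (fun i => gr i) i ⟨m, hm⟩ := by
    rw [LinearEquiv.symm_apply_eq]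
    exact (DirectSum.coeLinearMap_lof gr i ⟨m, hm⟩).symm
  simp [this]

lemma iSup_of_internal {gr : ℤ → Submodule ℂ M} (h : DirectSum.IsInternal gr) :
    ⨆ i, gr i = ⊤ :=
  h.submodule_iSup_eq_top

/-- To prove a linear property of all elements it suffices to treat homogeneous ones. -/
lemma hom_induction {gr : ℤ → Submodule ℂ M} (h : ⨆ i, gr i = ⊤) {P : M → Prop}
    (hz : P 0) (ha : ∀ x y, P x → P y → P (x + y)) (hh : ∀ i, ∀ m ∈ gr i, P m) (m : M) : P m :=
  Submodule.iSup_induction gr (motive := P) (h ▸ Submodule.mem_top : m ∈ ⨆ i, gr i) hh hz ha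

end Gradings

/-! ### The graded ring of regular functions on the line -/

/-- The ring of regular functions on `V = ℂ`. -/
abbrev R : Type := Polynomial ℂ

/-- The homogeneous component of `R` of degree `k`, where the coordinate function has degree `2`. -/
def Rgr (k : ℤ) : Submodule ℂ R where
  carrier := {p | ∀ n : ℕ, p.coeff n ≠ 0 → 2 * (n : ℤ) = k}
  zero_mem' := by simp
  add_mem' {p q} hp hq n hn := by
    by_cases h : p.coeff n = 0
    · exact hq n (by intro h2; simp [h, h2] at hn)
    · exact hp n h
  smul_mem' c p hp n hn := hp n (by intro h; simp [h] at hn)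

lemma monomial_mem_Rgr (n : ℕ) (c : ℂ) : Polynomial.monomial n c ∈ Rgr (2 * n) := by
  intro m hm
  rw [Polynomial.coeff_monomial] at hm
  by_cases h : n = m
  · rw [h]
  · simp [h] at hm

lemma one_mem_Rgr : (1 : R) ∈ Rgr 0 := by
  simpa using monomial_mem_Rgr 0 1

lemma mem_Rgr_eq {k : ℤ} {p : R} (hp : p ∈ Rgr k) (h0 : p ≠ 0) :
    ∃ (n : ℕ) (c : ℂ), 2 * (n : ℤ) = k ∧ p = Polynomial.monomial n c := by
  have hc : p.coeff p.natDegree ≠ 0 := by simpa using h0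
  refine ⟨p.natDegree, p.coeff p.natDegree, hp _ hc, ?_⟩
  ext m
  rw [Polynomial.coeff_monomial]
  split_ifs with h
  · rw [h]
  · by_contra hm
    have e1 := hp _ hc
    have e2 := hp m hm
    omega

lemma iSup_Rgr : ⨆ k, Rgr k = ⊤ := by
  rw [eq_top_iff]
  intro p _
  induction p using Polynomial.induction_on' with
  | add p q hp hq => exact Submodule.add_mem _ (hp trivial) (hq trivial)
  | monomial n c => exact Submodule.mem_iSup_of_mem _ (monomial_mem_Rgr n c)

lemma mul_mem_Rgr {k l : ℤ} {p q : R} (hp : p ∈ Rgr k) (hq : q ∈ Rgr l) : p * q ∈ Rgr (k + l) := by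
  by_cases hp0 : p = 0
  · simp [hp0]
  by_cases hq0 : q = 0
  · simp [hq0]
  obtain ⟨n, c, rfl, rfl⟩ := mem_Rgr_eq hp hp0
  obtain ⟨m, e, rfl, rfl⟩ := mem_Rgr_eq hq hq0
  rw [Polynomial.monomial_mul_monomial]
  have := monomial_mem_Rgr (n + m) (c * e)
  rwa [Nat.cast_add, mul_add] at this

lemma Rgr_internal : DirectSum.IsInternal Rgr := by
  refine isInternal_of_dec _
    (Polynomial.lsum (fun n => (Finsupp.lsingle (2 * (n : ℤ)) : R →ₗ[ℂ] (ℤ →₀ R)) ∘ₗ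
      Polynomial.monomial n)) ?_ iSup_Rgr
  intro i p hp
  by_cases h0 : p = 0
  · simp [h0]
  obtain ⟨n, c, rfl, rfl⟩ := mem_Rgr_eq hp h0
  simp [Polynomial.lsum_apply, Polynomial.sum_monomial_index]

/-! ### Graded bimodules -/

/-- A graded `R`-bimodule, on which `ℂ` acts in the same way from both sides. The right action is
given by an algebra homomorphism, which is the same as an anti-homomorphism since `R` is
commutative. -/
structure GrBimod where
  carrier : Type
  [grp : AddCommGroup carrier]
  [mod : Module ℂ carrier]
  /-- left action -/
  lact : R →ₐ[ℂ] Module.End ℂ carrier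
  /-- right action -/
  ract : R →ₐ[ℂ] Module.End ℂ carrier
  act_comm : ∀ p q m, lact p (ract q m) = ract q (lact p m)
  /-- homogeneous components -/
  gr : ℤ → Submodule ℂ carrier
  internal : DirectSum.IsInternal gr
  lact_mem : ∀ {k i p m}, p ∈ Rgr k → m ∈ gr i → lact p m ∈ gr (k + i)
  ract_mem : ∀ {k i p m}, p ∈ Rgr k → m ∈ gr i → ract p m ∈ gr (i + k)

attribute [instance] GrBimod.grp GrBimod.mod

namespace GrBimod

/-- Morphisms of graded bimodules: bimodule maps which are homogeneous of degree zero. -/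
@[ext]
structure Hom (M N : GrBimod) where
  lin : M.carrier →ₗ[ℂ] N.carrier
  map_lact : ∀ p m, lin (M.lact p m) = N.lact p (lin m)
  map_ract : ∀ p m, lin (M.ract p m) = N.ract p (lin m)
  map_gr : ∀ {i m}, m ∈ M.gr i → lin m ∈ N.gr i

instance : Category GrBimod where
  Hom := Hom
  id M := ⟨LinearMap.id, fun _ _ => rfl, fun _ _ => rfl, fun h => h⟩
  comp f g := ⟨g.lin ∘ₗ f.lin, fun p m => by simp [f.map_lact, g.map_lact],
    fun p m => by simp [f.map_ract, g.map_ract], fun h => g.map_gr (f.map_gr h)⟩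

@[ext]
lemma hom_ext {M N : GrBimod} {f g : M ⟶ N} (h : ∀ m, f.lin m = g.lin m) : f = g :=
  Hom.ext (LinearMap.ext h)

@[simp] lemma id_lin (M : GrBimod) (m : M.carrier) : Hom.lin (𝟙 M) m = m := rfl

@[simp] lemma comp_lin {M N P : GrBimod} (f : M ⟶ N) (g : N ⟶ P) (m : M.carrier) :
    (f ≫ g).lin m = g.lin (f.lin m) := rfl

variable {M N P Q : GrBimod}

instance : Zero (M ⟶ N) := ⟨⟨0, by simp, by simp, by simp⟩⟩

instance : Add (M ⟶ N) := ⟨fun f g => ⟨f.lin + g.lin, by simp [f.map_lact, g.map_lact],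
  by simp [f.map_ract, g.map_ract], fun h => add_mem (f.map_gr h) (g.map_gr h)⟩⟩

instance : Neg (M ⟶ N) := ⟨fun f => ⟨-f.lin, by simp [f.map_lact],
  by simp [f.map_ract], fun h => neg_mem (f.map_gr h)⟩⟩

@[simp] lemma zero_lin (m : M.carrier) : Hom.lin (0 : M ⟶ N) m = 0 := rfl
@[simp] lemma add_lin (f g : M ⟶ N) (m : M.carrier) : (f + g).lin m = f.lin m + g.lin m := rfl
@[simp] lemma neg_lin (f : M ⟶ N) (m : M.carrier) : (-f).lin m = -f.lin m := rfl

instance : AddCommGroup (M ⟶ N) where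
  __ := AddGroup.ofLeftAxioms (G := (M ⟶ N)) (fun f g h => by ext m; simp [add_assoc])
    (fun f => by ext m; simp) (fun f => by ext m; simp)
  add_comm f g := by ext m; simp [add_comm]

instance : Preadditive GrBimod where
  add_comp _ _ _ f g h := by ext m; simp
  comp_add _ _ _ f g h := by ext m; simp

/-- An isomorphism of graded bimodules from mutually inverse morphisms. -/
def isoOf (f : M ⟶ N) (g : N ⟶ M) (h1 : ∀ m, g.lin (f.lin m) = m)
    (h2 : ∀ n, f.lin (g.lin n) = n) : M ≅ N :=
  ⟨f, g, by ext m; simp [h1], by ext n; simp [h2]⟩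

/-! ### Zero object, direct sums, shifts, unit -/

/-- The zero bimodule. -/
def zeroObj : GrBimod where
  carrier := PUnit
  lact := Algebra.ofId ℂ _ |>.comp (Polynomial.aeval 0)
  ract := Algebra.ofId ℂ _ |>.comp (Polynomial.aeval 0)
  act_comm _ _ _ := rfl
  gr _ := ⊤
  internal := isInternal_of_dec _ 0 (fun i m _ => by
    rw [show m = 0 from Subsingleton.elim m 0, Finsupp.single_zero, map_zero]) (by simp)
  lact_mem _ _ := trivial
  ract_mem _ _ := trivial

/-- The direct sum of two graded bimodules. -/
def sum (M N : GrBimod) : GrBimod where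
  carrier := M.carrier × N.carrier
  lact := AlgHom.ofLinearMap
    { toFun := fun p => LinearMap.prodMap (M.lact p) (N.lact p)
      map_add' := fun p q => by ext <;> simp
      map_smul' := fun c p => by ext <;> simp }
    (by ext <;> simp) (fun p q => by ext <;> simp)
  ract := AlgHom.ofLinearMap
    { toFun := fun p => LinearMap.prodMap (M.ract p) (N.ract p)
      map_add' := fun p q => by ext <;> simp
      map_smul' := fun c p => by ext <;> simp }
    (by ext <;> simp) (fun p q => by ext <;> simp)
  act_comm p q m := by ext <;> simp [act_comm]
  gr i := (M.gr i).prod (N.gr i)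
  internal := by
    obtain ⟨δ, hδ⟩ := exists_dec M.gr M.internal
    obtain ⟨ε, hε⟩ := exists_dec N.gr N.internal
    refine isInternal_of_dec _
      ((Finsupp.mapRange.linearMap (LinearMap.inl ℂ M.carrier N.carrier) ∘ₗ δ).coprod
        (Finsupp.mapRange.linearMap (LinearMap.inr ℂ M.carrier N.carrier) ∘ₗ ε)) ?_ ?_
    · rintro i ⟨m, n⟩ ⟨hm, hn⟩
      simp only [LinearMap.coprod_apply, LinearMap.comp_apply]
      rw [hδ i m hm, hε i n hn]
      simp only [Finsupp.mapRange.linearMap_apply, Finsupp.mapRange_single]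
      rw [← Finsupp.single_add]
      simp
    · rw [eq_top_iff]
      rintro ⟨m, n⟩ -
      have e : ((m, n) : M.carrier × N.carrier) = (m, 0) + (0, n) := by simp
      rw [e]
      refine Submodule.add_mem _ ?_ ?_
      · refine hom_induction (iSup_of_internal M.internal)
          (P := fun m => ((m, 0) : M.carrier × N.carrier) ∈ _) ?_ ?_ ?_ m
        · exact Submodule.zero_mem _
        · intro x y hx hy
          simpa using Submodule.add_mem _ hx hy
        · intro i x hx
          exact Submodule.mem_iSup_of_mem i ⟨hx, Submodule.zero_mem _⟩
      · refine hom_induction (iSup_of_internal N.internal)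
          (P := fun n => ((0, n) : M.carrier × N.carrier) ∈ _) ?_ ?_ ?_ n
        · exact Submodule.zero_mem _
        · intro x y hx hy
          simpa using Submodule.add_mem _ hx hy
        · intro i x hx
          exact Submodule.mem_iSup_of_mem i ⟨Submodule.zero_mem _, hx⟩
  lact_mem hp hm := ⟨M.lact_mem hp hm.1, N.lact_mem hp hm.2⟩
  ract_mem hp hm := ⟨M.ract_mem hp hm.1, N.ract_mem hp hm.2⟩

/-- The grading shift `M[n]`, with `M[n]_i = M_{i+n}`. -/
def shift (n : ℤ) (M : GrBimod) : GrBimod where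
  carrier := M.carrier
  lact := M.lact
  ract := M.ract
  act_comm := M.act_comm
  gr i := M.gr (i + n)
  internal := by
    have h := M.internal
    rw [DirectSum.isInternal_submodule_iff_iSupIndep_and_iSup_eq_top] at h ⊢
    exact ⟨h.1.comp (add_left_injective n), by
      rw [← h.2]; exact (Equiv.addRight n).iSup_comp (g := M.gr)⟩
  lact_mem {k i p m} hp hm := by rw [add_assoc]; exact M.lact_mem hp hm
  ract_mem {k i p m} hp hm := by
    rw [add_assoc, add_comm k n, ← add_assoc]; exact M.ract_mem hp hm

/-- The monoidal unit: `R` as a bimodule over itself. -/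
def unit : GrBimod where
  carrier := R
  lact := Algebra.lmul ℂ R
  ract := Algebra.lmul ℂ R
  act_comm p q m := by simp [mul_left_comm]
  gr := Rgr
  internal := Rgr_internal
  lact_mem hp hm := mul_mem_Rgr hp hm
  ract_mem {k i p m} hp hm := by rw [add_comm]; exact mul_mem_Rgr hp hm

/-! ### Tensor product over `R` -/

/-- The relations `m·p ⊗ n = m ⊗ p·n`. -/
def tensRel (M N : GrBimod) : Submodule ℂ (M.carrier ⊗[ℂ] N.carrier) :=
  Submodule.span ℂ {z | ∃ m p n, z = (M.ract p m) ⊗ₜ[ℂ] n - m ⊗ₜ[ℂ] (N.lact p n)}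

/-- The underlying vector space of `M ⊗_R N`: the quotient of `M ⊗_ℂ N` by the relations
`m·p ⊗ n = m ⊗ p·n`. -/
abbrev TensCar (M N : GrBimod) : Type := (M.carrier ⊗[ℂ] N.carrier) ⧸ tensRel M N

/-- The bilinear map `(m, n) ↦ m ⊗ n`. -/
def tmk (M N : GrBimod) : M.carrier →ₗ[ℂ] N.carrier →ₗ[ℂ] TensCar M N :=
  (TensorProduct.mk ℂ M.carrier N.carrier).compr₂ (tensRel M N).mkQ

lemma tmk_bal (M N : GrBimod) (p : R) (m : M.carrier) (n : N.carrier) :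
    tmk M N (M.ract p m) n = tmk M N m (N.lact p n) := by
  refine (Submodule.Quotient.eq _).2 (Submodule.subset_span ⟨m, p, n, rfl⟩)

/-- Linear maps out of `M ⊗_R N` from balanced bilinear maps. -/
def tlift {S : Type*} [AddCommGroup S] [Module ℂ S] (f : M.carrier →ₗ[ℂ] N.carrier →ₗ[ℂ] S)
    (hf : ∀ p m n, f (M.ract p m) n = f m (N.lact p n)) : TensCar M N →ₗ[ℂ] S :=
  (tensRel M N).liftQ (TensorProduct.lift f) (by
    rw [tensRel, Submodule.span_le]
    rintro _ ⟨m, p, n, rfl⟩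
    simp [hf])

@[simp] lemma tlift_tmk {S : Type*} [AddCommGroup S] [Module ℂ S]
    (f : M.carrier →ₗ[ℂ] N.carrier →ₗ[ℂ] S)
    (hf : ∀ p m n, f (M.ract p m) n = f m (N.lact p n)) (m : M.carrier) (n : N.carrier) :
    tlift f hf (tmk M N m n) = f m n := by
  simp [tlift, tmk]

lemma tind {P : TensCar M N → Prop} (hz : P 0) (ha : ∀ x y, P x → P y → P (x + y))
    (ht : ∀ m n, P (tmk M N m n)) (z : TensCar M N) : P z := by
  induction z using Submodule.Quotient.induction_on with
  | H z =>
    induction z using TensorProduct.induction_on with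
    | zero => exact hz
    | tmul m n => exact ht m n
    | add x y hx hy => exact ha _ _ hx hy

lemma text {S : Type*} [AddCommGroup S] [Module ℂ S] {f g : TensCar M N →ₗ[ℂ] S}
    (h : ∀ m n, f (tmk M N m n) = g (tmk M N m n)) (z : TensCar M N) : f z = g z := by
  induction z using tind with
  | hz => simp
  | ha x y hx hy => simp [hx, hy]
  | ht m n => exact h m n

/-- The degree `k` part of `M ⊗_R N`, spanned by the `m ⊗ n` with `m`, `n` homogeneous of degrees
adding up to `k`. -/
def tgr (M N : GrBimod) (k : ℤ) : Submodule ℂ (TensCar M N) :=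
  Submodule.span ℂ {z | ∃ i j m n, i + j = k ∧ m ∈ M.gr i ∧ n ∈ N.gr j ∧ z = tmk M N m n}

lemma tmk_mem {i j k : ℤ} {m : M.carrier} {n : N.carrier} (hm : m ∈ M.gr i) (hn : n ∈ N.gr j)
    (h : i + j = k) : tmk M N m n ∈ tgr M N k :=
  Submodule.subset_span ⟨i, j, m, n, h, hm, hn, rfl⟩

lemma tgr_map {S : Type*} [AddCommGroup S] [Module ℂ S] (f : TensCar M N →ₗ[ℂ] S)
    (U : Submodule ℂ S) {k : ℤ}
    (h : ∀ i j m n, i + j = k → m ∈ M.gr i → n ∈ N.gr j → f (tmk M N m n) ∈ U)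
    {z : TensCar M N} (hz : z ∈ tgr M N k) : f z ∈ U := by
  have : tgr M N k ≤ U.comap f := by
    rw [tgr, Submodule.span_le]
    rintro _ ⟨i, j, m, n, e, hm, hn, rfl⟩
    exact h i j m n e hm hn
  exact this hz

lemma iSup_tgr (M N : GrBimod) : ⨆ k, tgr M N k = ⊤ := by
  rw [eq_top_iff]
  intro z _
  induction z using tind with
  | hz => exact Submodule.zero_mem _
  | ha x y hx hy => exact Submodule.add_mem _ (hx trivial) (hy trivial)
  | ht m n =>
    induction m using hom_induction (iSup_of_internal M.internal) with
    | hz => simp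
    | ha x y hx hy => simpa using Submodule.add_mem _ (hx trivial) (hy trivial)
    | hh i m hm =>
      induction n using hom_induction (iSup_of_internal N.internal) with
      | hz => simp
      | ha x y hx hy => simpa using Submodule.add_mem _ (hx trivial) (hy trivial)
      | hh j n hn => exact Submodule.mem_iSup_of_mem (i + j) (tmk_mem hm hn rfl)

lemma tgr_internal (M N : GrBimod) : DirectSum.IsInternal (tgr M N) := by
  obtain ⟨δ, hδ⟩ := exists_dec M.gr M.internal
  obtain ⟨ε, hε⟩ := exists_dec N.gr N.internal
  let b : ℤ → ℤ → M.carrier →ₗ[ℂ] N.carrier →ₗ[ℂ] (ℤ →₀ TensCar M N) := fun i j =>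
    (tmk M N).compr₂ (Finsupp.lsingle (i + j))
  let B : (ℤ →₀ M.carrier) →ₗ[ℂ] (ℤ →₀ N.carrier) →ₗ[ℂ] (ℤ →₀ TensCar M N) :=
    Finsupp.lsum ℂ (fun i => LinearMap.flip (Finsupp.lsum ℂ (fun j => LinearMap.flip (b i j))))
  let f : M.carrier →ₗ[ℂ] N.carrier →ₗ[ℂ] (ℤ →₀ TensCar M N) := B.compl₁₂ δ ε
  have hf : ∀ i j m n, m ∈ M.gr i → n ∈ N.gr j →
      f m n = Finsupp.single (i + j) (tmk M N m n) := by
    intro i j m n hm hn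
    simp [f, B, b, hδ i m hm, hε j n hn]
  have hbal : ∀ p m n, f (M.ract p m) n = f m (N.lact p n) := by
    intro p m n
    induction m using hom_induction (iSup_of_internal M.internal) with
    | hz => simp
    | ha x y hx hy => simp [hx, hy]
    | hh i m hm =>
      induction n using hom_induction (iSup_of_internal N.internal) with
      | hz => simp
      | ha x y hx hy => simp [hx, hy]
      | hh j n hn =>
        induction p using hom_induction iSup_Rgr with
        | hz => simp
        | ha x y hx hy => simp [hx, hy]
        | hh k p hp =>
          rw [hf _ _ _ _ (M.ract_mem hp hm) hn, hf _ _ _ _ hm (N.lact_mem hp hn), tmk_bal,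
            add_assoc]
  refine isInternal_of_dec _ (tlift f hbal) ?_ (iSup_tgr M N)
  intro k z hz
  have : z ∈ LinearMap.eqLocus (tlift f hbal) (Finsupp.lsingle k) := by
    refine (?_ : tgr M N k ≤ _) hz
    rw [tgr, Submodule.span_le]
    rintro _ ⟨i, j, m, n, rfl, hm, hn, rfl⟩
    simp [hf i j m n hm hn]
  exact this

/-- The linear map `m ⊗ n ↦ f m ⊗ g n`. -/
def tmapLin {M M' N N' : GrBimod} (f : M.carrier →ₗ[ℂ] M'.carrier) (g : N.carrier →ₗ[ℂ] N'.carrier)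
    (hf : ∀ p m, f (M.ract p m) = M'.ract p (f m))
    (hg : ∀ p n, g (N.lact p n) = N'.lact p (g n)) : TensCar M N →ₗ[ℂ] TensCar M' N' :=
  tlift ((tmk M' N').compl₁₂ f g) (fun p m n => by simp [hf, hg, tmk_bal])

@[simp] lemma tmapLin_tmk {M M' N N' : GrBimod} (f : M.carrier →ₗ[ℂ] M'.carrier)
    (g : N.carrier →ₗ[ℂ] N'.carrier) (hf : ∀ p m, f (M.ract p m) = M'.ract p (f m))
    (hg : ∀ p n, g (N.lact p n) = N'.lact p (g n)) (m : M.carrier) (n : N.carrier) :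
    tmapLin f g hf hg (tmk M N m n) = tmk M' N' (f m) (g n) := by
  simp [tmapLin]

/-- The tensor product `M ⊗_R N` of graded bimodules. -/
def tens (M N : GrBimod) : GrBimod where
  carrier := TensCar M N
  lact := AlgHom.ofLinearMap
    { toFun := fun p => tmapLin (M.lact p) LinearMap.id (fun q m => M.act_comm p q m)
        (fun _ _ => rfl)
      map_add' := fun p q => LinearMap.ext (text fun m n => by simp)
      map_smul' := fun c p => LinearMap.ext (text fun m n => by simp) }
    (LinearMap.ext (text fun m n => by simp)) (fun p q => LinearMap.ext (text fun m n => by simp))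
  ract := AlgHom.ofLinearMap
    { toFun := fun p => tmapLin LinearMap.id (N.ract p) (fun _ _ => rfl)
        (fun q n => (N.act_comm q p n).symm)
      map_add' := fun p q => LinearMap.ext (text fun m n => by simp)
      map_smul' := fun c p => LinearMap.ext (text fun m n => by simp) }
    (LinearMap.ext (text fun m n => by simp)) (fun p q => LinearMap.ext (text fun m n => by simp))
  act_comm p q z := by
    induction z using tind with
    | hz => simp
    | ha x y hx hy => simp only [map_add, hx, hy]
    | ht m n => simp
  gr := tgr M N
  internal := tgr_internal M N
  lact_mem {k i p z} hp hz := by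
    refine tgr_map _ _ (fun a b m n e hm hn => ?_) hz
    simpa using tmk_mem (M.lact_mem hp hm) hn (by omega)
  ract_mem {k i p z} hp hz := by
    refine tgr_map _ _ (fun a b m n e hm hn => ?_) hz
    simpa using tmk_mem hm (N.ract_mem hp hn) (by omega)

/-- The bilinear map `(m, n) ↦ m ⊗ n`, with values in the bimodule `M ⊗_R N`. -/
def tp (M N : GrBimod) : M.carrier →ₗ[ℂ] N.carrier →ₗ[ℂ] (tens M N).carrier := tmk M N

lemma tp_bal (p : R) (m : M.carrier) (n : N.carrier) :
    tp M N (M.ract p m) n = tp M N m (N.lact p n) := tmk_bal M N p m n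

lemma tp_lact (p : R) (m : M.carrier) (n : N.carrier) :
    (tens M N).lact p (tp M N m n) = tp M N (M.lact p m) n :=
  tmapLin_tmk (M.lact p) LinearMap.id (fun q m => M.act_comm p q m) (fun _ _ => rfl) m n

lemma tp_ract (p : R) (m : M.carrier) (n : N.carrier) :
    (tens M N).ract p (tp M N m n) = tp M N m (N.ract p n) :=
  tmapLin_tmk LinearMap.id (N.ract p) (fun _ _ => rfl) (fun q n => (N.act_comm q p n).symm) m n

lemma tp_mem {i j k : ℤ} {m : M.carrier} {n : N.carrier} (hm : m ∈ M.gr i) (hn : n ∈ N.gr j)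
    (h : i + j = k) : tp M N m n ∈ (tens M N).gr k := tmk_mem hm hn h

lemma tp_ind {P : (tens M N).carrier → Prop} (hz : P 0)
    (ha : ∀ x y, P x → P y → P (x + y)) (ht : ∀ m n, P (tp M N m n))
    (z : (tens M N).carrier) : P z := tind (P := P) hz ha ht z

lemma tp_ext {S : Type*} [AddCommGroup S] [Module ℂ S] {f g : (tens M N).carrier →ₗ[ℂ] S}
    (h : ∀ m n, f (tp M N m n) = g (tp M N m n)) : f = g :=
  LinearMap.ext (text (M := M) (N := N) h)

lemma tp_map_gr {S : Type*} [AddCommGroup S] [Module ℂ S] (f : (tens M N).carrier →ₗ[ℂ] S)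
    (U : Submodule ℂ S) {k : ℤ}
    (h : ∀ i j m n, i + j = k → m ∈ M.gr i → n ∈ N.gr j → f (tp M N m n) ∈ U)
    {z : (tens M N).carrier} (hz : z ∈ (tens M N).gr k) : f z ∈ U :=
  tgr_map (M := M) (N := N) f U h hz

/-- Linear maps out of `M ⊗_R N` from balanced bilinear maps. -/
def tl {S : Type*} [AddCommGroup S] [Module ℂ S] (f : M.carrier →ₗ[ℂ] N.carrier →ₗ[ℂ] S)
    (hf : ∀ p m n, f (M.ract p m) n = f m (N.lact p n)) : (tens M N).carrier →ₗ[ℂ] S :=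
  tlift f hf

@[simp] lemma tl_tp {S : Type*} [AddCommGroup S] [Module ℂ S]
    (f : M.carrier →ₗ[ℂ] N.carrier →ₗ[ℂ] S)
    (hf : ∀ p m n, f (M.ract p m) n = f m (N.lact p n)) (m : M.carrier) (n : N.carrier) :
    tl f hf (tp M N m n) = f m n := tlift_tmk f hf m n

/-- Morphisms out of a tensor product. -/
def tensDesc (f : M.carrier →ₗ[ℂ] N.carrier →ₗ[ℂ] P.carrier)
    (hb : ∀ p m n, f (M.ract p m) n = f m (N.lact p n))
    (hl : ∀ p m n, f (M.lact p m) n = P.lact p (f m n))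
    (hr : ∀ p m n, f m (N.ract p n) = P.ract p (f m n))
    (hg : ∀ i j m n, m ∈ M.gr i → n ∈ N.gr j → f m n ∈ P.gr (i + j)) : tens M N ⟶ P where
  lin := tl f hb
  map_lact p z := by
    induction z using tp_ind with
    | hz => simp
    | ha x y hx hy => simp only [map_add, hx, hy]
    | ht a b => simp [tp_lact, hl]
  map_ract p z := by
    induction z using tp_ind with
    | hz => simp
    | ha x y hx hy => simp only [map_add, hx, hy]
    | ht a b => simp [tp_ract, hr]
  map_gr hz := tp_map_gr _ _ (fun i j m n e hm hn => by
    rw [tl_tp, ← e]; exact hg i j m n hm hn) hz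

@[simp] lemma tensDesc_tp (f : M.carrier →ₗ[ℂ] N.carrier →ₗ[ℂ] P.carrier) (hb hl hr hg)
    (m : M.carrier) (n : N.carrier) :
    (tensDesc f hb hl hr hg).lin (tp M N m n) = f m n :=
  tl_tp f hb m n

lemma tens_hom_ext {f g : tens M N ⟶ P}
    (h : ∀ m n, f.lin (tp M N m n) = g.lin (tp M N m n)) : f = g :=
  Hom.ext (tp_ext h)

/-- Functoriality of the tensor product. -/
def tensMap {M M' N N' : GrBimod} (f : M ⟶ M') (g : N ⟶ N') : tens M N ⟶ tens M' N' :=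
  tensDesc ((tp M' N').compl₁₂ f.lin g.lin)
    (fun p m n => by simp [f.map_ract, g.map_lact, tp_bal])
    (fun p m n => by simp [f.map_lact, tp_lact])
    (fun p m n => by simp [g.map_ract, tp_ract])
    (fun i j m n hm hn => tp_mem (f.map_gr hm) (g.map_gr hn) rfl)

@[simp] lemma tensMap_tp {M M' N N' : GrBimod} (f : M ⟶ M') (g : N ⟶ N') (m : M.carrier)
    (n : N.carrier) : (tensMap f g).lin (tp M N m n) = tp M' N' (f.lin m) (g.lin n) :=
  tensDesc_tp _ _ _ _ _ m n

/-- Isomorphic factors have isomorphic tensor products. -/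
def tensIso {M M' N N' : GrBimod} (e : M ≅ M') (e' : N ≅ N') : tens M N ≅ tens M' N' where
  hom := tensMap e.hom e'.hom
  inv := tensMap e.inv e'.inv
  hom_inv_id := tens_hom_ext fun m n => by
    simp only [comp_lin, tensMap_tp, id_lin]
    simp only [← comp_lin, Iso.hom_inv_id, id_lin]
  inv_hom_id := tens_hom_ext fun m n => by
    simp only [comp_lin, tensMap_tp, id_lin]
    simp only [← comp_lin, Iso.inv_hom_id, id_lin]

/-- The bilinear map `((m ⊗ n), x) ↦ m ⊗ (n ⊗ x)`. -/
def assocLin (M N P : GrBimod) :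
    (tens M N).carrier →ₗ[ℂ] P.carrier →ₗ[ℂ] (tens M (tens N P)).carrier :=
  tl (LinearMap.mk₂ ℂ (fun m n => (tp M (tens N P) m) ∘ₗ (tp N P n))
      (fun a b c => by ext x; simp) (fun a b c => by ext x; simp)
      (fun a b c => by ext x; simp) (fun a b c => by ext x; simp))
    (fun p m n => by ext x; simp [tp_bal, tp_lact])

@[simp] lemma assocLin_tp (m : M.carrier) (n : N.carrier) (x : P.carrier) :
    assocLin M N P (tp M N m n) x = tp M (tens N P) m (tp N P n x) := by
  simp [assocLin]

/-- The bilinear map `(m, (n ⊗ x)) ↦ (m ⊗ n) ⊗ x`. -/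
def assocInvLin (M N P : GrBimod) :
    M.carrier →ₗ[ℂ] (tens N P).carrier →ₗ[ℂ] (tens (tens M N) P).carrier :=
  LinearMap.flip (tl (LinearMap.mk₂ ℂ
      (fun n x => ((tp (tens M N) P).flip x) ∘ₗ ((tp M N).flip n))
      (fun a b c => by ext x; simp) (fun a b c => by ext x; simp)
      (fun a b c => by ext x; simp) (fun a b c => by ext x; simp))
    (fun p m n => by ext x; simp [← tp_bal, tp_ract]))

@[simp] lemma assocInvLin_tp (m : M.carrier) (n : N.carrier) (x : P.carrier) :
    assocInvLin M N P m (tp N P n x) = tp (tens M N) P (tp M N m n) x := by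
  simp [assocInvLin]

/-- Associativity of the tensor product. -/
def assoc (M N P : GrBimod) : tens (tens M N) P ≅ tens M (tens N P) where
  hom := tensDesc (assocLin M N P)
    (fun p z n => by
      induction z using tp_ind with
      | hz => simp
      | ha x y hx hy => simp only [map_add, LinearMap.add_apply, hx, hy]
      | ht a b => simp [tp_bal, tp_ract])
    (fun p z n => by
      induction z using tp_ind with
      | hz => simp
      | ha x y hx hy => simp only [map_add, LinearMap.add_apply, hx, hy]
      | ht a b => simp [tp_lact])
    (fun p z n => by
      induction z using tp_ind with
      | hz => simp
      | ha x y hx hy => simp only [map_add, LinearMap.add_apply, hx, hy]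
      | ht a b => simp [tp_ract])
    (fun i j z n hz hn => by
      refine tp_map_gr ((assocLin M N P).flip n) ((tens M (tens N P)).gr (i + j))
        (fun a b x y e hx hy => ?_) hz
      rw [LinearMap.flip_apply, assocLin_tp]
      exact tp_mem hx (tp_mem hy hn rfl) (by omega))
  inv := tensDesc (assocInvLin M N P)
    (fun p n z => by
      induction z using tp_ind with
      | hz => simp
      | ha x y hx hy => simp only [map_add, hx, hy]
      | ht a b => simp [tp_bal, tp_lact])
    (fun p n z => by
      induction z using tp_ind with
      | hz => simp
      | ha x y hx hy => simp only [map_add, hx, hy]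
      | ht a b => simp [tp_lact])
    (fun p n z => by
      induction z using tp_ind with
      | hz => simp
      | ha x y hx hy => simp only [map_add, hx, hy]
      | ht a b => simp [tp_ract])
    (fun i j n z hn hz => by
      refine tp_map_gr (assocInvLin M N P n) ((tens (tens M N) P).gr (i + j))
        (fun a b x y e hx hy => ?_) hz
      rw [assocInvLin_tp]
      exact tp_mem (tp_mem hn hx rfl) hy (by omega))
  hom_inv_id := by
    refine tens_hom_ext fun z p => ?_
    induction z using tp_ind with
    | hz => simp
    | ha x y hx hy => simp only [map_add, LinearMap.add_apply, hx, hy]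
    | ht a b => rfl
  inv_hom_id := by
    refine tens_hom_ext fun m z => ?_
    induction z using tp_ind with
    | hz => simp
    | ha x y hx hy => simp only [map_add, hx, hy]
    | ht a b => rfl

/-! ### Direct sums, shifts and tensor products -/

/-- Inclusions and projections of a direct sum. -/
def inl (M N : GrBimod) : M ⟶ sum M N :=
  ⟨LinearMap.inl ℂ M.carrier N.carrier, fun p _ => Prod.ext rfl (map_zero (N.lact p)).symm,
    fun p _ => Prod.ext rfl (map_zero (N.ract p)).symm, fun h => ⟨h, Submodule.zero_mem _⟩⟩

/-- The second inclusion. -/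
def inr (M N : GrBimod) : N ⟶ sum M N :=
  ⟨LinearMap.inr ℂ M.carrier N.carrier, fun p _ => Prod.ext (map_zero (M.lact p)).symm rfl,
    fun p _ => Prod.ext (map_zero (M.ract p)).symm rfl, fun h => ⟨Submodule.zero_mem _, h⟩⟩

/-- The first projection. -/
def fst (M N : GrBimod) : sum M N ⟶ M :=
  ⟨LinearMap.fst ℂ M.carrier N.carrier, fun _ _ => rfl, fun _ _ => rfl, fun h => h.1⟩

/-- The second projection. -/
def snd (M N : GrBimod) : sum M N ⟶ N :=
  ⟨LinearMap.snd ℂ M.carrier N.carrier, fun _ _ => rfl, fun _ _ => rfl, fun h => h.2⟩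

lemma inl_fst (M N : GrBimod) : inl M N ≫ fst M N = 𝟙 M := rfl
lemma inr_snd (M N : GrBimod) : inr M N ≫ snd M N = 𝟙 N := rfl
lemma inl_snd (M N : GrBimod) : inl M N ≫ snd M N = 0 := rfl
lemma inr_fst (M N : GrBimod) : inr M N ≫ fst M N = 0 := rfl

lemma sum_total (M N : GrBimod) : fst M N ≫ inl M N + snd M N ≫ inr M N = 𝟙 (sum M N) := by
  ext z
  exact Prod.ext (add_zero z.1) (zero_add z.2)

/-- An object with the inclusions and projections of a direct sum is isomorphic to it. -/
def isoSum {X : GrBimod} (i : M ⟶ X) (j : N ⟶ X) (p : X ⟶ M) (q : X ⟶ N)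
    (h1 : i ≫ p = 𝟙 M) (h2 : i ≫ q = 0) (h3 : j ≫ p = 0) (h4 : j ≫ q = 𝟙 N)
    (h5 : p ≫ i + q ≫ j = 𝟙 X) : X ≅ sum M N where
  hom := p ≫ inl M N + q ≫ inr M N
  inv := fst M N ≫ i + snd M N ≫ j
  hom_inv_id := by
    simp [reassoc_of% inl_fst, reassoc_of% inl_snd, reassoc_of% inr_fst, reassoc_of% inr_snd, h5]
  inv_hom_id := by
    simp only [Preadditive.add_comp, Preadditive.comp_add, Category.assoc, reassoc_of% h1,
      reassoc_of% h2, reassoc_of% h3, reassoc_of% h4]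
    simp [sum_total]

/-- Isomorphic summands have isomorphic direct sums. -/
def sumIso {M M' N N' : GrBimod} (e : M ≅ M') (e' : N ≅ N') : sum M N ≅ sum M' N' :=
  isoSum (e.inv ≫ inl M N) (e'.inv ≫ inr M N) (fst M N ≫ e.hom) (snd M N ≫ e'.hom)
    (by simp [reassoc_of% inl_fst]) (by simp [reassoc_of% inl_snd])
    (by simp [reassoc_of% inr_fst]) (by simp [reassoc_of% inr_snd]) (by simp [sum_total])

lemma tensMap_comp {M M' M'' N N' N'' : GrBimod} (f : M ⟶ M') (f' : M' ⟶ M'') (g : N ⟶ N')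
    (g' : N' ⟶ N'') : tensMap f g ≫ tensMap f' g' = tensMap (f ≫ f') (g ≫ g') :=
  tens_hom_ext fun _ _ => rfl

lemma tensMap_id (M N : GrBimod) : tensMap (𝟙 M) (𝟙 N) = 𝟙 (tens M N) :=
  tens_hom_ext fun _ _ => rfl

lemma tensMap_zero {M M' N N' : GrBimod} (f : M ⟶ M') : tensMap f (0 : N ⟶ N') = 0 :=
  tens_hom_ext fun m _ => map_zero (tp M' N' (f.lin m))

lemma zero_tensMap {M M' N N' : GrBimod} (g : N ⟶ N') : tensMap (0 : M ⟶ M') g = 0 :=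
  tens_hom_ext fun _ n => LinearMap.map_zero₂ (tp M' N') (g.lin n)

lemma tensMap_add {M M' N N' : GrBimod} (f : M ⟶ M') (g h : N ⟶ N') :
    tensMap f (g + h) = tensMap f g + tensMap f h :=
  tens_hom_ext fun m n => map_add (tp M' N' (f.lin m)) (g.lin n) (h.lin n)

lemma add_tensMap {M M' N N' : GrBimod} (f g : M ⟶ M') (h : N ⟶ N') :
    tensMap (f + g) h = tensMap f h + tensMap g h :=
  tens_hom_ext fun m n => LinearMap.map_add₂ (tp M' N') (f.lin m) (g.lin m) (h.lin n)

/-- Left distributivity. -/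
def tensSum (M N P : GrBimod) : tens M (sum N P) ≅ sum (tens M N) (tens M P) :=
  isoSum (tensMap (𝟙 M) (inl N P)) (tensMap (𝟙 M) (inr N P)) (tensMap (𝟙 M) (fst N P))
    (tensMap (𝟙 M) (snd N P)) (by simp [tensMap_comp, tensMap_id, inl_fst])
    (by simp [tensMap_comp, tensMap_zero, inl_snd])
    (by simp [tensMap_comp, tensMap_zero, inr_fst])
    (by simp [tensMap_comp, tensMap_id, inr_snd])
    (by simp only [tensMap_comp, ← tensMap_add, Category.comp_id, sum_total, tensMap_id])

/-- Right distributivity. -/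
def sumTens (M N P : GrBimod) : tens (sum M N) P ≅ sum (tens M P) (tens N P) :=
  isoSum (tensMap (inl M N) (𝟙 P)) (tensMap (inr M N) (𝟙 P)) (tensMap (fst M N) (𝟙 P))
    (tensMap (snd M N) (𝟙 P)) (by simp [tensMap_comp, tensMap_id, inl_fst])
    (by simp [tensMap_comp, zero_tensMap, inl_snd])
    (by simp [tensMap_comp, zero_tensMap, inr_fst])
    (by simp [tensMap_comp, tensMap_id, inr_snd])
    (by simp only [tensMap_comp, ← add_tensMap, Category.comp_id, sum_total, tensMap_id])

/-- `M[a][b] ≅ M[b + a]`. -/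
def shiftShift (a b : ℤ) (M : GrBimod) : shift b (shift a M) ≅ shift (b + a) M :=
  isoOf ⟨(LinearMap.id : M.carrier →ₗ[ℂ] M.carrier), fun _ _ => rfl, fun _ _ => rfl,
      fun {i m} (h : m ∈ M.gr (i + b + a)) =>
        show m ∈ M.gr (i + (b + a)) by rwa [← add_assoc]⟩
    ⟨(LinearMap.id : M.carrier →ₗ[ℂ] M.carrier), fun _ _ => rfl, fun _ _ => rfl,
      fun {i m} (h : m ∈ M.gr (i + (b + a))) =>
        show m ∈ M.gr (i + b + a) by rwa [add_assoc]⟩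
    (fun _ => rfl) (fun _ => rfl)

/-- `M[0] ≅ M`. -/
def shiftZero (M : GrBimod) : shift 0 M ≅ M :=
  isoOf ⟨(LinearMap.id : M.carrier →ₗ[ℂ] M.carrier), fun _ _ => rfl, fun _ _ => rfl,
      fun {i m} (h : m ∈ M.gr (i + 0)) => show m ∈ M.gr i by rwa [add_zero] at h⟩
    ⟨(LinearMap.id : M.carrier →ₗ[ℂ] M.carrier), fun _ _ => rfl, fun _ _ => rfl,
      fun {i m} (h : m ∈ M.gr i) => show m ∈ M.gr (i + 0) by rwa [add_zero]⟩
    (fun _ => rfl) (fun _ => rfl)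

/-- `R[k] ⊗_R M ≅ M[k]`. -/
def unitTens (k : ℤ) (M : GrBimod) : tens (shift k unit) M ≅ shift k M where
  hom := tensDesc (M := shift k unit) (P := shift k M) M.lact.toLinearMap
    (fun p (m : R) n => by
      change M.lact (p * m) n = M.lact m (M.lact p n)
      rw [mul_comm, map_mul]; rfl)
    (fun p (m : R) n => by
      change M.lact (p * m) n = M.lact p (M.lact m n)
      rw [map_mul]; rfl)
    (fun p m n => M.act_comm m p n)
    (fun i j m n hm hn => by
      have := M.lact_mem (k := i + k) hm hn
      change M.lact m n ∈ M.gr (i + j + k)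
      rwa [show i + j + k = i + k + j by ring])
  inv :=
    { lin := tp (shift k unit) M (1 : R)
      map_lact := fun p m => by
        refine (tp_bal (M := shift k unit) (N := M) p (1 : R) m).symm.trans ?_
        refine Eq.trans ?_ (tp_lact (M := shift k unit) (N := M) p (1 : R) m).symm
        rfl
      map_ract := fun p m => (tp_ract (M := shift k unit) (N := M) p (1 : R) m).symm
      map_gr := fun {i m} hm => tp_mem (M := shift k unit) (i := -k) (j := i + k)
        (show (1 : R) ∈ Rgr (-k + k) by rw [neg_add_cancel]; exact one_mem_Rgr) hm (by omega) }
  hom_inv_id := tens_hom_ext fun p m => by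
    refine (tp_bal (M := shift k unit) (N := M) p (1 : R) m).symm.trans ?_
    exact congrArg (fun q => tp (shift k unit) M q m) (@mul_one R _ p)
  inv_hom_id := by
    ext m
    change M.lact 1 m = m
    rw [map_one]; rfl

/-- `M ⊗_R R[k] ≅ M[k]`. -/
def tensUnit (k : ℤ) (M : GrBimod) : tens M (shift k unit) ≅ shift k M where
  hom := tensDesc (N := shift k unit) (P := shift k M) M.ract.toLinearMap.flip
    (fun p m (n : R) => by
      change M.ract n (M.ract p m) = M.ract (p * n) m
      rw [mul_comm, map_mul]; rfl)
    (fun p m n => (M.act_comm p n m).symm)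
    (fun p m (n : R) => by
      change M.ract (p * n) m = M.ract p (M.ract n m)
      rw [map_mul]; rfl)
    (fun i j m n hm hn => by
      have := M.ract_mem (k := j + k) hn hm
      change M.ract n m ∈ M.gr (i + j + k)
      rwa [add_assoc])
  inv :=
    { lin := (tp M (shift k unit)).flip (1 : R)
      map_lact := fun p m => (tp_lact (N := shift k unit) (M := M) p m (1 : R)).symm
      map_ract := fun p m => by
        refine (tp_bal (N := shift k unit) (M := M) p m (1 : R)).trans ?_
        refine Eq.trans ?_ (tp_ract (N := shift k unit) (M := M) p m (1 : R)).symm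
        rfl
      map_gr := fun {i m} hm => tp_mem (N := shift k unit) (i := i + k) (j := -k) hm
        (show (1 : R) ∈ Rgr (-k + k) by rw [neg_add_cancel]; exact one_mem_Rgr) (by omega) }
  hom_inv_id := tens_hom_ext fun m p => by
    refine (tp_bal (M := M) (N := shift k unit) p m (1 : R)).trans ?_
    exact congrArg (fun q => tp M (shift k unit) m q) (@mul_one R _ p)
  inv_hom_id := by
    ext m
    change M.ract 1 m = m
    rw [map_one]; rfl

end GrBimod

/-! ### Regular functions on unions of reversed graphs -/

/-- The reversed graph `{(x v, v)}` of a linear automorphism `x` of the line. -/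
def graph (x : ℂ ≃ₗ[ℂ] ℂ) : Set (Fin 2 → ℂ) := Set.range fun v : ℂ => ![x v, v]

/-- The union of the reversed graphs of the elements of `A`. -/
def graphs (A : Set (ℂ ≃ₗ[ℂ] ℂ)) : Set (Fin 2 → ℂ) := ⋃ x ∈ A, graph x

/-- The ideal of polynomial functions on the plane vanishing on the reversed graphs. -/
abbrev graphIdeal (A : Set (ℂ ≃ₗ[ℂ] ℂ)) : Ideal (MvPolynomial (Fin 2) ℂ) :=
  MvPolynomial.vanishingIdeal ℂ (graphs A)

/-- The ring of regular functions on the union of the reversed graphs. -/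
abbrev ORing (A : Set (ℂ ≃ₗ[ℂ] ℂ)) : Type := MvPolynomial (Fin 2) ℂ ⧸ graphIdeal A

/-- Polynomials in two variables of degree `k`, where both variables have degree `2`. -/
abbrev homog (k : ℤ) : Submodule ℂ (MvPolynomial (Fin 2) ℂ) :=
  MvPolynomial.weightedHomogeneousSubmodule ℂ (fun _ : Fin 2 => (2 : ℤ)) k

/-- The grading of the ring of regular functions. -/
def Ogr (A : Set (ℂ ≃ₗ[ℂ] ℂ)) (k : ℤ) : Submodule ℂ (ORing A) :=
  (homog k).map (Ideal.Quotient.mkₐ ℂ (graphIdeal A)).toLinearMap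

lemma weight_two (a : Fin 2 →₀ ℕ) :
    Finsupp.weight (fun _ : Fin 2 => (2 : ℤ)) a = 2 * ((a 0 + a 1 : ℕ) : ℤ) := by
  rw [Finsupp.weight_apply, Finsupp.sum_fintype _ _ (by simp)]
  simp [Fin.sum_univ_two]
  ring

lemma monomial_mem_homog (a : Fin 2 →₀ ℕ) (c : ℂ) :
    MvPolynomial.monomial a c ∈ homog (2 * ((a 0 + a 1 : ℕ) : ℤ)) :=
  MvPolynomial.isWeightedHomogeneous_monomial _ a c (weight_two a)

lemma homog_iSup : ⨆ k, homog k = ⊤ := by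
  rw [eq_top_iff]
  intro p _
  induction p using MvPolynomial.induction_on' with
  | monomial a c => exact Submodule.mem_iSup_of_mem _ (monomial_mem_homog a c)
  | add p q hp hq => exact Submodule.add_mem _ (hp trivial) (hq trivial)

lemma smul_mem_graphs {A : Set (ℂ ≃ₗ[ℂ] ℂ)} {z : Fin 2 → ℂ} (hz : z ∈ graphs A) (t : ℂ) :
    (fun i => z i * t) ∈ graphs A := by
  simp only [graphs, Set.mem_iUnion] at hz ⊢
  obtain ⟨x, hx, v, rfl⟩ := hz
  refine ⟨x, hx, t * v, ?_⟩
  funext i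
  have : x (t * v) = t * x v := by simpa using x.map_smul t v
  fin_cases i <;> simp [this, mul_comm]

/-- The degree `k` part of a polynomial. -/
abbrev comp (k : ℤ) : MvPolynomial (Fin 2) ℂ →ₗ[ℂ] MvPolynomial (Fin 2) ℂ :=
  MvPolynomial.weightedHomogeneousComponent (fun _ : Fin 2 => (2 : ℤ)) k

open MvPolynomial in
/-- The vanishing ideal is homogeneous. -/
lemma component_mem {A : Set (ℂ ≃ₗ[ℂ] ℂ)} {p : MvPolynomial (Fin 2) ℂ} (hp : p ∈ graphIdeal A)
    (k : ℤ) : comp k p ∈ graphIdeal A := by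
  intro z hz
  let φ : MvPolynomial (Fin 2) ℂ →ₐ[ℂ] Polynomial ℂ :=
    aeval (fun i => Polynomial.C (z i) * Polynomial.X)
  have hφ : φ p = 0 := by
    refine Polynomial.funext fun t => ?_
    have e : ((Polynomial.aeval t).comp φ : MvPolynomial (Fin 2) ℂ →ₐ[ℂ] ℂ) =
        aeval (fun i => z i * t) := by
      ext i
      simp [φ]
    have e2 := congrArg (fun f : MvPolynomial (Fin 2) ℂ →ₐ[ℂ] ℂ => f p) e
    simp only [AlgHom.comp_apply] at e2
    rw [hp _ (smul_mem_graphs hz t)] at e2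
    simpa [Polynomial.aeval_def] using e2
  have key : ∀ q : MvPolynomial (Fin 2) ℂ,
      aeval z (comp k q) =
        if k % 2 = 0 ∧ 0 ≤ k then (φ q).coeff (k / 2).toNat else 0 := by
    intro q
    induction q using MvPolynomial.induction_on' with
    | add p q hp hq =>
      rw [map_add, map_add, hp, hq]
      split_ifs <;> simp
    | monomial a c =>
      have e : φ (monomial a c) =
          Polynomial.C (c * (z 0 ^ a 0 * z 1 ^ a 1)) * Polynomial.X ^ (a 0 + a 1) := by
        simp only [φ, aeval_monomial]
        rw [Finsupp.prod_fintype _ _ (by simp), Fin.prod_univ_two]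
        simp only [map_mul, map_pow, mul_pow, pow_add, Polynomial.algebraMap_eq]
        ring
      have e2 : aeval z (monomial a c) = c * (z 0 ^ a 0 * z 1 ^ a 1) := by
        rw [aeval_monomial, Finsupp.prod_fintype _ _ (by simp), Fin.prod_univ_two]
        rfl
      rw [e, Polynomial.coeff_C_mul, Polynomial.coeff_X_pow,
        weightedHomogeneousComponent_of_mem (monomial_mem_homog a c)]
      by_cases h : k = 2 * ((a 0 + a 1 : ℕ) : ℤ)
      · rw [if_pos h, e2, if_pos (by omega), if_pos (by omega), mul_one]
      · rw [if_neg h, map_zero]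
        by_cases h2 : k % 2 = 0 ∧ 0 ≤ k
        · rw [if_pos h2, if_neg (by omega), mul_zero]
        · rw [if_neg h2]
  rw [key, hφ]
  simp

lemma Ogr_internal (A : Set (ℂ ≃ₗ[ℂ] ℂ)) : DirectSum.IsInternal (Ogr A) := by
  classical
  rw [DirectSum.isInternal_submodule_iff_iSupIndep_and_iSup_eq_top]
  constructor
  · rw [iSupIndep_def]
    intro i
    rw [Submodule.disjoint_def]
    intro x hx hx'
    let π := (Ideal.Quotient.mkₐ ℂ (graphIdeal A)).toLinearMap
    have h1 : (⨆ j, ⨆ (_ : j ≠ i), Ogr A j) ≤ (LinearMap.ker (comp i)).map π := by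
      refine iSup_le fun j => iSup_le fun hj => Submodule.map_mono ?_
      intro p hp
      rw [LinearMap.mem_ker, MvPolynomial.weightedHomogeneousComponent_of_mem hp,
        if_neg (Ne.symm hj)]
    obtain ⟨q, hq, hqx⟩ := h1 hx'
    obtain ⟨p, hp, rfl⟩ := hx
    have h2 : p - q ∈ graphIdeal A := Ideal.Quotient.eq.1 hqx.symm
    have h3 := component_mem h2 i
    rw [map_sub, LinearMap.mem_ker.1 hq, sub_zero,
      MvPolynomial.weightedHomogeneousComponent_of_mem hp, if_pos rfl] at h3
    exact Ideal.Quotient.eq_zero_iff_mem.2 h3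
  · have h : LinearMap.range (Ideal.Quotient.mkₐ ℂ (graphIdeal A)).toLinearMap = ⊤ :=
      LinearMap.range_eq_top.2 (Ideal.Quotient.mkₐ_surjective ℂ (graphIdeal A))
    rw [LinearMap.range_eq_map, ← homog_iSup, Submodule.map_iSup] at h
    exact h

lemma mul_mem_Ogr {A : Set (ℂ ≃ₗ[ℂ] ℂ)} {k l : ℤ} {x y : ORing A} (hx : x ∈ Ogr A k)
    (hy : y ∈ Ogr A l) : x * y ∈ Ogr A (k + l) := by
  obtain ⟨p, hp, rfl⟩ := hx
  obtain ⟨q, hq, rfl⟩ := hy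
  exact ⟨p * q, MvPolynomial.IsWeightedHomogeneous.mul hp hq, map_mul (Ideal.Quotient.mkₐ ℂ _) p q⟩

/-- The pullback of a function on the line along the `i`-th projection. -/
def pull (A : Set (ℂ ≃ₗ[ℂ] ℂ)) (i : Fin 2) : R →ₐ[ℂ] ORing A :=
  Polynomial.aeval (Ideal.Quotient.mkₐ ℂ (graphIdeal A) (MvPolynomial.X i))

lemma pull_mem (A : Set (ℂ ≃ₗ[ℂ] ℂ)) (i : Fin 2) {k : ℤ} {p : R} (hp : p ∈ Rgr k) :
    pull A i p ∈ Ogr A k := by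
  by_cases h0 : p = 0
  · simp [h0]
  obtain ⟨n, c, rfl, rfl⟩ := mem_Rgr_eq hp h0
  refine ⟨MvPolynomial.monomial (Finsupp.single i n) c,
    MvPolynomial.isWeightedHomogeneous_monomial _ _ c ?_, ?_⟩
  · rw [weight_two]
    fin_cases i <;> simp
  · rw [pull, Polynomial.aeval_monomial, ← map_pow, ← AlgHom.commutes (Ideal.Quotient.mkₐ ℂ _),
      ← map_mul, MvPolynomial.monomial_eq]
    simp [MvPolynomial.algebraMap_eq]

/-- The graded bimodule `𝒪(A)` of regular functions on the union of the reversed graphs of the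
elements of `A`; the actions of `R` are given by the first and the second projection. -/
def O (A : Set (ℂ ≃ₗ[ℂ] ℂ)) : GrBimod where
  carrier := ORing A
  lact := (Algebra.lmul ℂ (ORing A)).comp (pull A 0)
  ract := (Algebra.lmul ℂ (ORing A)).comp (pull A 1)
  act_comm p q m := mul_left_comm _ _ _
  gr := Ogr A
  internal := Ogr_internal A
  lact_mem hp hm := mul_mem_Ogr (pull_mem A 0 hp) hm
  ract_mem {k i p m} hp hm := by
    rw [add_comm]; exact mul_mem_Ogr (pull_mem A 1 hp) hm

/-! ### The category `𝓑_W` -/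

/-- The objects of `𝓑_W`, for `W` generated by `s`: the smallest class of graded bimodules which
contains `R` and `𝒪(e, s)` and is closed under tensor products, finite direct sums, grading shifts
and direct summands (in particular under isomorphism). -/
inductive InB (s : ℂ ≃ₗ[ℂ] ℂ) : GrBimod → Prop
  | unit : InB s GrBimod.unit
  | gen : InB s (O {1, s})
  | tens {M N : GrBimod} : InB s M → InB s N → InB s (M.tens N)
  | zero : InB s GrBimod.zeroObj
  | sum {M N : GrBimod} : InB s M → InB s N → InB s (M.sum N)
  | shift {M : GrBimod} (n : ℤ) : InB s M → InB s (M.shift n)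
  | retract {M N : GrBimod} : InB s M → Retract N M → InB s N

/-- The category `𝓑_W`, a full subcategory of the category of graded bimodules. -/
abbrev B (s : ℂ ≃ₗ[ℂ] ℂ) : Type 1 := ObjectProperty.FullSubcategory (InB s)

section BCat

variable (s : ℂ ≃ₗ[ℂ] ℂ)

instance : HasBinaryBiproducts (B s) where
  has_binary_biproduct X Y := hasBinaryBiproduct_of_total
    { pt := ⟨X.obj.sum Y.obj, X.property.sum Y.property⟩
      fst := ObjectProperty.homMk (GrBimod.fst X.obj Y.obj)
      snd := ObjectProperty.homMk (GrBimod.snd X.obj Y.obj)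
      inl := ObjectProperty.homMk (GrBimod.inl X.obj Y.obj)
      inr := ObjectProperty.homMk (GrBimod.inr X.obj Y.obj)
      inl_fst := rfl
      inl_snd := rfl
      inr_fst := rfl
      inr_snd := rfl }
    (ObjectProperty.hom_ext _ (GrBimod.sum_total X.obj Y.obj))

/-! ### The split Grothendieck ring -/

/-- Isomorphism classes of objects of `𝓑_W`. -/
def IsoCl : Type 1 := Quotient (isIsomorphicSetoid (B s))

variable {s}

/-- The isomorphism class of an object. -/
def cl (X : B s) : IsoCl s := Quotient.mk (isIsomorphicSetoid (B s)) X

lemma cl_surjective (a : IsoCl s) : ∃ X : B s, cl X = a := Quotient.exists_rep a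

lemma cl_eq {X Y : B s} (e : X.obj ≅ Y.obj) : cl X = cl Y :=
  Quotient.sound ⟨ObjectProperty.isoMk _ e⟩

lemma cl_eq_iff {X Y : B s} : cl X = cl Y ↔ Nonempty (X.obj ≅ Y.obj) :=
  ⟨fun h => (Quotient.exact h).elim fun e => ⟨(ObjectProperty.ι _).mapIso e⟩,
    fun ⟨e⟩ => cl_eq e⟩

/-- Tensor product of objects of `𝓑_W`. -/
def bTens (X Y : B s) : B s := ⟨X.obj.tens Y.obj, X.property.tens Y.property⟩

/-- Direct sum of objects of `𝓑_W`. -/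
def bSum (X Y : B s) : B s := ⟨X.obj.sum Y.obj, X.property.sum Y.property⟩

/-- Grading shift of objects of `𝓑_W`. -/
def bShift (n : ℤ) (X : B s) : B s := ⟨X.obj.shift n, X.property.shift n⟩

/-- The shifted units `R[n]`. -/
def bUnit (s : ℂ ≃ₗ[ℂ] ℂ) (n : ℤ) : B s := bShift n ⟨GrBimod.unit, InB.unit⟩

/-- Isomorphism classes form a monoid under the tensor product. -/
instance : Monoid (IsoCl s) where
  mul := Quotient.map₂ bTens (fun X X' ⟨e⟩ Y Y' ⟨f⟩ => ⟨ObjectProperty.isoMk _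
    (GrBimod.tensIso ((ObjectProperty.ι _).mapIso e) ((ObjectProperty.ι _).mapIso f))⟩)
  one := cl ⟨GrBimod.unit, InB.unit⟩
  mul_assoc a b c := by
    induction a using Quotient.inductionOn
    induction b using Quotient.inductionOn
    induction c using Quotient.inductionOn
    exact cl_eq (GrBimod.assoc _ _ _)
  one_mul a := by
    induction a using Quotient.inductionOn with
    | h X => exact cl_eq (GrBimod.tensIso (GrBimod.shiftZero GrBimod.unit).symm (Iso.refl X.obj) ≪≫
        GrBimod.unitTens 0 X.obj ≪≫ GrBimod.shiftZero X.obj)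
  mul_one a := by
    induction a using Quotient.inductionOn with
    | h X => exact cl_eq (GrBimod.tensIso (Iso.refl X.obj) (GrBimod.shiftZero GrBimod.unit).symm ≪≫
        GrBimod.tensUnit 0 X.obj ≪≫ GrBimod.shiftZero X.obj)

lemma cl_mul (X Y : B s) : cl X * cl Y = cl (bTens X Y) := rfl

lemma cl_unit_mul (n : ℤ) (X : B s) : cl (bUnit s n) * cl X = cl (bShift n X) :=
  cl_eq (GrBimod.unitTens n X.obj)

lemma cl_mul_unit (n : ℤ) (X : B s) : cl X * cl (bUnit s n) = cl (bShift n X) :=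
  cl_eq (GrBimod.tensUnit n X.obj)

variable (s)

/-- The relations `[X ⊕ Y] = [X] + [Y]`. -/
def splitRel : AddSubgroup (FreeAbelianGroup (IsoCl s)) :=
  AddSubgroup.closure {x | ∃ X Y : B s, x = FreeAbelianGroup.of (cl (bSum X Y)) -
    (FreeAbelianGroup.of (cl X) + FreeAbelianGroup.of (cl Y))}

variable {s}

lemma of_mul_splitRel (a : IsoCl s) {x : FreeAbelianGroup (IsoCl s)} (hx : x ∈ splitRel s) :
    FreeAbelianGroup.of a * x ∈ splitRel s := by
  induction hx using AddSubgroup.closure_induction with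
  | mem x hx =>
    obtain ⟨X, Y, rfl⟩ := hx
    obtain ⟨Z, rfl⟩ := cl_surjective a
    refine AddSubgroup.subset_closure ⟨bTens Z X, bTens Z Y, ?_⟩
    rw [mul_sub, mul_add, ← FreeAbelianGroup.of_mul, ← FreeAbelianGroup.of_mul,
      ← FreeAbelianGroup.of_mul, cl_mul, cl_mul, cl_mul,
      cl_eq (X := bTens Z (bSum X Y)) (Y := bSum (bTens Z X) (bTens Z Y))
        (GrBimod.tensSum Z.obj X.obj Y.obj)]
  | zero => simp
  | add x y _ _ hx hy => rw [mul_add]; exact add_mem hx hy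
  | neg x _ hx => rw [mul_neg]; exact neg_mem hx

lemma splitRel_mul_of (a : IsoCl s) {x : FreeAbelianGroup (IsoCl s)} (hx : x ∈ splitRel s) :
    x * FreeAbelianGroup.of a ∈ splitRel s := by
  induction hx using AddSubgroup.closure_induction with
  | mem x hx =>
    obtain ⟨X, Y, rfl⟩ := hx
    obtain ⟨Z, rfl⟩ := cl_surjective a
    refine AddSubgroup.subset_closure ⟨bTens X Z, bTens Y Z, ?_⟩
    rw [sub_mul, add_mul, ← FreeAbelianGroup.of_mul, ← FreeAbelianGroup.of_mul,
      ← FreeAbelianGroup.of_mul, cl_mul, cl_mul, cl_mul,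
      cl_eq (X := bTens (bSum X Y) Z) (Y := bSum (bTens X Z) (bTens Y Z))
        (GrBimod.sumTens X.obj Y.obj Z.obj)]
  | zero => simp
  | add x y _ _ hx hy => rw [add_mul]; exact add_mem hx hy
  | neg x _ hx => rw [neg_mul]; exact neg_mem hx

variable (s)

/-- The relations form a two-sided ideal. -/
def splitIdeal : TwoSidedIdeal (FreeAbelianGroup (IsoCl s)) :=
  TwoSidedIdeal.mk' (splitRel s) (zero_mem _) add_mem neg_mem
    (fun {x y} hy => by
      induction x using FreeAbelianGroup.induction_on with
      | zero => simp
      | of a => exact of_mul_splitRel a hy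
      | neg a h => rw [neg_mul]; exact neg_mem h
      | add x x' h h' => rw [add_mul]; exact add_mem h h')
    (fun {x y} hx => by
      induction y using FreeAbelianGroup.induction_on with
      | zero => simp
      | of a => exact splitRel_mul_of a hx
      | neg a h => rw [mul_neg]; exact neg_mem h
      | add x x' h h' => rw [mul_add]; exact add_mem h h')

/-- The split Grothendieck ring `A_W` of `𝓑_W`: the free abelian group on isomorphism classes of
objects modulo `[X ⊕ Y] = [X] + [Y]`, with product `[X][Y] = [X ⊗_R Y]`. -/
def AW : Type 1 := (splitIdeal s).ringCon.Quotient

instance : Ring (AW s) := inferInstanceAs (Ring (splitIdeal s).ringCon.Quotient)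

variable {s}

/-- The quotient map onto the split Grothendieck ring. -/
def toAW : FreeAbelianGroup (IsoCl s) →+* AW s := (splitIdeal s).ringCon.mk'

lemma toAW_surjective : Function.Surjective (toAW (s := s)) := Quotient.mk_surjective

lemma toAW_eq_zero_iff (x : FreeAbelianGroup (IsoCl s)) : toAW x = 0 ↔ x ∈ splitRel s := by
  have h : toAW x = toAW 0 ↔ (splitIdeal s).ringCon x 0 := RingCon.eq _
  rw [map_zero] at h
  rw [h, ← TwoSidedIdeal.mem_iff]
  exact TwoSidedIdeal.mem_mk' _ _ _ _ _ _ _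

/-- The class of an object in the split Grothendieck ring. -/
def aw (X : B s) : AW s := toAW (FreeAbelianGroup.of (cl X))

lemma aw_mul (X Y : B s) : aw X * aw Y = aw (bTens X Y) := by
  rw [aw, aw, ← map_mul, ← FreeAbelianGroup.of_mul]; rfl

variable (s)

/-- The homomorphism `ℤ[v, v⁻¹] → A_W` with `v ^ n ↦ [R[n]]`. -/
def laurentHom : ℤ[T;T⁻¹] →ₐ[ℤ] AW s :=
  AddMonoidAlgebra.lift ℤ (AW s) ℤ
    { toFun := fun n => aw (bUnit s n.toAdd)
      map_one' := by
        rw [aw, show cl (bUnit s (Multiplicative.toAdd (1 : Multiplicative ℤ))) = 1 from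
          cl_eq (GrBimod.shiftZero _), FreeAbelianGroup.of_one, map_one]
      map_mul' := fun m n => by
        rw [aw_mul, aw, aw]
        congr 2
        exact (cl_eq (GrBimod.unitTens m.toAdd (GrBimod.shift n.toAdd GrBimod.unit) ≪≫
          GrBimod.shiftShift n.toAdd m.toAdd GrBimod.unit)).symm }

lemma laurentHom_T (n : ℤ) : laurentHom s (LaurentPolynomial.T n) = aw (bUnit s n) := by
  refine (AddMonoidAlgebra.lift_single _ _ _).trans ?_
  rw [one_smul]
  rfl

lemma laurentHom_comm (f : ℤ[T;T⁻¹]) (x : AW s) : laurentHom s f * x = x * laurentHom s f := by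
  induction f using LaurentPolynomial.induction_on' with
  | add p q hp hq => rw [map_add, add_mul, mul_add, hp, hq]
  | C_mul_T n a =>
    have : Commute (aw (bUnit s n)) x := by
      obtain ⟨x, rfl⟩ := toAW_surjective x
      induction x using FreeAbelianGroup.induction_on with
      | zero => simp
      | of a =>
        obtain ⟨X, rfl⟩ := cl_surjective a
        change toAW _ * toAW _ = toAW _ * toAW _
        rw [← map_mul, ← map_mul, ← FreeAbelianGroup.of_mul, ← FreeAbelianGroup.of_mul,
          cl_unit_mul, cl_mul_unit]
      | neg a h => rw [map_neg]; exact h.neg_right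
      | add x y hx hy => rw [map_add]; exact hx.add_right hy
    have h2 : laurentHom s (LaurentPolynomial.C a) = (a : AW s) := by
      rw [show (LaurentPolynomial.C a : ℤ[T;T⁻¹]) = (a : ℤ[T;T⁻¹]) from
        eq_intCast (LaurentPolynomial.C : ℤ →+* ℤ[T;T⁻¹]) a, map_intCast]
    rw [map_mul, laurentHom_T, h2]
    exact (Int.cast_commute a x).mul_left this

/-- The split Grothendieck ring is a `ℤ[v, v⁻¹]`-algebra, with `v · [X] = [X[1]]`. -/
instance : Algebra ℤ[T;T⁻¹] (AW s) :=
  (laurentHom s).toRingHom.toAlgebra' (laurentHom_comm s)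

lemma T_smul_aw (n : ℤ) (X : B s) :
    (LaurentPolynomial.T n : ℤ[T;T⁻¹]) • aw X = aw (bShift n X) := by
  rw [Algebra.smul_def]
  change laurentHom s _ * _ = _
  rw [laurentHom_T, aw_mul]
  exact congrArg (fun c => toAW (FreeAbelianGroup.of c)) (cl_unit_mul n X)

end BCat

/-! ### Cyclically connected subsets -/

/-- A subset of the cyclic group generated by `s` is cyclically connected if it is of the form
`{s^i, s^(i+1), …, s^(i+j)}` with `0 ≤ i, j ≤ d - 1`, where `d` is the order of `s`. -/
def CycConn (s : ℂ ≃ₗ[ℂ] ℂ) (A : Set (ℂ ≃ₗ[ℂ] ℂ)) : Prop :=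
  ∃ i j : ℕ, i < orderOf s ∧ j < orderOf s ∧ A = {x | ∃ k ≤ j, x = s ^ (i + k)}

end CyclicSoergel
end

/-! A graded `R`-bimodule is a graded module over the polynomial ring in the two outer coordinates,
and `O A` is its cyclic quotient by the ideal of a union of lines. With `ζ = s 1`, a primitive
`d`-th root of unity, the line of `s ^ k` has slope `ζ ^ k`. For a segment of at most `d` powers the
ideal is principal, generated by the product of the linear forms (`graphIdeal_seg`).

The heart of the proof is tensoring a segment with the generator. In `O A ⊗ O {1, s}` let `x`, `y`,
`z` be the left, middle and right coordinates; `y` satisfies `(y - z)(y - ζ z) = 0`. So `1` and `y`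
generate over the outer coordinates. If `A` has `n + 1 < d` elements starting at `s ^ i`, then `y`
can be replaced by a linear combination `w` of `x`, `y`, `z` that vanishes on the two end lines. The
element `1` then generates the functions on the segment of length `n + 2`, and `w`, of degree 2,
those on the `n` interior lines (`tens_gen_split`). If `A` is the whole group, every line is covered
twice and two copies of `O A` appear (`tens_gen_split_full`). Relations are checked by algebra in a
commutative ring, independence by evaluation at points.

Endomorphisms of `O A` of degree 0 are scalars, since `O A` is generated by `1`, which spans degree
0. This gives a direct Krull–Schmidt argument: retracts of finite sums of shifted segments are again
such sums (`retract_sum_brick`, `Dec.retract`). Together with the splittings, every object of the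
category is such a sum (`InB.dec`). Conversely all segments occur (`inB_seg`), and it is here that
`d > 2` enters: a segment of length 2 must still be extendable to move the starting point. Segments
are determined by the annihilator of the generator, shifts by its degree.

The segments therefore span the Grothendieck ring over Laurent polynomials. For independence,
dimensions of spaces of morphisms from a shifted segment are additive functions on the ring. They
are triangular for the degree and for inclusion of segments, so a relation cannot survive at its top
exponent and a minimal segment there (`linearIndependent_lab`). The rank counts `d` starting points
and lengths `1, …, d - 1`, together with the full group. -/

noncomputable section

namespace CyclicSoergel

/-! ### Bimodules as modules over polynomials in two variables -/

namespace GrBimod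

variable {M N P : GrBimod}

/-- The action of monomials in two variables: the first variable acts from the left, the second one
from the right. -/
def actMonomial (M : GrBimod) : Multiplicative (Fin 2 →₀ ℕ) →* Module.End ℂ M.carrier where
  toFun a := M.lact Polynomial.X ^ (a.toAdd 0) * M.ract Polynomial.X ^ (a.toAdd 1)
  map_one' := by simp
  map_mul' a b := by
    have h : Commute (M.lact Polynomial.X) (M.ract Polynomial.X) :=
      LinearMap.ext fun m => M.act_comm _ _ m
    have h2 := (h.pow_pow (b.toAdd 0) (a.toAdd 1)).eq
    simp only [toAdd_mul, Finsupp.add_apply, pow_add]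
    rw [mul_assoc, mul_assoc, ← mul_assoc _ (M.lact _ ^ _) (M.ract _ ^ _), ← h2]
    simp only [mul_assoc]

/-- The action of polynomials in two variables: the first variable acts from the left, the second
one from the right. -/
def act (M : GrBimod) : MvPolynomial (Fin 2) ℂ →ₐ[ℂ] Module.End ℂ M.carrier :=
  AddMonoidAlgebra.lift ℂ (Module.End ℂ M.carrier) (Fin 2 →₀ ℕ) M.actMonomial

lemma act_monomial (a : Fin 2 →₀ ℕ) (c : ℂ) (m : M.carrier) :
    M.act (MvPolynomial.monomial a c) m =
      c • M.lact (Polynomial.X ^ a 0) (M.ract (Polynomial.X ^ a 1) m) := by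
  refine (congrArg (fun f : Module.End ℂ M.carrier => f m)
    (AddMonoidAlgebra.lift_single M.actMonomial a c)).trans ?_
  simp [actMonomial]

lemma act_C (c : ℂ) (m : M.carrier) : M.act (MvPolynomial.C c) m = c • m := by
  rw [← MvPolynomial.algebraMap_eq, AlgHom.commutes]; rfl

lemma act_X0 (m : M.carrier) : M.act (MvPolynomial.X 0) m = M.lact Polynomial.X m := by
  rw [MvPolynomial.X, act_monomial]; simp

lemma act_X1 (m : M.carrier) : M.act (MvPolynomial.X 1) m = M.ract Polynomial.X m := by
  rw [MvPolynomial.X, act_monomial]; simp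

lemma act_mul (p q : MvPolynomial (Fin 2) ℂ) (m : M.carrier) :
    M.act (p * q) m = M.act p (M.act q m) := by rw [map_mul]; rfl

lemma lin_act (f : M ⟶ N) (p : MvPolynomial (Fin 2) ℂ) (m : M.carrier) :
    f.lin (M.act p m) = N.act p (f.lin m) := by
  induction p using MvPolynomial.induction_on' with
  | monomial a c => simp only [act_monomial, map_smul, f.map_lact, f.map_ract]
  | add p q hp hq => simp [hp, hq]

lemma act_mem {k i : ℤ} {p : MvPolynomial (Fin 2) ℂ} {m : M.carrier} (hp : p ∈ homog k)
    (hm : m ∈ M.gr i) : M.act p m ∈ M.gr (k + i) := by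
  rw [p.as_sum, map_sum, LinearMap.sum_apply]
  refine Submodule.sum_mem _ fun a ha => ?_
  have h := hp (MvPolynomial.mem_support_iff.1 ha)
  rw [weight_two] at h
  rw [act_monomial]
  refine Submodule.smul_mem _ _ ?_
  have h1 := M.ract_mem (monomial_mem_Rgr (a 1) 1) hm
  have h2 := M.lact_mem (monomial_mem_Rgr (a 0) 1) h1
  rw [Polynomial.monomial_one_right_eq_X_pow, Polynomial.monomial_one_right_eq_X_pow] at h2
  convert h2 using 2
  push_cast at h
  omega

/-- A polynomial in the left action acts as a polynomial in the first variable. -/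
lemma act_left (p : R) (m : M.carrier) :
    M.act (Polynomial.aeval (MvPolynomial.X 0) p) m = M.lact p m := by
  have : M.act.comp (Polynomial.aeval (MvPolynomial.X 0)) = M.lact :=
    Polynomial.algHom_ext (LinearMap.ext fun m => by simp [act_X0])
  rw [← this]; rfl

lemma act_right (p : R) (m : M.carrier) :
    M.act (Polynomial.aeval (MvPolynomial.X 1) p) m = M.ract p m := by
  have : M.act.comp (Polynomial.aeval (MvPolynomial.X 1)) = M.ract :=
    Polynomial.algHom_ext (LinearMap.ext fun m => by simp [act_X1])
  rw [← this]; rfl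

lemma shift_act (n : ℤ) (p : MvPolynomial (Fin 2) ℂ) (m : M.carrier) :
    (M.shift n).act p m = M.act p m := rfl

lemma sum_act (p : MvPolynomial (Fin 2) ℂ) (m : M.carrier) (n : N.carrier) :
    (M.sum N).act p (m, n) = (M.act p m, N.act p n) := by
  have h1 := lin_act (fst M N) p (m, n)
  have h2 := lin_act (snd M N) p (m, n)
  exact Prod.ext h1 h2

/-- An injective morphism reflects degrees. -/
lemma gr_of_lin_mem (f : M ⟶ N) (hf : Function.Injective f.lin) {i : ℤ} {m : M.carrier}
    (h : f.lin m ∈ N.gr i) : m ∈ M.gr i := by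
  obtain ⟨δ, hδ⟩ := exists_dec M.gr M.internal
  obtain ⟨ε, hε⟩ := exists_dec N.gr N.internal
  -- Morphisms commute with the decompositions into components. If `f m` has degree `i`, then `m`
  -- and its component of degree `i` have the same image, hence coincide.
  have key : ∀ m, (δ m i ∈ M.gr i) ∧ ε (f.lin m) = Finsupp.mapRange.linearMap f.lin (δ m) := by
    intro m
    induction m using hom_induction (iSup_of_internal M.internal) with
    | hz => simp
    | ha x y hx hy =>
      exact ⟨by simpa using add_mem hx.1 hy.1, by simp only [map_add, hx.2, hy.2]⟩
    | hh j m hm =>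
      rw [hδ j m hm, hε j _ (f.map_gr hm)]
      refine ⟨?_, by simp⟩
      by_cases hij : j = i
      · subst hij; simpa using hm
      · simp [hij]
  obtain ⟨h1, h2⟩ := key m
  rw [hε i _ h] at h2
  have h3 := congrArg (fun z => z i) h2
  simp only [Finsupp.single_eq_same, Finsupp.mapRange.linearMap_apply,
    Finsupp.mapRange_apply] at h3
  rwa [hf h3]

/-- A bijective morphism is an isomorphism. -/
def isoOfBijective (f : M ⟶ N) (hf : Function.Bijective f.lin) : M ≅ N :=
  let e := LinearEquiv.ofBijective f.lin hf
  isoOf f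
    { lin := e.symm
      map_lact := fun p n => by
        rw [LinearEquiv.coe_coe, LinearEquiv.symm_apply_eq]
        exact ((f.map_lact p _).trans (by rw [show f.lin (e.symm n) = n from
          e.apply_symm_apply n])).symm
      map_ract := fun p n => by
        rw [LinearEquiv.coe_coe, LinearEquiv.symm_apply_eq]
        exact ((f.map_ract p _).trans (by rw [show f.lin (e.symm n) = n from
          e.apply_symm_apply n])).symm
      map_gr := fun {i n} hn => gr_of_lin_mem f hf.1 (by
        rwa [LinearEquiv.coe_coe, show f.lin (e.symm n) = n from e.apply_symm_apply n]) }
    e.symm_apply_apply e.apply_symm_apply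

end GrBimod

open GrBimod

/-! ### The bimodules of regular functions -/

section Regular

variable {A : Set (ℂ ≃ₗ[ℂ] ℂ)}

lemma apply_eq_mul (x : ℂ ≃ₗ[ℂ] ℂ) (v : ℂ) : x v = x 1 * v := by
  have := x.map_smul v 1
  simpa [mul_comm] using this

lemma mem_graphIdeal {p : MvPolynomial (Fin 2) ℂ} :
    p ∈ graphIdeal A ↔ ∀ x ∈ A, ∀ v : ℂ, MvPolynomial.aeval ![x v, v] p = 0 := by
  rw [MvPolynomial.mem_vanishingIdeal_iff]
  simp only [graphs, graph, Set.mem_iUnion, Set.mem_range]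
  constructor
  · intro h x hx v
    exact h _ ⟨x, hx, v, rfl⟩
  · rintro h _ ⟨x, hx, v, rfl⟩
    exact h x hx v

/-- The restriction of a polynomial function to the line of slope `b`. -/
def restr (b : ℂ) : MvPolynomial (Fin 2) ℂ →ₐ[ℂ] Polynomial ℂ :=
  MvPolynomial.aeval ![Polynomial.C b * Polynomial.X, Polynomial.X]

lemma eval_restr (b v : ℂ) (p : MvPolynomial (Fin 2) ℂ) :
    (restr b p).eval v = MvPolynomial.aeval ![b * v, v] p := by
  have : (Polynomial.aeval v).comp (restr b) = MvPolynomial.aeval ![b * v, v] := by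
    ext i
    fin_cases i <;> simp [restr]
  rw [← this, AlgHom.comp_apply, Polynomial.coe_aeval_eq_eval]

/-- Since `ℂ` is infinite, vanishing at all points of a line is the same as restricting to the zero
polynomial. Membership becomes a statement about ring homomorphisms to a domain, where products can
be cancelled. -/
lemma mem_graphIdeal_iff_restr {p : MvPolynomial (Fin 2) ℂ} :
    p ∈ graphIdeal A ↔ ∀ x ∈ A, restr (x 1) p = 0 := by
  rw [mem_graphIdeal]
  refine forall₂_congr fun x _ => ⟨fun h => Polynomial.funext fun v => ?_, fun h v => ?_⟩
  · rw [eval_restr, ← apply_eq_mul, h, Polynomial.eval_zero]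
  · rw [apply_eq_mul, ← eval_restr, h, Polynomial.eval_zero]

/-- The origin may be omitted because a polynomial with cofinitely many zeros is zero. This is
needed when a factor `v` has to be cancelled from the values on a line. -/
lemma restr_eq_zero {b : ℂ} {p : MvPolynomial (Fin 2) ℂ}
    (h : ∀ v : ℂ, v ≠ 0 → MvPolynomial.aeval ![b * v, v] p = 0) : restr b p = 0 := by
  have : restr b p * Polynomial.X = 0 := Polynomial.funext fun v => by
    by_cases hv : v = 0
    · simp [hv]
    · simp [eval_restr, h v hv]
  simpa using this

/-- Modulo `X 0 - b * X 1` the quotient map factors through restriction to the line of slope `b`,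
because both agree on the two variables. -/
lemma dvd_of_restr_eq_zero {b : ℂ} {p : MvPolynomial (Fin 2) ℂ} (h : restr b p = 0) :
    MvPolynomial.X 0 - MvPolynomial.C b * MvPolynomial.X 1 ∣ p := by
  rw [← Ideal.mem_span_singleton, ← Ideal.Quotient.eq_zero_iff_mem]
  set I : Ideal (MvPolynomial (Fin 2) ℂ) :=
    Ideal.span {MvPolynomial.X 0 - MvPolynomial.C b * MvPolynomial.X 1} with hI
  have : (Polynomial.aeval (Ideal.Quotient.mkₐ ℂ I (MvPolynomial.X 1))).comp (restr b) =
      Ideal.Quotient.mkₐ ℂ I := by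
    ext i
    fin_cases i
    · simp only [restr, Fin.zero_eta, AlgHom.comp_apply, MvPolynomial.aeval_X,
        Matrix.cons_val_zero, map_mul, Polynomial.aeval_C, Polynomial.aeval_X]
      rw [← AlgHom.commutes (Ideal.Quotient.mkₐ ℂ I), ← map_mul, eq_comm, ← sub_eq_zero,
        ← map_sub]
      exact Ideal.Quotient.eq_zero_iff_mem.2 (Ideal.subset_span rfl)
    · simp [restr]
  have h2 := congrArg (fun f : _ →ₐ[ℂ] _ => f p) this
  simp only [AlgHom.comp_apply, h, map_zero] at h2
  exact h2.symm

/-- The regular function given by a polynomial. -/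
def O.mk (A : Set (ℂ ≃ₗ[ℂ] ℂ)) : MvPolynomial (Fin 2) ℂ →ₗ[ℂ] (O A).carrier :=
  (Ideal.Quotient.mkₐ ℂ (graphIdeal A)).toLinearMap

lemma O.mk_surjective : Function.Surjective (O.mk A) :=
  Ideal.Quotient.mkₐ_surjective ℂ (graphIdeal A)

lemma O.mk_eq_zero {p : MvPolynomial (Fin 2) ℂ} : O.mk A p = 0 ↔ p ∈ graphIdeal A :=
  Ideal.Quotient.eq_zero_iff_mem

lemma O.act_mk (p q : MvPolynomial (Fin 2) ℂ) :
    (O A).act p (O.mk A q) = O.mk A (p * q) := by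
  have : (O A).act = (Algebra.lmul ℂ (ORing A)).comp (Ideal.Quotient.mkₐ ℂ (graphIdeal A)) := by
    apply MvPolynomial.algHom_ext
    intro i
    refine LinearMap.ext fun (m : ORing A) => ?_
    fin_cases i
    · refine (act_X0 (M := O A) m).trans ?_
      change pull A 0 Polynomial.X * m = _
      simp [pull]; rfl
    · refine (act_X1 (M := O A) m).trans ?_
      change pull A 1 Polynomial.X * m = _
      simp [pull]; rfl
  rw [this]
  exact (map_mul (Ideal.Quotient.mkₐ ℂ (graphIdeal A)) p q).symm

/-- The constant function `1`. -/
def O.one (A : Set (ℂ ≃ₗ[ℂ] ℂ)) : (O A).carrier := O.mk A 1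

lemma O.act_one (p : MvPolynomial (Fin 2) ℂ) : (O A).act p (O.one A) = O.mk A p := by
  rw [O.one, O.act_mk, mul_one]

lemma O.exists_act (m : (O A).carrier) : ∃ p, m = (O A).act p (O.one A) := by
  obtain ⟨p, hp⟩ := O.mk_surjective m
  exact ⟨p, by rw [O.act_one, hp]⟩

lemma O.act_one_eq_zero {p : MvPolynomial (Fin 2) ℂ} :
    (O A).act p (O.one A) = 0 ↔ p ∈ graphIdeal A := by
  rw [O.act_one, O.mk_eq_zero]

lemma O.one_mem : O.one A ∈ (O A).gr 0 :=
  ⟨1, MvPolynomial.isWeightedHomogeneous_one ℂ _, rfl⟩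

lemma O.exists_homog {k : ℤ} {m : (O A).carrier} (hm : m ∈ (O A).gr k) :
    ∃ p ∈ homog k, m = (O A).act p (O.one A) := by
  obtain ⟨p, hp, rfl⟩ := hm
  exact ⟨p, hp, (O.act_one p).symm⟩

lemma homog_of_neg {k : ℤ} (hk : k < 0) {p : MvPolynomial (Fin 2) ℂ} (hp : p ∈ homog k) :
    p = 0 := by
  ext a
  by_contra h
  have := hp h
  rw [weight_two] at this
  omega

lemma homog_zero {p : MvPolynomial (Fin 2) ℂ} (hp : p ∈ homog 0) :
    p = MvPolynomial.C (p.coeff 0) := by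
  ext a
  rw [MvPolynomial.coeff_C]
  split_ifs with h
  · rw [h]
  · by_contra hc
    have h2 := hp hc
    rw [weight_two] at h2
    apply h
    ext i
    fin_cases i
    · simp; omega
    · simp; omega

lemma O.gr_neg {k : ℤ} (hk : k < 0) {m : (O A).carrier} (hm : m ∈ (O A).gr k) : m = 0 := by
  obtain ⟨p, hp, rfl⟩ := O.exists_homog hm
  rw [homog_of_neg hk hp]; simp

lemma O.gr_zero {m : (O A).carrier} (hm : m ∈ (O A).gr 0) : ∃ c : ℂ, m = c • O.one A := by
  obtain ⟨p, hp, rfl⟩ := O.exists_homog hm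
  rw [homog_zero hp, act_C]
  exact ⟨_, rfl⟩

lemma O.one_ne_zero (h : A.Nonempty) : O.one A ≠ 0 := by
  intro h1
  obtain ⟨x, hx⟩ := h
  have h2 : (O A).act 1 (O.one A) = 0 := by rw [h1, map_zero]
  have := mem_graphIdeal.1 (O.act_one_eq_zero.1 h2) x hx 0
  simp at this

/-- Only finitely many exponents have a given weight. Finiteness is what makes `Module.finrank`
additive for the spaces of morphisms used later. -/
instance finite_homog (k : ℤ) : Module.Finite ℂ (homog k) := by
  have hfin : {a : Fin 2 →₀ ℕ | Finsupp.weight (fun _ : Fin 2 => (2 : ℤ)) a = k}.Finite := by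
    refine (Set.Finite.preimage (f := fun a : Fin 2 →₀ ℕ => (a 0, a 1)) ?_
      ((Set.finite_Iic (k.toNat)).prod (Set.finite_Iic (k.toNat)))).subset ?_
    · intro a _ b _ h
      simp only [Prod.mk.injEq] at h
      ext i
      fin_cases i
      · exact h.1
      · exact h.2
    · intro a ha
      simp only [Set.mem_ofPred_eq, weight_two] at ha
      simp only [Set.mem_preimage, Set.mem_prod, Set.mem_Iic]
      omega
  rw [Module.Finite.iff_fg]
  refine ⟨hfin.toFinset.image (fun a => MvPolynomial.monomial a 1), le_antisymm ?_ ?_⟩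
  · rw [Submodule.span_le]
    intro p hp
    simp only [Finset.coe_image, Set.mem_image, Finset.mem_coe, Set.Finite.mem_toFinset] at hp
    obtain ⟨a, ha, rfl⟩ := hp
    exact MvPolynomial.isWeightedHomogeneous_monomial _ _ _ ha
  · intro p hp
    rw [p.as_sum]
    refine Submodule.sum_mem _ fun a ha => ?_
    have : MvPolynomial.monomial a (p.coeff a) =
        p.coeff a • MvPolynomial.monomial a (1 : ℂ) := by
      rw [MvPolynomial.smul_monomial, smul_eq_mul, mul_one]
    rw [this]
    refine Submodule.smul_mem _ _ (Submodule.subset_span ?_)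
    simp only [Finset.coe_image, Set.mem_image, Finset.mem_coe, Set.Finite.mem_toFinset]
    exact ⟨a, hp (MvPolynomial.mem_support_iff.1 ha), rfl⟩

instance O.finite_gr (k : ℤ) : Module.Finite ℂ ((O A).gr k) :=
  inferInstanceAs (Module.Finite ℂ ((homog k).map
    (Ideal.Quotient.mkₐ ℂ (graphIdeal A)).toLinearMap))

variable {M : GrBimod}

/-- Morphisms from `𝒪(A)[n]` correspond to homogeneous elements annihilated by the ideal of the
union of the graphs. -/
def O.desc (A : Set (ℂ ≃ₗ[ℂ] ℂ)) (n : ℤ) (x : M.carrier) (hx : x ∈ M.gr (-n))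
    (h : ∀ p ∈ graphIdeal A, M.act p x = 0) : (O A).shift n ⟶ M :=
  let f : (O A).carrier →ₗ[ℂ] M.carrier := Submodule.liftQ ((graphIdeal A).restrictScalars ℂ)
    (M.act.toLinearMap.flip x) (fun p hp => h p hp)
  have hf : ∀ p, f (O.mk A p) = M.act p x := fun _ => rfl
  { lin := f
    map_lact := fun p (m : (O A).carrier) => by
      obtain ⟨q, rfl⟩ := O.mk_surjective m
      change f ((O A).lact p (O.mk A q)) = M.lact p (f (O.mk A q))
      rw [hf, ← act_left, O.act_mk, hf, act_mul, act_left]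
    map_ract := fun p (m : (O A).carrier) => by
      obtain ⟨q, rfl⟩ := O.mk_surjective m
      change f ((O A).ract p (O.mk A q)) = M.ract p (f (O.mk A q))
      rw [hf, ← act_right, O.act_mk, hf, act_mul, act_right]
    map_gr := fun {i m} hm => by
      obtain ⟨p, hp, rfl⟩ := hm
      change M.act p x ∈ _
      have := act_mem hp hx
      rwa [add_neg_cancel_right] at this }

lemma O.desc_act_one (n : ℤ) (x : M.carrier) (hx : x ∈ M.gr (-n))
    (h : ∀ p ∈ graphIdeal A, M.act p x = 0) (p : MvPolynomial (Fin 2) ℂ) :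
    (O.desc A n x hx h).lin ((O A).act p (O.one A)) = M.act p x := by
  rw [O.act_one]; rfl

lemma O.hom_ext {n : ℤ} {f g : (O A).shift n ⟶ M} (h : f.lin (O.one A) = g.lin (O.one A)) :
    f = g := by
  ext m
  obtain ⟨p, rfl⟩ := O.exists_act (A := A) m
  have hf := lin_act f p (O.one A)
  have hg := lin_act g p (O.one A)
  rw [shift_act] at hf hg
  rw [hf, hg, h]

lemma O.one_mem_shift (n : ℤ) : O.one A ∈ ((O A).shift n).gr (-n) := by
  change O.one A ∈ (O A).gr (-n + n)
  rw [neg_add_cancel]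
  exact O.one_mem

/-- Endomorphisms of `𝒪(A)[n]` are scalar. -/
lemma O.end_scalar {n : ℤ} (f : (O A).shift n ⟶ (O A).shift n) :
    ∃ c : ℂ, ∀ m : (O A).carrier, f.lin m = c • m := by
  have h1 : f.lin (O.one A) ∈ ((O A).shift n).gr (-n) := f.map_gr (O.one_mem_shift n)
  change f.lin (O.one A) ∈ (O A).gr (-n + n) at h1
  rw [neg_add_cancel] at h1
  obtain ⟨c, hc⟩ := O.gr_zero h1
  refine ⟨c, fun m => ?_⟩
  obtain ⟨p, rfl⟩ := O.exists_act (A := A) m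
  have hf := lin_act f p (O.one A)
  rw [shift_act] at hf
  rw [hf, hc, shift_act, map_smul]

end Regular

/-! ### Segments of the cyclic group -/

section Segments

variable {s : ℂ ≃ₗ[ℂ] ℂ} {d : ℕ}

/-- The segment `{s^i, …, s^(i+n-1)}` of the powers of `s`. -/
def seg (s : ℂ ≃ₗ[ℂ] ℂ) (i n : ℕ) : Set (ℂ ≃ₗ[ℂ] ℂ) := {x | ∃ k < n, x = s ^ (i + k)}

lemma pow_apply_one (s : ℂ ≃ₗ[ℂ] ℂ) (k : ℕ) : (s ^ k) 1 = s 1 ^ k := by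
  induction k with
  | zero => simp
  | succ k ih =>
    rw [pow_succ, LinearEquiv.mul_apply, apply_eq_mul (s ^ k), ih, pow_succ]

lemma pow_apply (s : ℂ ≃ₗ[ℂ] ℂ) (k : ℕ) (v : ℂ) : (s ^ k) v = s 1 ^ k * v := by
  rw [apply_eq_mul, pow_apply_one]

lemma linearEquiv_ext_one {x y : ℂ ≃ₗ[ℂ] ℂ} (h : x 1 = y 1) : x = y :=
  LinearEquiv.ext fun v => by rw [apply_eq_mul, h, ← apply_eq_mul]

lemma isPrimitiveRoot_apply_one (hs : orderOf s = d) : IsPrimitiveRoot (s 1) d := by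
  have h : ∀ k, s 1 ^ k = 1 ↔ s ^ k = 1 := fun k => by
    rw [← pow_apply_one]
    exact ⟨fun h => linearEquiv_ext_one (by simpa using h), fun h => by rw [h]; rfl⟩
  rw [IsPrimitiveRoot.iff_def]
  refine ⟨(h d).2 (hs ▸ pow_orderOf_eq_one s), fun l hl => ?_⟩
  rw [← hs]
  exact orderOf_dvd_of_pow_eq_one ((h l).1 hl)

lemma apply_one_ne_zero (s : ℂ ≃ₗ[ℂ] ℂ) : s 1 ≠ 0 := by simp

/-- Inside any window of `d` consecutive exponents the slopes are distinct, which is primitivity of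
`s 1` after cancelling the unit `s 1 ^ i`. -/
lemma apply_one_pow_inj (hs : orderOf s = d) {i k l : ℕ} (hk : k < d) (hl : l < d)
    (h : s 1 ^ (i + k) = s 1 ^ (i + l)) : k = l := by
  rw [pow_add, pow_add] at h
  exact (isPrimitiveRoot_apply_one hs).pow_inj hk hl
    (mul_left_cancel₀ (pow_ne_zero _ (apply_one_ne_zero s)) h)

/-- The equation of the union of the graphs of a segment. -/
def segPoly (ζ : ℂ) (i n : ℕ) : MvPolynomial (Fin 2) ℂ :=
  ∏ k ∈ Finset.range n,
    (MvPolynomial.X 0 - MvPolynomial.C (ζ ^ (i + k)) * MvPolynomial.X 1)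

lemma aeval_segPoly {K : Type*} [CommRing K] [Algebra ℂ K] (x y : K) (ζ : ℂ) (i n : ℕ) :
    MvPolynomial.aeval ![x, y] (segPoly ζ i n) =
      ∏ k ∈ Finset.range n, (x - algebraMap ℂ K (ζ ^ (i + k)) * y) := by
  simp [segPoly]

lemma mem_graphIdeal_seg {i n : ℕ} {p : MvPolynomial (Fin 2) ℂ} :
    p ∈ graphIdeal (seg s i n) ↔ ∀ k < n, restr (s 1 ^ (i + k)) p = 0 := by
  rw [mem_graphIdeal_iff_restr]
  constructor
  · intro h k hk
    rw [← pow_apply_one]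
    exact h _ ⟨k, hk, rfl⟩
  · rintro h _ ⟨k, hk, rfl⟩
    rw [pow_apply_one]
    exact h k hk

lemma segPoly_mem (i n : ℕ) : segPoly (s 1) i n ∈ graphIdeal (seg s i n) := by
  rw [mem_graphIdeal_seg]
  intro k hk
  rw [restr, aeval_segPoly]
  refine Finset.prod_eq_zero (Finset.mem_range.2 hk) ?_
  simp

/-- Lines are added one at a time. The product of the earlier forms does not vanish on the new line,
as the slopes are distinct for `n ≤ d`, so the cofactor vanishes there and is divisible by the new
form. -/
lemma graphIdeal_seg (hs : orderOf s = d) {i n : ℕ} (hn : n ≤ d) :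
    graphIdeal (seg s i n) = Ideal.span {segPoly (s 1) i n} := by
  refine le_antisymm ?_ (by
    rw [Ideal.span_le, Set.singleton_subset_iff]; exact segPoly_mem i n)
  induction n with
  | zero =>
    intro p _
    simp [segPoly]
  | succ n ih =>
    intro p hp
    rw [mem_graphIdeal_seg] at hp
    have h1 := ih (by omega) (mem_graphIdeal_seg.2 fun k hk => hp k (by omega))
    rw [Ideal.mem_span_singleton] at h1 ⊢
    obtain ⟨q, rfl⟩ := h1
    have h2 := hp n (by omega)
    rw [map_mul, mul_eq_zero] at h2
    -- On the line of slope `ζ ^ (i + n)` the factor number `k` restricts to `(ζ ^ (i + n) - ζ ^ (i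
    -- + k)) X`.
    have h3 : restr (s 1 ^ (i + n)) (segPoly (s 1) i n) ≠ 0 := by
      rw [restr, aeval_segPoly, Finset.prod_ne_zero_iff]
      intro k hk h
      have hk := Finset.mem_range.1 hk
      rw [Polynomial.algebraMap_eq, ← sub_mul, ← Polynomial.C_sub, mul_eq_zero,
        Polynomial.C_eq_zero, sub_eq_zero] at h
      rcases h with h | h
      · have := apply_one_pow_inj hs (by omega) (by omega) h
        omega
      · exact Polynomial.X_ne_zero h
    obtain ⟨r, rfl⟩ := dvd_of_restr_eq_zero (h2.resolve_left h3)
    rw [segPoly, Finset.prod_range_succ, ← segPoly]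
    exact ⟨r, by ring⟩

lemma pow_mem_seg (hs : orderOf s = d) {i n m : ℕ} (hn : n ≤ d) (hm : m < d) :
    s ^ (i + m) ∈ seg s i n ↔ m < n := by
  constructor
  · rintro ⟨k, hk, h⟩
    have h1 : s 1 ^ (i + m) = s 1 ^ (i + k) := by
      rw [← pow_apply_one, ← pow_apply_one, h]
    have := apply_one_pow_inj hs hm (by omega) h1
    omega
  · exact fun h => ⟨m, h, rfl⟩

lemma seg_mod (hs : orderOf s = d) (i n : ℕ) : seg s (i % d) n = seg s i n := by
  have h : ∀ k, s ^ (i % d + k) = s ^ (i + k) := fun k => by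
    rw [pow_add, pow_add, ← hs, pow_mod_orderOf]
  simp only [seg, h]

/-- The segment of full length does not depend on the starting point. -/
lemma seg_full (hs : orderOf s = d) (hd : 0 < d) (i : ℕ) : seg s i d = seg s 0 d := by
  have key : ∀ i j m : ℕ, s ^ m ∈ seg s j d := fun i j m => by
    -- The offset is the residue of `m - j` modulo `d`, written without negative numbers.
    refine ⟨(m + (d - j % d)) % d, Nat.mod_lt _ hd, ?_⟩
    have hj := Nat.mod_lt j hd
    have : (j + (m + (d - j % d)) % d) ≡ m [MOD orderOf s] := by
      rw [hs]
      have h1 : (j + (m + (d - j % d)) % d) ≡ j % d + (m + (d - j % d)) [MOD d] :=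
        Nat.ModEq.add (Nat.mod_modEq j d).symm (Nat.mod_modEq _ d)
      have h2 : j % d + (m + (d - j % d)) = m + d := by omega
      rw [h2] at h1
      exact h1.trans (by simp [Nat.ModEq])
    exact (pow_eq_pow_iff_modEq.2 this).symm
  ext x
  constructor
  · rintro ⟨k, _, rfl⟩
    exact key i 0 _
  · rintro ⟨k, _, rfl⟩
    exact key 0 i _

lemma seg_nonempty {i n : ℕ} (hn : 0 < n) : (seg s i n).Nonempty := ⟨_, 0, hn, rfl⟩

/-- The starting point of a proper segment is its only element whose predecessor lies outside it.
This fails for the full group, hence the strict bounds on the lengths. -/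
lemma seg_injective (hs : orderOf s = d) {i i' n n' : ℕ} (hi : i < d) (hi' : i' < d)
    (hn : 0 < n) (hnd : n < d) (hnd' : n' < d) (h : seg s i n = seg s i' n') :
    i = i' ∧ n = n' := by
  have hpow : ∀ m, s ^ (m + d) = s ^ m := fun m => by
    rw [pow_add, ← hs, pow_orderOf_eq_one, mul_one]
  have step : ∀ i n i' n' : ℕ, n < d → n' < d → 0 < n → seg s i n = seg s i' n' →
      ∃ k < d, s ^ i = s ^ (i' + k) ∧ k = 0 := by
    intro i n i' n' hnd hnd' hn h
    have h1 : s ^ i ∈ seg s i' n' := h ▸ ⟨0, hn, rfl⟩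
    obtain ⟨k, hk, hik⟩ := h1
    refine ⟨k, by omega, hik, ?_⟩
    by_contra hk0
    have h2 : s ^ (i' + (k - 1)) ∈ seg s i n := h ▸ ⟨k - 1, by omega, rfl⟩
    -- If `s ^ i` had offset `k > 0` in the second segment, its predecessor would lie in the segment
    -- too. But this predecessor has offset `d - 1` from `i`, which is not less than `n`.
    have h3 : s ^ (i' + (k - 1)) = s ^ (i + (d - 1)) := by
      have e1 : s ^ (i' + (k - 1)) * s = s ^ (i + (d - 1)) * s := by
        rw [← pow_succ, ← pow_succ, show i' + (k - 1) + 1 = i' + k by omega,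
          show i + (d - 1) + 1 = i + d by omega, hpow, hik]
      exact mul_right_cancel e1
    rw [h3, pow_mem_seg hs hnd.le (by omega)] at h2
    omega
  have hii : i = i' := by
    obtain ⟨k, _, hk, rfl⟩ := step i n i' n' hnd hnd' hn h
    have h1 : s 1 ^ (0 + i) = s 1 ^ (0 + i') := by
      rw [← pow_apply_one, ← pow_apply_one, zero_add, zero_add, hk, add_zero]
    exact apply_one_pow_inj hs hi hi' h1
  subst hii
  refine ⟨rfl, ?_⟩
  -- With equal starting points, the lengths are compared by testing the first element past the end
  -- of each segment for membership in the other.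
  have h1 := (pow_mem_seg hs hnd.le hnd (i := i))
  have h2 := (pow_mem_seg hs hnd'.le hnd' (i := i))
  have h3 := (pow_mem_seg hs hnd'.le hnd (i := i))
  have h4 := (pow_mem_seg hs hnd.le hnd' (i := i))
  rw [h] at h1 h4
  have := h1.symm.trans h3
  have := h2.symm.trans h4
  omega

lemma cycConn_iff (hs : orderOf s = d) (hd : 0 < d) {A : Set (ℂ ≃ₗ[ℂ] ℂ)} :
    CycConn s A ↔ ∃ i n, 0 < n ∧ n ≤ d ∧ A = seg s i n := by
  have e : ∀ i j, {x | ∃ k ≤ j, x = s ^ (i + k)} = seg s i (j + 1) := fun i j => by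
    simp only [seg, Nat.lt_succ_iff]
  constructor
  · rintro ⟨i, j, hi, hj, rfl⟩
    exact ⟨i, j + 1, by omega, by omega, e i j⟩
  · rintro ⟨i, n, hn, hnd, rfl⟩
    refine ⟨i % d, n - 1, by rw [hs]; exact Nat.mod_lt _ hd, by omega, ?_⟩
    rw [e, Nat.sub_add_cancel hn, seg_mod hs]

/-- The equation of the segment vanishes at the point of the line of `x` with `v = 1`, so one of its
linear factors does, and this fixes the slope of `x`. -/
lemma subset_of_graphIdeal_le {i n : ℕ} {A : Set (ℂ ≃ₗ[ℂ] ℂ)}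
    (h : graphIdeal (seg s i n) ≤ graphIdeal A) : A ⊆ seg s i n := by
  intro x hx
  have h1 := mem_graphIdeal.1 (h (segPoly_mem i n)) x hx 1
  rw [aeval_segPoly, Finset.prod_eq_zero_iff] at h1
  obtain ⟨k, hk, h2⟩ := h1
  refine ⟨k, Finset.mem_range.1 hk, linearEquiv_ext_one ?_⟩
  rw [pow_apply_one]
  simpa [sub_eq_zero] using h2

end Segments

/-! ### Tensor products of rings of regular functions -/

section TensorRing

variable {A E : Set (ℂ ≃ₗ[ℂ] ℂ)}

/-- The ring of regular functions, with its structure of an algebra only. -/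
def FunRing (A : Set (ℂ ≃ₗ[ℂ] ℂ)) : Type := ORing A

instance : CommRing (FunRing A) := inferInstanceAs (CommRing (ORing A))

instance : Algebra ℂ (FunRing A) := inferInstanceAs (Algebra ℂ (ORing A))

/-- The regular function given by a polynomial. -/
def funMk (A : Set (ℂ ≃ₗ[ℂ] ℂ)) : MvPolynomial (Fin 2) ℂ →ₐ[ℂ] FunRing A :=
  Ideal.Quotient.mkₐ ℂ (graphIdeal A)

lemma funMk_surjective : Function.Surjective (funMk A) :=
  Ideal.Quotient.mkₐ_surjective ℂ (graphIdeal A)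

lemma funMk_eq_zero {p : MvPolynomial (Fin 2) ℂ} (hp : p ∈ graphIdeal A) : funMk A p = 0 :=
  Ideal.Quotient.eq_zero_iff_mem.2 hp

/-- The ideal identifying the two actions in the middle. -/
def midIdeal (A E : Set (ℂ ≃ₗ[ℂ] ℂ)) : Ideal (FunRing A ⊗[ℂ] FunRing E) :=
  Ideal.span {(funMk A (MvPolynomial.X 1)) ⊗ₜ[ℂ] (1 : FunRing E) -
    (1 : FunRing A) ⊗ₜ[ℂ] (funMk E (MvPolynomial.X 0))}

/-- The tensor product of two rings of regular functions over `R`, as a ring. -/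
abbrev TensRing (A E : Set (ℂ ≃ₗ[ℂ] ℂ)) : Type := (FunRing A ⊗[ℂ] FunRing E) ⧸ midIdeal A E

/-- The comparison of the ring with the bimodule before taking quotients. -/
def preTensRingMap (A E : Set (ℂ ≃ₗ[ℂ] ℂ)) :
    (FunRing A ⊗[ℂ] FunRing E) →ₗ[ℂ] (tens (O A) (O E)).carrier :=
  (tensRel (O A) (O E)).mkQ

/-- A multiple of the generator by a pure tensor `m ⊗ n` is exactly the balancing relation of `m`
and `n` for the coordinate of `R`. -/
lemma preTensRingMap_midIdeal {w : FunRing A ⊗[ℂ] FunRing E} (hw : w ∈ midIdeal A E) :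
    preTensRingMap A E w = 0 := by
  obtain ⟨a, rfl⟩ := Ideal.mem_span_singleton'.1 hw
  induction a using TensorProduct.induction_on with
  | zero => rw [zero_mul, map_zero]
  | add a b ha hb =>
    rw [add_mul, map_add, ha (Ideal.mul_mem_left _ _ (Ideal.subset_span rfl)),
      hb (Ideal.mul_mem_left _ _ (Ideal.subset_span rfl)), add_zero]
  | tmul m n =>
    rw [mul_sub, Algebra.TensorProduct.tmul_mul_tmul, Algebra.TensorProduct.tmul_mul_tmul,
      mul_one, mul_one, map_sub, sub_eq_zero]
    have h := tp_bal (M := O A) (N := O E) Polynomial.X m n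
    have h1 : (O A).ract Polynomial.X m =
        (m * funMk A (MvPolynomial.X 1) : FunRing A) := by
      have e : pull A 1 Polynomial.X = funMk A (MvPolynomial.X 1) := Polynomial.aeval_X _
      exact (congrArg (fun u : FunRing A => u * m) e).trans (mul_comm _ _)
    have h2 : (O E).lact Polynomial.X n =
        (n * funMk E (MvPolynomial.X 0) : FunRing E) := by
      have e : pull E 0 Polynomial.X = funMk E (MvPolynomial.X 0) := Polynomial.aeval_X _
      exact (congrArg (fun u : FunRing E => u * n) e).trans (mul_comm _ _)
    exact (congrArg (fun u => tp (O A) (O E) u n) h1.symm).trans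
      (h.trans (congrArg (fun u => tp (O A) (O E) m u) h2))

/-- The comparison of the tensor product as a ring with the tensor product as a bimodule. -/
def tensRingMap (A E : Set (ℂ ≃ₗ[ℂ] ℂ)) : TensRing A E →ₗ[ℂ] (tens (O A) (O E)).carrier :=
  Submodule.liftQ ((midIdeal A E).restrictScalars ℂ) (preTensRingMap A E)
    (fun _ hw => preTensRingMap_midIdeal hw)

/-- Functions on the first factor. -/
def leftFun (A E : Set (ℂ ≃ₗ[ℂ] ℂ)) : MvPolynomial (Fin 2) ℂ →ₐ[ℂ] TensRing A E :=
  ((Ideal.Quotient.mkₐ ℂ (midIdeal A E)).comp Algebra.TensorProduct.includeLeft).comp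
    (funMk A)

/-- Functions on the second factor. -/
def rightFun (A E : Set (ℂ ≃ₗ[ℂ] ℂ)) : MvPolynomial (Fin 2) ℂ →ₐ[ℂ] TensRing A E :=
  ((Ideal.Quotient.mkₐ ℂ (midIdeal A E)).comp Algebra.TensorProduct.includeRight).comp
    (funMk E)

lemma leftFun_eq_zero {p : MvPolynomial (Fin 2) ℂ} (hp : p ∈ graphIdeal A) :
    leftFun A E p = 0 := by
  rw [leftFun, AlgHom.comp_apply, funMk_eq_zero hp, map_zero]

lemma rightFun_eq_zero {p : MvPolynomial (Fin 2) ℂ} (hp : p ∈ graphIdeal E) :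
    rightFun A E p = 0 := by
  rw [rightFun, AlgHom.comp_apply, funMk_eq_zero hp, map_zero]

lemma tensRingMap_mul (p q : MvPolynomial (Fin 2) ℂ) :
    tensRingMap A E (leftFun A E p * rightFun A E q) =
      tp (O A) (O E) (O.mk A p) (O.mk E q) := by
  have : leftFun A E p * rightFun A E q = Ideal.Quotient.mkₐ ℂ (midIdeal A E)
      ((funMk A p) ⊗ₜ[ℂ] (funMk E q)) := by
    simp only [leftFun, rightFun, AlgHom.comp_apply, ← map_mul,
      Algebra.TensorProduct.includeLeft_apply, Algebra.TensorProduct.includeRight_apply,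
      Algebra.TensorProduct.tmul_mul_tmul, mul_one, one_mul]
  rw [this]; rfl

variable (A E) in
/-- The middle coordinate. -/
def midCoord : TensRing A E := leftFun A E (MvPolynomial.X 1)

lemma rightFun_X0 : rightFun A E (MvPolynomial.X 0) = midCoord A E := by
  symm
  rw [midCoord, leftFun, rightFun, AlgHom.comp_apply, AlgHom.comp_apply, AlgHom.comp_apply,
    AlgHom.comp_apply, ← sub_eq_zero, ← map_sub]
  exact Ideal.Quotient.eq_zero_iff_mem.2 (Ideal.subset_span rfl)

variable (A E) in
/-- Functions of the two outer coordinates. -/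
def outerFun : MvPolynomial (Fin 2) ℂ →ₐ[ℂ] TensRing A E :=
  MvPolynomial.aeval ![leftFun A E (MvPolynomial.X 0), rightFun A E (MvPolynomial.X 1)]

lemma outerFun_X0 : outerFun A E (MvPolynomial.X 0) = leftFun A E (MvPolynomial.X 0) := by
  simp [outerFun]

lemma outerFun_X1 : outerFun A E (MvPolynomial.X 1) = rightFun A E (MvPolynomial.X 1) := by
  simp [outerFun]

lemma tensRing_induction {P : TensRing A E → Prop} (ha : ∀ x y, P x → P y → P (x + y))
    (ht : ∀ p q, P (leftFun A E p * rightFun A E q)) (w : TensRing A E) : P w := by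
  obtain ⟨w, rfl⟩ := Ideal.Quotient.mkₐ_surjective ℂ (midIdeal A E) w
  induction w using TensorProduct.induction_on with
  | zero => simpa using ht 0 0
  | add x y hx hy => rw [map_add]; exact ha _ _ hx hy
  | tmul m n =>
    obtain ⟨p, rfl⟩ := funMk_surjective m
    obtain ⟨q, rfl⟩ := funMk_surjective n
    have := ht p q
    simpa only [leftFun, rightFun, AlgHom.comp_apply, ← map_mul,
      Algebra.TensorProduct.includeLeft_apply, Algebra.TensorProduct.includeRight_apply,
      Algebra.TensorProduct.tmul_mul_tmul, mul_one, one_mul] using this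

/-- Only this direction is needed: relations and generators are carried from the ring to the
bimodule, while independence is tested in the bimodule by `tensEval`. -/
lemma tensRingMap_surjective : Function.Surjective (tensRingMap A E) := by
  intro t
  induction t using tp_ind with
  | hz => exact ⟨0, map_zero _⟩
  | ha x y hx hy =>
    obtain ⟨a, rfl⟩ := hx
    obtain ⟨b, rfl⟩ := hy
    exact ⟨a + b, map_add _ _ _⟩
  | ht m n =>
    obtain ⟨p, rfl⟩ := O.mk_surjective m
    obtain ⟨q, rfl⟩ := O.mk_surjective n
    exact ⟨_, tensRingMap_mul p q⟩

lemma tp_act_X0 {M N : GrBimod} (m : M.carrier) (n : N.carrier) :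
    (tens M N).act (MvPolynomial.X 0) (tp M N m n) = tp M N (M.act (MvPolynomial.X 0) m) n := by
  rw [act_X0, act_X0, tp_lact]

lemma tp_act_X1 {M N : GrBimod} (m : M.carrier) (n : N.carrier) :
    (tens M N).act (MvPolynomial.X 1) (tp M N m n) = tp M N m (N.act (MvPolynomial.X 1) n) := by
  rw [act_X1, act_X1, tp_ract]

lemma act_tensRingMap (p : MvPolynomial (Fin 2) ℂ) (w : TensRing A E) :
    (tens (O A) (O E)).act p (tensRingMap A E w) = tensRingMap A E (outerFun A E p * w) := by
  induction p using MvPolynomial.induction_on generalizing w with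
  | C a =>
    rw [act_C, ← map_smul, ← MvPolynomial.algebraMap_eq, AlgHom.commutes]
    exact congrArg (tensRingMap A E) (Algebra.smul_def a w)
  | add p q hp hq => rw [map_add, LinearMap.add_apply, hp, hq, map_add, add_mul, map_add]
  | mul_X p i hp =>
    rw [act_mul, map_mul (outerFun A E), mul_assoc, ← hp]
    congr 1
    induction w using tensRing_induction with
    | ha x y hx hy => simp only [map_add, mul_add, hx, hy]
    | ht u v =>
      rw [tensRingMap_mul]
      fin_cases i
      · rw [Fin.zero_eta, outerFun_X0, ← mul_assoc, ← map_mul, tensRingMap_mul, tp_act_X0, O.act_mk]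
      · rw [Fin.mk_one, outerFun_X1, mul_left_comm, ← map_mul, tensRingMap_mul, tp_act_X1, O.act_mk]

/-- The evaluation of a regular function at a point. -/
def O.eval {x : ℂ ≃ₗ[ℂ] ℂ} (hx : x ∈ A) (v : ℂ) : (O A).carrier →ₗ[ℂ] ℂ :=
  Submodule.liftQ ((graphIdeal A).restrictScalars ℂ) (MvPolynomial.aeval ![x v, v]).toLinearMap
    (fun _ hp => mem_graphIdeal.1 hp x hx v)

lemma O.eval_mk {x : ℂ ≃ₗ[ℂ] ℂ} (hx : x ∈ A) (v : ℂ) (p : MvPolynomial (Fin 2) ℂ) :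
    O.eval hx v (O.mk A p) = MvPolynomial.aeval ![x v, v] p := rfl

lemma O.eval_lact {x : ℂ ≃ₗ[ℂ] ℂ} (hx : x ∈ A) (v : ℂ) (p : R) (m : (O A).carrier) :
    O.eval hx v ((O A).lact p m) = p.eval (x v) * O.eval hx v m := by
  obtain ⟨q, rfl⟩ := O.mk_surjective m
  rw [← act_left, O.act_mk, O.eval_mk, O.eval_mk, map_mul, ← Polynomial.aeval_algHom_apply]
  simp [Polynomial.aeval_def]

lemma O.eval_ract {x : ℂ ≃ₗ[ℂ] ℂ} (hx : x ∈ A) (v : ℂ) (p : R) (m : (O A).carrier) :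
    O.eval hx v ((O A).ract p m) = p.eval v * O.eval hx v m := by
  obtain ⟨q, rfl⟩ := O.mk_surjective m
  rw [← act_right, O.act_mk, O.eval_mk, O.eval_mk, map_mul, ← Polynomial.aeval_algHom_apply]
  simp [Polynomial.aeval_def]

/-- The evaluation of an element of a tensor product at a point. -/
def tensEval {a e : ℂ ≃ₗ[ℂ] ℂ} (ha : a ∈ A) (he : e ∈ E) (v : ℂ) :
    (tens (O A) (O E)).carrier →ₗ[ℂ] ℂ :=
  tl ((LinearMap.mul ℂ ℂ).compl₁₂ (O.eval ha (e v)) (O.eval he v)) (fun p m n => by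
    simp only [LinearMap.compl₁₂_apply, LinearMap.mul_apply', O.eval_lact, O.eval_ract]
    ring)

lemma tensEval_tp {a e : ℂ ≃ₗ[ℂ] ℂ} (ha : a ∈ A) (he : e ∈ E) (v : ℂ)
    (p q : MvPolynomial (Fin 2) ℂ) :
    tensEval ha he v (tp (O A) (O E) (O.mk A p) (O.mk E q)) =
      MvPolynomial.aeval ![a (e v), e v] p * MvPolynomial.aeval ![e v, v] q := by
  rw [tensEval, tl_tp]
  rfl

lemma tensEval_act {a e : ℂ ≃ₗ[ℂ] ℂ} (ha : a ∈ A) (he : e ∈ E) (v : ℂ)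
    (p : MvPolynomial (Fin 2) ℂ) (t : (tens (O A) (O E)).carrier) :
    tensEval ha he v ((tens (O A) (O E)).act p t) =
      MvPolynomial.aeval ![a (e v), v] p * tensEval ha he v t := by
  induction p using MvPolynomial.induction_on generalizing t with
  | C c => rw [act_C, map_smul]; simp
  | add p q hp hq => rw [map_add, LinearMap.add_apply, map_add, hp, hq, map_add, add_mul]
  | mul_X p i hp =>
    rw [act_mul, hp, map_mul, mul_assoc]
    congr 1
    induction t using tp_ind with
    | hz => simp
    | ha x y hx hy => simp only [map_add, mul_add, hx, hy]
    | ht m n =>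
      obtain ⟨p, rfl⟩ := O.mk_surjective m
      obtain ⟨q, rfl⟩ := O.mk_surjective n
      fin_cases i
      · simp only [Fin.zero_eta, tp_act_X0, O.act_mk, tensEval_tp, map_mul, MvPolynomial.aeval_X,
          Matrix.cons_val_zero, mul_assoc]
      · simp only [Fin.mk_one, tp_act_X1, O.act_mk, tensEval_tp, map_mul, MvPolynomial.aeval_X,
          Matrix.cons_val_one]
        exact mul_left_comm _ _ _

/-- A bimodule with two generators and independent relations between them is a direct sum of
shifted rings of regular functions. -/
lemma two_generator_split {B C : Set (ℂ ≃ₗ[ℂ] ℂ)} {M : GrBimod} {n : ℤ} (u w : M.carrier)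
    (hu : u ∈ M.gr (-0)) (hw : w ∈ M.gr (-n))
    (hB : ∀ p ∈ graphIdeal B, M.act p u = 0) (hC : ∀ p ∈ graphIdeal C, M.act p w = 0)
    (hgen : ∀ t, ∃ p q, t = M.act p u + M.act q w)
    (hind : ∀ p q, M.act p u + M.act q w = 0 → p ∈ graphIdeal B ∧ q ∈ graphIdeal C) :
    Nonempty (M ≅ ((O B).shift 0).sum ((O C).shift n)) := by
  let f : ((O B).shift 0).sum ((O C).shift n) ⟶ M :=
    fst _ _ ≫ O.desc B 0 u hu hB + snd _ _ ≫ O.desc C n w hw hC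
  have hf : ∀ p q, f.lin ((O B).act p (O.one B), (O C).act q (O.one C)) =
      M.act p u + M.act q w := fun p q =>
    congrArg₂ (· + ·) (O.desc_act_one 0 u hu hB p) (O.desc_act_one n w hw hC q)
  refine ⟨(isoOfBijective f ⟨?_, ?_⟩).symm⟩
  · rw [injective_iff_map_eq_zero]
    rintro ⟨a, b⟩ h
    obtain ⟨p, rfl⟩ := O.exists_act (A := B) a
    obtain ⟨q, rfl⟩ := O.exists_act (A := C) b
    obtain ⟨h1, h2⟩ := hind p q ((hf p q).symm.trans h)
    exact Prod.ext (O.act_one_eq_zero.2 h1) (O.act_one_eq_zero.2 h2)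
  · intro t
    obtain ⟨p, q, rfl⟩ := hgen t
    exact ⟨_, hf p q⟩

end TensorRing

/-! ### Tensor products with the generator -/

section Identities

variable {K : Type*} [CommRing K] {x y z ζ : K}

lemma geom_shift (ζ : K) (i n : ℕ) :
    (1 - ζ) * ∑ k ∈ Finset.range n, ζ ^ (i + k) = ζ ^ i - ζ ^ (i + n) := by
  induction n with
  | zero => simp
  | succ n ih => rw [Finset.sum_range_succ, mul_add, ih]; ring

/-- The two values `y = z` and `y = ζ z` turn the product into those over the exponents `i, …, i +
n` and `i + 1, …, i + n + 1`. They share the factors `i + 1, …, i + n`. The last factor on the right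
interpolates linearly in `y` between the remaining ones, `x - ζ ^ i z` and `x - ζ ^ (i + n + 1) z`;
the geometric sum is the slope required. -/
lemma prod_eq_of_quadratic (hq : (y - z) * (y - ζ * z) = 0) (x : K) (i n : ℕ) :
    ∏ k ∈ Finset.range (n + 1), (x - ζ ^ (i + k) * y) =
      (∏ k ∈ Finset.range n, (x - ζ ^ (i + 1 + k) * z)) *
        (x - (ζ ^ i - ∑ k ∈ Finset.range (n + 1), ζ ^ (i + k)) * z -
          (∑ k ∈ Finset.range (n + 1), ζ ^ (i + k)) * y) := by
  induction n with
  | zero => simp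
  | succ n ih =>
    rw [Finset.prod_range_succ, ih, Finset.prod_range_succ _ n, mul_assoc, mul_assoc,
      Finset.sum_range_succ _ (n + 1)]
    congr 1
    have hg := geom_shift ζ i (n + 1)
    rw [show i + 1 + n = i + (n + 1) by ring]
    generalize ∑ k ∈ Finset.range (n + 1), ζ ^ (i + k) = g at *
    generalize ζ ^ (i + (n + 1)) = η at *
    linear_combination (η * g) * hq - η * (z * y - z * z) * hg

/-- The second factor is the conjugate of the first: it takes the values `x - η z` and `x - a z` at
`y = z` and `y = ζ z`, the first takes them in the opposite order. Since `K` need not be a domain,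
the identity is derived from the quadratic relation and not by cases. -/
lemma mul_conj_of_quadratic (hq : (y - z) * (y - ζ * z) = 0) (x : K) {a g η : K}
    (hg : (1 - ζ) * g = a - η) :
    (x - (a - g) * z - g * y) * (x - (η + g) * z + g * y) = (x - a * z) * (x - η * z) := by
  linear_combination (- g ^ 2) * hq - (g * z * z - g * z * y) * hg

lemma prod_range_add_two (x z ζ : K) (i n : ℕ) :
    ∏ k ∈ Finset.range (n + 2), (x - ζ ^ (i + k) * z) =
      (∏ k ∈ Finset.range n, (x - ζ ^ (i + 1 + k) * z)) *
        ((x - ζ ^ i * z) * (x - ζ ^ (i + (n + 1)) * z)) := by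
  rw [Finset.prod_range_succ, Finset.prod_range_succ', add_zero, mul_assoc]
  congr 1
  exact Finset.prod_congr rfl fun k _ => by rw [show i + (k + 1) = i + 1 + k by ring]

end Identities

/-! ### Splitting the tensor product of a segment with the generator -/

section Generator

variable {s : ℂ ≃ₗ[ℂ] ℂ} {d : ℕ}

lemma seg_zero_two (s : ℂ ≃ₗ[ℂ] ℂ) : seg s 0 2 = {1, s} := by
  ext x
  simp only [seg, zero_add, Set.mem_insert_iff, Set.mem_singleton_iff]
  constructor
  · rintro ⟨k, hk, rfl⟩
    interval_cases k
    · exact Or.inl (pow_zero s)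
    · exact Or.inr (pow_one s)
  · rintro (rfl | rfl)
    · exact ⟨0, by norm_num, (pow_zero s).symm⟩
    · exact ⟨1, by norm_num, (pow_one x).symm⟩

variable (A : Set (ℂ ≃ₗ[ℂ] ℂ)) (s)

/-- The number `s 1` in the ring underlying a tensor product with the generator. -/
def scal : TensRing A {1, s} := algebraMap ℂ _ (s 1)

lemma leftFun_eq {A E : Set (ℂ ≃ₗ[ℂ] ℂ)} : leftFun A E =
    MvPolynomial.aeval ![outerFun A E (MvPolynomial.X 0), midCoord A E] := by
  apply MvPolynomial.algHom_ext
  intro i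
  fin_cases i
  · simp [outerFun_X0]
  · simp [midCoord]

lemma rightFun_eq {A E : Set (ℂ ≃ₗ[ℂ] ℂ)} : rightFun A E =
    MvPolynomial.aeval ![midCoord A E, outerFun A E (MvPolynomial.X 1)] := by
  apply MvPolynomial.algHom_ext
  intro i
  fin_cases i
  · simp [rightFun_X0]
  · simp [outerFun_X1]

lemma outerFun_eq {A E : Set (ℂ ≃ₗ[ℂ] ℂ)} : outerFun A E = MvPolynomial.aeval
    ![outerFun A E (MvPolynomial.X 0), outerFun A E (MvPolynomial.X 1)] := by
  rw [outerFun_X0, outerFun_X1]; rfl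

/-- This is the equation of the two lines of `1` and `s`, read in the second tensor factor. -/
lemma midCoord_quadratic :
    (midCoord A {1, s} - outerFun A {1, s} (MvPolynomial.X 1)) *
      (midCoord A {1, s} - scal s A * outerFun A {1, s} (MvPolynomial.X 1)) = 0 := by
  have h := rightFun_eq_zero (A := A) (seg_zero_two s ▸ segPoly_mem (s := s) 0 2)
  rw [rightFun_eq, aeval_segPoly] at h
  simpa [Finset.prod_range_succ, scal] using h

variable {A} in
-- The quadratic relation for the middle coordinate makes the elements of this form a subring, and
-- it contains all coordinates.
lemma exists_outerFun (w : TensRing A {1, s}) :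
    ∃ p q, w = outerFun A {1, s} p + outerFun A {1, s} q * midCoord A {1, s} := by
  have hm : ∀ a b : TensRing A {1, s},
      (∃ p q, a = outerFun A {1, s} p + outerFun A {1, s} q * midCoord A {1, s}) →
      (∃ p q, b = outerFun A {1, s} p + outerFun A {1, s} q * midCoord A {1, s}) →
      ∃ p q, a * b = outerFun A {1, s} p + outerFun A {1, s} q * midCoord A {1, s} := by
    rintro _ _ ⟨p, q, rfl⟩ ⟨p', q', rfl⟩
    -- The square of the middle coordinate is replaced using `y ^ 2 = (1 + ζ) z y - ζ z ^ 2`.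
    refine ⟨p * p' - q * q' * (MvPolynomial.C (s 1) * MvPolynomial.X 1 ^ 2),
      p * q' + q * p' + q * q' * ((1 + MvPolynomial.C (s 1)) * MvPolynomial.X 1), ?_⟩
    have hq := midCoord_quadratic s A
    have hC : outerFun A {1, s} (MvPolynomial.C (s 1)) = scal s A := by
      rw [← MvPolynomial.algebraMap_eq, AlgHom.commutes]; rfl
    simp only [map_add, map_sub, map_mul, map_pow, hC, map_one]
    linear_combination (outerFun A {1, s} q * outerFun A {1, s} q') * hq
  have ha : ∀ a b : TensRing A {1, s},
      (∃ p q, a = outerFun A {1, s} p + outerFun A {1, s} q * midCoord A {1, s}) →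
      (∃ p q, b = outerFun A {1, s} p + outerFun A {1, s} q * midCoord A {1, s}) →
      ∃ p q, a + b = outerFun A {1, s} p + outerFun A {1, s} q * midCoord A {1, s} := by
    rintro _ _ ⟨p, q, rfl⟩ ⟨p', q', rfl⟩
    exact ⟨p + p', q + q', by simp only [map_add]; ring⟩
  have hc : ∀ c, ∃ p q, algebraMap ℂ (TensRing A {1, s}) c =
      outerFun A {1, s} p + outerFun A {1, s} q * midCoord A {1, s} := fun c =>
    ⟨MvPolynomial.C c, 0, by rw [← MvPolynomial.algebraMap_eq, AlgHom.commutes]; simp⟩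
  have hy : ∃ p q, midCoord A {1, s} =
      outerFun A {1, s} p + outerFun A {1, s} q * midCoord A {1, s} := ⟨0, 1, by simp⟩
  have hx : ∀ i, ∃ p q, outerFun A {1, s} (MvPolynomial.X i) =
      outerFun A {1, s} p + outerFun A {1, s} q * midCoord A {1, s} :=
    fun i => ⟨MvPolynomial.X i, 0, by simp⟩
  induction w using tensRing_induction with
  | ha a b h1 h2 => exact ha _ _ h1 h2
  | ht p q =>
    refine hm _ _ ?_ ?_
    · induction p using MvPolynomial.induction_on with
      | C c => rw [← MvPolynomial.algebraMap_eq, AlgHom.commutes]; exact hc c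
      | add p q hp hq => rw [map_add]; exact ha _ _ hp hq
      | mul_X p i hp =>
        rw [map_mul]
        refine hm _ _ hp ?_
        fin_cases i
        · rw [Fin.zero_eta, ← outerFun_X0]; exact hx 0
        · exact hy
    · induction q using MvPolynomial.induction_on with
      | C c => rw [← MvPolynomial.algebraMap_eq, AlgHom.commutes]; exact hc c
      | add p q hp hq => rw [map_add]; exact ha _ _ hp hq
      | mul_X p i hp =>
        rw [map_mul]
        refine hm _ _ hp ?_
        fin_cases i
        · rw [Fin.zero_eta, rightFun_X0]; exact hy
        · rw [Fin.mk_one, ← outerFun_X1]; exact hx 1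

/-- The element `1 ⊗ 1`. -/
def tensOne (A E : Set (ℂ ≃ₗ[ℂ] ℂ)) : (tens (O A) (O E)).carrier :=
  tp (O A) (O E) (O.mk A 1) (O.mk E 1)

/-- The middle coordinate as an element of the tensor product of bimodules. -/
def tensMid (A E : Set (ℂ ≃ₗ[ℂ] ℂ)) : (tens (O A) (O E)).carrier :=
  tp (O A) (O E) (O.mk A (MvPolynomial.X 1)) (O.mk E 1)

lemma tensRingMap_one {A E : Set (ℂ ≃ₗ[ℂ] ℂ)} : tensRingMap A E 1 = tensOne A E := by
  rw [tensOne, ← tensRingMap_mul, map_one (leftFun A E), map_one (rightFun A E), one_mul]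

lemma tensRingMap_midCoord {A E : Set (ℂ ≃ₗ[ℂ] ℂ)} :
    tensRingMap A E (midCoord A E) = tensMid A E := by
  rw [tensMid, ← tensRingMap_mul, map_one (rightFun A E), mul_one]; rfl

lemma X_mem_homog (i : Fin 2) : (MvPolynomial.X i : MvPolynomial (Fin 2) ℂ) ∈ homog 2 :=
  MvPolynomial.isWeightedHomogeneous_X ℂ _ i

lemma tensOne_mem {A E : Set (ℂ ≃ₗ[ℂ] ℂ)} : tensOne A E ∈ (tens (O A) (O E)).gr 0 :=
  tp_mem O.one_mem O.one_mem rfl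

lemma tensMid_mem {A E : Set (ℂ ≃ₗ[ℂ] ℂ)} : tensMid A E ∈ (tens (O A) (O E)).gr 2 :=
  tp_mem ⟨_, X_mem_homog 1, rfl⟩ O.one_mem (add_zero 2)

lemma tensEval_tensOne {A E : Set (ℂ ≃ₗ[ℂ] ℂ)} {a e : ℂ ≃ₗ[ℂ] ℂ} (ha : a ∈ A) (he : e ∈ E)
    (v : ℂ) : tensEval ha he v (tensOne A E) = 1 := by
  rw [tensOne, tensEval_tp]; simp

lemma tensEval_tensMid {A E : Set (ℂ ≃ₗ[ℂ] ℂ)} {a e : ℂ ≃ₗ[ℂ] ℂ} (ha : a ∈ A) (he : e ∈ E)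
    (v : ℂ) : tensEval ha he v (tensMid A E) = e v := by
  rw [tensMid, tensEval_tp]; simp

lemma outerFun_C {A E : Set (ℂ ≃ₗ[ℂ] ℂ)} (c : ℂ) :
    outerFun A E (MvPolynomial.C c) = algebraMap ℂ _ c := by
  rw [← MvPolynomial.algebraMap_eq, AlgHom.commutes]

variable {s A}

/-- The pairs in `A × {1, s}` multiply onto the longer segment, hitting each end line once and each
interior line twice. One generator `1` lives on all lines, the other generator `w` vanishes on the
ends and so sees only the interior. For `n = 0` the second summand is zero. -/
lemma tens_gen_split (hs : orderOf s = d) {i n : ℕ} (hn : n + 1 < d) :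
    Nonempty (tens (O (seg s i (n + 1))) (O {1, s}) ≅
      ((O (seg s i (n + 2))).shift 0).sum ((O (seg s (i + 1) n)).shift (-2))) := by
  set A := seg s i (n + 1) with hA
  set ζ := s 1 with hζ
  let g : ℂ := ∑ k ∈ Finset.range (n + 1), ζ ^ (i + k)
  have hg1 : (1 - ζ) * g = ζ ^ i - ζ ^ (i + (n + 1)) := geom_shift ζ i (n + 1)
  -- The end lines are distinct because `n + 1 < d`. Hence `g` is nonzero and the middle coordinate
  -- can be recovered from `w`.
  have hne : ζ ^ i - ζ ^ (i + (n + 1)) ≠ 0 := by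
    intro h
    have := apply_one_pow_inj (s := s) (i := i) (k := 0) (l := n + 1) hs (by omega) hn
      (by rw [add_zero]; exact sub_eq_zero.1 h)
    omega
  have hg0 : g ≠ 0 := fun h => hne (by rw [← hg1, h, mul_zero])
  let T := tens (O A) (O {1, s})
  let L : MvPolynomial (Fin 2) ℂ :=
    MvPolynomial.X 0 - MvPolynomial.C (ζ ^ i - g) * MvPolynomial.X 1
  -- This is the interpolating linear factor of `prod_eq_of_quadratic`; `w'` is the same element in
  -- the ring. The product of that factor with the interior forms is the equation of `A` in `x` and
  -- `y`, hence zero.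
  let w : T.carrier := T.act L (tensOne A {1, s}) - g • tensMid A {1, s}
  let w' : TensRing A {1, s} := outerFun A {1, s} L - algebraMap ℂ _ g * midCoord A {1, s}
  have hw' : tensRingMap A {1, s} w' = w := by
    have h1 : tensRingMap A {1, s} (outerFun A {1, s} L) = T.act L (tensOne A {1, s}) := by
      rw [← tensRingMap_one, act_tensRingMap, mul_one]
    have h2 : algebraMap ℂ _ g * midCoord A {1, s} = g • midCoord A {1, s} :=
      (Algebra.smul_def _ _).symm
    rw [map_sub, h1, h2, map_smul, tensRingMap_midCoord]
  let x := outerFun A {1, s} (MvPolynomial.X 0)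
  let z := outerFun A {1, s} (MvPolynomial.X 1)
  let y := midCoord A {1, s}
  let ζ' := scal s A
  let g' := ∑ k ∈ Finset.range (n + 1), ζ' ^ (i + k)
  have hgg : algebraMap ℂ (TensRing A {1, s}) g = g' := by
    simp only [g, g', map_sum, map_pow]; rfl
  have hw2 : w' = x - (ζ' ^ i - g') * z - g' * y := by
    simp only [w', L]
    rw [map_sub, map_mul, outerFun_C, hgg, map_sub, hgg, map_pow]; rfl
  have hq : (y - z) * (y - ζ' * z) = 0 := midCoord_quadratic s A
  have hprod : ∏ k ∈ Finset.range (n + 1), (x - ζ' ^ (i + k) * y) = 0 := by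
    have h := leftFun_eq_zero (E := {1, s}) (segPoly_mem (s := s) i (n + 1))
    rw [leftFun_eq, aeval_segPoly] at h
    simp only [map_pow] at h
    exact h
  have hCw : (∏ k ∈ Finset.range n, (x - ζ' ^ (i + 1 + k) * z)) * w' = 0 := by
    rw [hw2, ← prod_eq_of_quadratic hq, hprod]
  -- The two end forms multiply to `w'` times its conjugate, and `w'` is already killed by the
  -- interior forms.
  have hBu : ∏ k ∈ Finset.range (n + 2), (x - ζ' ^ (i + k) * z) = 0 := by
    rw [prod_range_add_two, ← mul_conj_of_quadratic hq x (geom_shift ζ' i (n + 1)), ← hw2,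
      ← mul_assoc, hCw, zero_mul]
  have hout : ∀ j m, outerFun A {1, s} (segPoly (s 1) j m) =
      ∏ k ∈ Finset.range m, (x - ζ' ^ (j + k) * z) := fun j m => by
    rw [outerFun_eq, aeval_segPoly]
    simp only [map_pow]; rfl
  refine two_generator_split (tensOne A {1, s}) w tensOne_mem ?_ ?_ ?_ ?_ ?_
  · rw [neg_neg]
    refine sub_mem ?_ (Submodule.smul_mem _ _ tensMid_mem)
    exact act_mem (k := 2) (i := 0)
      (sub_mem (X_mem_homog 0) (by
        rw [MvPolynomial.C_mul']; exact Submodule.smul_mem _ _ (X_mem_homog 1))) tensOne_mem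
  · intro p hp
    rw [graphIdeal_seg hs (by omega), Ideal.mem_span_singleton] at hp
    obtain ⟨r, rfl⟩ := hp
    rw [← tensRingMap_one, act_tensRingMap, map_mul (outerFun A {1, s}), hout, hBu, zero_mul, zero_mul, map_zero]
  · intro p hp
    rw [graphIdeal_seg hs (by omega), Ideal.mem_span_singleton] at hp
    obtain ⟨r, rfl⟩ := hp
    rw [← hw', act_tensRingMap, map_mul (outerFun A {1, s}), hout, mul_right_comm, hCw, zero_mul, map_zero]
  · intro t
    obtain ⟨a, rfl⟩ := tensRingMap_surjective t
    obtain ⟨p, q, rfl⟩ := exists_outerFun s a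
    -- Substitute `y = g⁻¹ (L - w)`.
    refine ⟨p + q * (MvPolynomial.C g⁻¹ * L), - (MvPolynomial.C g⁻¹ * q), ?_⟩
    rw [← tensRingMap_one, ← hw', act_tensRingMap, act_tensRingMap, ← map_add]
    congr 1
    simp only [w']
    have e : algebraMap ℂ (TensRing A {1, s}) g⁻¹ * algebraMap ℂ (TensRing A {1, s}) g = 1 := by
      rw [← map_mul, inv_mul_cancel₀ hg0, map_one]
    simp only [map_add, map_mul, map_neg, outerFun_C]
    linear_combination (-outerFun A {1, s} q * midCoord A {1, s}) * e
  · intro p q h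
    -- Evaluation at the pair `(s ^ (i + m), 1)`, where the middle coordinate is `v` and `w` takes
    -- the value `(ζ ^ (i + m) - ζ ^ i) v`.
    have h1 : ∀ m < n + 1, ∀ v : ℂ, MvPolynomial.aeval ![ζ ^ (i + m) * v, v] p +
        MvPolynomial.aeval ![ζ ^ (i + m) * v, v] q * ((ζ ^ (i + m) - ζ ^ i) * v) = 0 := by
      intro m hm v
      have ha : s ^ (i + m) ∈ A := ⟨m, hm, rfl⟩
      have he := Set.mem_insert 1 {s}
      have e := congrArg (tensEval ha he v) h
      rw [map_add, map_zero, tensEval_act, tensEval_act, tensEval_tensOne, mul_one,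
        map_sub, map_smul, tensEval_act, tensEval_tensOne, tensEval_tensMid, mul_one,
        show (1 : ℂ ≃ₗ[ℂ] ℂ) v = v from rfl, pow_apply] at e
      simp only [L, map_sub, map_mul, MvPolynomial.aeval_X, MvPolynomial.aeval_C, Matrix.cons_val_zero,
        Matrix.cons_val_one, Algebra.algebraMap_self, RingHom.id_apply, smul_eq_mul] at e
      linear_combination e
    -- Evaluation at the pair `(s ^ (i + m), s)`, where the middle coordinate is `ζ v`. The value of
    -- `w` now vanishes on the last line instead of the first.
    have h2 : ∀ m < n + 1, ∀ v : ℂ, MvPolynomial.aeval ![ζ ^ (i + (m + 1)) * v, v] p +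
        MvPolynomial.aeval ![ζ ^ (i + (m + 1)) * v, v] q *
          ((ζ ^ (i + (m + 1)) - ζ ^ (i + (n + 1))) * v) = 0 := by
      intro m hm v
      have ha : s ^ (i + m) ∈ A := ⟨m, hm, rfl⟩
      have he := Set.mem_insert_of_mem 1 (Set.mem_singleton s)
      have e := congrArg (tensEval ha he v) h
      rw [map_add, map_zero, tensEval_act, tensEval_act, tensEval_tensOne, mul_one,
        map_sub, map_smul, tensEval_act, tensEval_tensOne, tensEval_tensMid, mul_one,
        apply_eq_mul s v, pow_apply, ← hζ,
        show ζ ^ (i + m) * (ζ * v) = ζ ^ (i + (m + 1)) * v by ring] at e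
      simp only [L, map_sub, map_mul, MvPolynomial.aeval_X, MvPolynomial.aeval_C, Matrix.cons_val_zero,
        Matrix.cons_val_one, Algebra.algebraMap_self, RingHom.id_apply, smul_eq_mul] at e
      linear_combination e - (MvPolynomial.aeval ![ζ ^ (i + (m + 1)) * v, v] q * v) * hg1
    -- An interior line is reached by both kinds of pairs. The two values of `w` differ by a nonzero
    -- multiple of `v`, so subtraction isolates `q`.
    have h3 : ∀ m < n, ∀ v : ℂ, v ≠ 0 →
        MvPolynomial.aeval ![ζ ^ (i + (m + 1)) * v, v] q = 0 := by
      intro m hm v hv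
      have e : MvPolynomial.aeval ![ζ ^ (i + (m + 1)) * v, v] q *
          ((ζ ^ i - ζ ^ (i + (n + 1))) * v) = 0 := by
        linear_combination h2 m (by omega) v - h1 (m + 1) (by omega) v
      exact (mul_eq_zero.1 e).resolve_right (mul_ne_zero hne hv)
    constructor
    · rw [mem_graphIdeal_seg]
      intro m hm
      refine restr_eq_zero fun v hv => ?_
      rcases Nat.eq_zero_or_pos m with rfl | hm0
      · simpa using h1 0 (by omega) v
      · obtain ⟨m, rfl⟩ : ∃ l, m = l + 1 := ⟨m - 1, by omega⟩
        have e := h2 m (by omega) v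
        by_cases hmn : m = n
        · subst hmn
          simpa using e
        · rwa [h3 m (by omega) v hv, zero_mul, add_zero] at e
    · rw [mem_graphIdeal_seg]
      intro m hm
      refine restr_eq_zero fun v hv => ?_
      rw [show i + 1 + m = i + (m + 1) by ring]
      exact h3 m hm v hv

/-- For the full group the geometric sum is zero, so the equation of `A` has the same form in `y` as
in `z`. Every line is reached by two pairs with middle coordinates `v` and `ζ v`, so `1` and `y` are
independent and have the same annihilator. -/
lemma tens_gen_split_full (hs : orderOf s = d) (hd : 1 < d) {i : ℕ} :
    Nonempty (tens (O (seg s i d)) (O {1, s}) ≅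
      ((O (seg s i d)).shift 0).sum ((O (seg s i d)).shift (-2))) := by
  obtain ⟨n, rfl⟩ : ∃ n, d = n + 1 := ⟨d - 1, by omega⟩
  set A := seg s i (n + 1) with hA
  set ζ := s 1 with hζ
  have hζd : ζ ^ (n + 1) = 1 := (isPrimitiveRoot_apply_one hs).pow_eq_one
  have hζ1 : ζ - 1 ≠ 0 := sub_ne_zero.2 ((isPrimitiveRoot_apply_one hs).ne_one hd)
  let T := tens (O A) (O {1, s})
  let x := outerFun A {1, s} (MvPolynomial.X 0)
  let z := outerFun A {1, s} (MvPolynomial.X 1)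
  let y := midCoord A {1, s}
  let ζ' := scal s A
  have hgg : ∑ k ∈ Finset.range (n + 1), ζ' ^ (i + k) = 0 := by
    have e : ∑ k ∈ Finset.range (n + 1), ζ ^ (i + k) = 0 := by
      have := geom_shift ζ i (n + 1)
      rw [pow_add, hζd, mul_one, sub_self, mul_eq_zero] at this
      exact this.resolve_left (fun h => hζ1 (by linear_combination -h))
    have e2 := congrArg (algebraMap ℂ (TensRing A {1, s})) e
    simp only [map_sum, map_pow, map_zero] at e2
    exact e2
  have hq : (y - z) * (y - ζ' * z) = 0 := midCoord_quadratic s A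
  have hprod : ∏ k ∈ Finset.range (n + 1), (x - ζ' ^ (i + k) * y) = 0 := by
    have h := leftFun_eq_zero (E := {1, s}) (segPoly_mem (s := s) i (n + 1))
    rw [leftFun_eq, aeval_segPoly] at h
    simp only [map_pow] at h
    exact h
  have hB : ∏ k ∈ Finset.range (n + 1), (x - ζ' ^ (i + k) * z) = 0 := by
    rw [prod_eq_of_quadratic hq, hgg, sub_zero, zero_mul, sub_zero] at hprod
    rw [Finset.prod_range_succ', add_zero, ← hprod]
    congr 1
    exact Finset.prod_congr rfl fun k _ => by rw [show i + (k + 1) = i + 1 + k by ring]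
  have hout : ∀ p ∈ graphIdeal A, outerFun A {1, s} p = 0 := by
    intro p hp
    rw [graphIdeal_seg hs le_rfl, Ideal.mem_span_singleton] at hp
    obtain ⟨r, rfl⟩ := hp
    rw [map_mul, outerFun_eq, aeval_segPoly]
    simp only [map_pow]
    exact mul_eq_zero_of_left hB _
  refine two_generator_split (tensOne A {1, s}) (tensMid A {1, s}) tensOne_mem tensMid_mem ?_ ?_ ?_ ?_
  · intro p hp
    rw [← tensRingMap_one, act_tensRingMap, hout p hp, zero_mul, map_zero]
  · intro p hp
    rw [← tensRingMap_midCoord, act_tensRingMap, hout p hp, zero_mul, map_zero]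
  · intro t
    obtain ⟨a, rfl⟩ := tensRingMap_surjective t
    obtain ⟨p, q, rfl⟩ := exists_outerFun s a
    refine ⟨p, q, ?_⟩
    rw [← tensRingMap_one, ← tensRingMap_midCoord, act_tensRingMap, act_tensRingMap, ← map_add,
      mul_one]
  · intro p q h
    have h1 : ∀ m < n + 1, ∀ v : ℂ, MvPolynomial.aeval ![ζ ^ (i + m) * v, v] p +
        MvPolynomial.aeval ![ζ ^ (i + m) * v, v] q * v = 0 := by
      intro m hm v
      have ha : s ^ (i + m) ∈ A := ⟨m, hm, rfl⟩
      have he := Set.mem_insert 1 {s}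
      have e := congrArg (tensEval ha he v) h
      rw [map_add, map_zero, tensEval_act, tensEval_act, tensEval_tensOne, mul_one, tensEval_tensMid,
        show (1 : ℂ ≃ₗ[ℂ] ℂ) v = v from rfl, pow_apply] at e
      exact e
    have h2 : ∀ m < n + 1, ∀ v : ℂ, MvPolynomial.aeval ![ζ ^ (i + (m + 1)) * v, v] p +
        MvPolynomial.aeval ![ζ ^ (i + (m + 1)) * v, v] q * (ζ * v) = 0 := by
      intro m hm v
      have ha : s ^ (i + m) ∈ A := ⟨m, hm, rfl⟩
      have he := Set.mem_insert_of_mem 1 (Set.mem_singleton s)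
      have e := congrArg (tensEval ha he v) h
      rw [map_add, map_zero, tensEval_act, tensEval_act, tensEval_tensOne, mul_one, tensEval_tensMid,
        apply_eq_mul s v, pow_apply, ← hζ,
        show ζ ^ (i + m) * (ζ * v) = ζ ^ (i + (m + 1)) * v by ring] at e
      exact e
    -- Reindexing `h2` cyclically: line `0` is line `n + 1`, since `ζ ^ (n + 1) = 1`.
    have h3 : ∀ m < n + 1, ∀ v : ℂ, MvPolynomial.aeval ![ζ ^ (i + m) * v, v] p +
        MvPolynomial.aeval ![ζ ^ (i + m) * v, v] q * (ζ * v) = 0 := by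
      intro m hm v
      rcases Nat.eq_zero_or_pos m with rfl | hm0
      · have := h2 n (by omega) v
        rwa [pow_add, hζd, mul_one] at this
      · have := h2 (m - 1) (by omega) v
        rwa [Nat.sub_add_cancel hm0] at this
    have h4 : ∀ m < n + 1, ∀ v : ℂ, v ≠ 0 →
        MvPolynomial.aeval ![ζ ^ (i + m) * v, v] q = 0 := by
      intro m hm v hv
      have e : MvPolynomial.aeval ![ζ ^ (i + m) * v, v] q * ((ζ - 1) * v) = 0 := by
        linear_combination h3 m hm v - h1 m hm v
      exact (mul_eq_zero.1 e).resolve_right (mul_ne_zero hζ1 hv)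
    constructor
    · rw [mem_graphIdeal_seg]
      intro m hm
      refine restr_eq_zero fun v hv => ?_
      have e := h1 m hm v
      rwa [h4 m hm v hv, zero_mul, add_zero] at e
    · rw [mem_graphIdeal_seg]
      exact fun m hm => restr_eq_zero fun v hv => h4 m hm v hv

end Generator

namespace GrBimod

variable {M N P : GrBimod}

/-! ### Idempotents and retracts -/

/-- The image of an idempotent endomorphism. -/
def imageIdem (e : N ⟶ N) (he : e ≫ e = e) : GrBimod :=
  have hee : ∀ m, e.lin (e.lin m) = e.lin m := fun m => congrArg (fun f : N ⟶ N => f.lin m) he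
  { carrier := LinearMap.range e.lin
    lact := AlgHom.ofLinearMap
      { toFun := fun p => (N.lact p).restrict (p := LinearMap.range e.lin)
          (q := LinearMap.range e.lin) (by
            rintro _ ⟨m, rfl⟩
            exact ⟨N.lact p m, e.map_lact p m⟩)
        map_add' := fun p q => by ext; simp
        map_smul' := fun c p => by ext; simp }
      (by ext; simp) (fun p q => by ext; simp)
    ract := AlgHom.ofLinearMap
      { toFun := fun p => (N.ract p).restrict (p := LinearMap.range e.lin)
          (q := LinearMap.range e.lin) (by
            rintro _ ⟨m, rfl⟩
            exact ⟨N.ract p m, e.map_ract p m⟩)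
        map_add' := fun p q => by ext; simp
        map_smul' := fun c p => by ext; simp }
      (by ext; simp) (fun p q => by ext; simp)
    act_comm := fun p q m => Subtype.ext (N.act_comm p q m)
    gr := fun i => (N.gr i).comap (LinearMap.range e.lin).subtype
    internal := by
      obtain ⟨δ, hδ⟩ := exists_dec N.gr N.internal
      refine isInternal_of_dec _ (Finsupp.mapRange.linearMap e.lin.rangeRestrict ∘ₗ δ ∘ₗ
        (LinearMap.range e.lin).subtype) ?_ ?_
      · rintro i ⟨_, m, rfl⟩ hm
        simp only [LinearMap.comp_apply, Submodule.subtype_apply]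
        refine (congrArg (Finsupp.mapRange.linearMap e.lin.rangeRestrict) (hδ i _ hm)).trans ?_
        rw [Finsupp.mapRange.linearMap_apply, Finsupp.mapRange_single]
        congr 1
        exact Subtype.ext (hee m)
      · rw [eq_top_iff]
        rintro ⟨_, m, rfl⟩ -
        refine hom_induction (iSup_of_internal N.internal)
          (P := fun m => e.lin.rangeRestrict m ∈ _) ?_ ?_ ?_ m
        · rw [map_zero]; exact Submodule.zero_mem _
        · intro x y hx hy
          rw [map_add]; exact Submodule.add_mem _ hx hy
        · intro i x hx
          exact Submodule.mem_iSup_of_mem i (e.map_gr hx)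
    lact_mem := fun hp hm => N.lact_mem hp hm
    ract_mem := fun hp hm => N.ract_mem hp hm }

/-- The inclusion of the image of an idempotent. -/
def imageι (e : N ⟶ N) (he : e ≫ e = e) : imageIdem e he ⟶ N :=
  ⟨(LinearMap.range e.lin).subtype, fun _ _ => rfl, fun _ _ => rfl, fun h => h⟩

/-- The projection to the image of an idempotent. -/
def imageπ (e : N ⟶ N) (he : e ≫ e = e) : N ⟶ imageIdem e he :=
  ⟨e.lin.rangeRestrict, fun p m => Subtype.ext (e.map_lact p m),
    fun p m => Subtype.ext (e.map_ract p m), fun h => e.map_gr h⟩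

lemma imageπ_ι (e : N ⟶ N) (he : e ≫ e = e) : imageπ e he ≫ imageι e he = e := rfl

lemma imageι_π (e : N ⟶ N) (he : e ≫ e = e) : imageι e he ≫ imageπ e he = 𝟙 _ := by
  ext ⟨_, m, rfl⟩
  exact Subtype.ext (congrArg (fun f : N ⟶ N => f.lin m) he)

instance : Linear ℂ GrBimod where
  homModule M N :=
    { smul := fun c f => ⟨c • f.lin, fun p m => by simp [f.map_lact],
        fun p m => by simp [f.map_ract], fun h => Submodule.smul_mem _ c (f.map_gr h)⟩
      one_smul := fun f => hom_ext fun m => one_smul ℂ (f.lin m)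
      mul_smul := fun a b f => hom_ext fun m => mul_smul a b (f.lin m)
      smul_zero := fun a => hom_ext fun m => smul_zero a
      smul_add := fun a f g => hom_ext fun m => smul_add a (f.lin m) (g.lin m)
      add_smul := fun a b f => hom_ext fun m => add_smul a b (f.lin m)
      zero_smul := fun f => hom_ext fun m => zero_smul ℂ (f.lin m) }
  smul_comp _ _ _ r f g := hom_ext fun m => map_smul g.lin r (f.lin m)
  comp_smul _ _ _ f r g := rfl

/-- A retract of `P ⊕ X` with `P` a brick is a retract of `X`, or the sum of `P` and a retract of
`X`. -/
lemma retract_sum_brick {X : GrBimod} (hP : ∀ f : P ⟶ P, ∃ c : ℂ, f = c • 𝟙 P)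
    (r : Retract N (P.sum X)) :
    Nonempty (Retract N X) ∨
      ∃ N', Nonempty (Retract N' X) ∧ Nonempty (N ≅ P.sum N') := by
  let f : P ⟶ N := inl P X ≫ r.r
  let g : N ⟶ P := r.i ≫ fst P X
  -- The identity of `N` is the sum of its parts through `P` and through `X`.
  have hr : 𝟙 N - g ≫ f = r.i ≫ snd P X ≫ inr P X ≫ r.r := by
    have h := congrArg (fun e => r.i ≫ e ≫ r.r) (sum_total P X)
    simp only [Preadditive.add_comp, Preadditive.comp_add, Category.id_comp, r.retract,
      Category.assoc] at h
    rw [← h]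
    simp only [f, g, Category.assoc, add_sub_cancel_left]
  obtain ⟨c, hc⟩ := hP (f ≫ g)
  by_cases h0 : c = 0
  -- Here `g ≫ f` has square zero, so `𝟙 N - g ≫ f` is invertible with inverse `𝟙 N + g ≫ f`. It
  -- factors through `X`, which makes `N` a retract of `X`.
  · left
    have hfg : f ≫ g = 0 := by rw [hc, h0, zero_smul]
    refine ⟨⟨r.i ≫ snd P X, inr P X ≫ r.r ≫ (𝟙 N + g ≫ f), ?_⟩⟩
    have e : (𝟙 N - g ≫ f) ≫ (𝟙 N + g ≫ f) = 𝟙 N := by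
      simp only [Preadditive.sub_comp, Preadditive.comp_add, Category.id_comp, Category.comp_id,
        Category.assoc, reassoc_of% hfg, zero_comp, comp_zero]
      abel
    rw [hr] at e
    simpa only [Category.assoc] using e
  · right
    have hfc : f ≫ (c⁻¹ • g) = 𝟙 P := by
      rw [Linear.comp_smul, hc, smul_smul, inv_mul_cancel₀ h0, one_smul]
    set g' := c⁻¹ • g with hg'
    -- Now `f` is a split inclusion of `P`, and `e` projects onto a complement. As `g` vanishes on
    -- that complement, `hr` restricts there to a factorization of the identity through `X`.
    let e : N ⟶ N := 𝟙 N - g' ≫ f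
    have hee : e ≫ e = e := by
      simp only [e, Preadditive.sub_comp, Preadditive.comp_sub, Category.id_comp,
        Category.comp_id, Category.assoc, reassoc_of% hfc]
      abel
    have hfe : f ≫ e = 0 := by
      simp only [e, Preadditive.comp_sub, Category.comp_id, reassoc_of% hfc, sub_self]
    have heg : e ≫ g' = 0 := by
      simp only [e, Preadditive.sub_comp, Category.id_comp, Category.assoc, hfc,
        Category.comp_id, sub_self]
    have hιg' : imageι e hee ≫ g' = 0 := by
      rw [← Category.id_comp (imageι e hee), ← imageι_π e hee, Category.assoc, Category.assoc,
        reassoc_of% (imageπ_ι e hee), heg, comp_zero]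
    have hιg : imageι e hee ≫ g = 0 := by
      have h : g = c • g' := by rw [hg', smul_smul, mul_inv_cancel₀ h0, one_smul]
      rw [h, Linear.comp_smul, hιg', smul_zero]
    have hfπ : f ≫ imageπ e hee = 0 := by
      rw [← Category.comp_id (imageπ e hee), ← imageι_π e hee, reassoc_of% (imageπ_ι e hee),
        reassoc_of% hfe, zero_comp]
    refine ⟨imageIdem e hee, ⟨⟨imageι e hee ≫ r.i ≫ snd P X, inr P X ≫ r.r ≫ imageπ e hee, ?_⟩⟩,
      ⟨isoSum f (imageι e hee) g' (imageπ e hee) hfc hfπ hιg' (imageι_π e hee) ?_⟩⟩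
    · have h1 := congrArg (fun u => imageι e hee ≫ u ≫ imageπ e hee) hr
      simp only [Preadditive.sub_comp, Preadditive.comp_sub, Category.id_comp, Category.assoc,
        reassoc_of% hιg, zero_comp, sub_zero, imageι_π] at h1
      simp only [Category.assoc]
      exact h1.symm
    · rw [imageπ_ι]; simp [e]

lemma iso_zeroObj_of_id_eq_zero (h : 𝟙 M = 0) : Nonempty (M ≅ zeroObj) :=
  ⟨⟨0, 0, by rw [h, comp_zero], hom_ext fun _ => rfl⟩⟩

lemma id_zeroObj : 𝟙 zeroObj = 0 := hom_ext fun _ => rfl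

/-! ### Sums, shifts and tensor products -/

/-- Associativity of direct sums. -/
def sumAssoc (M N P : GrBimod) : (M.sum N).sum P ≅ M.sum (N.sum P) :=
  isoOf
    ⟨(LinearEquiv.prodAssoc ℂ M.carrier N.carrier P.carrier).toLinearMap, fun _ _ => rfl,
      fun _ _ => rfl, fun h => ⟨h.1.1, h.1.2, h.2⟩⟩
    ⟨(LinearEquiv.prodAssoc ℂ M.carrier N.carrier P.carrier).symm.toLinearMap, fun _ _ => rfl,
      fun _ _ => rfl, fun h => ⟨⟨h.1, h.2.1⟩, h.2.2⟩⟩ (fun _ => rfl) (fun _ => rfl)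

/-- The sum with a zero object. -/
lemma zero_sum (h : 𝟙 M = 0) : Nonempty (M.sum N ≅ N) :=
  ⟨⟨snd M N, inr M N, by
    rw [← sum_total M N, right_eq_add, ← Category.id_comp (inl M N), h, zero_comp, comp_zero],
    inr_snd M N⟩⟩

lemma sum_zero (h : 𝟙 N = 0) : Nonempty (M.sum N ≅ M) :=
  ⟨⟨fst M N, inl M N, by
    rw [← sum_total M N, left_eq_add, ← Category.id_comp (inr M N), h, zero_comp, comp_zero],
    inl_fst M N⟩⟩

/-- Functoriality of the shift. -/
def shiftMap (n : ℤ) (f : M ⟶ N) : M.shift n ⟶ N.shift n :=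
  ⟨f.lin, f.map_lact, f.map_ract, fun h => f.map_gr h⟩

/-- Isomorphic bimodules have isomorphic shifts. -/
def shiftIso (n : ℤ) (e : M ≅ N) : M.shift n ≅ N.shift n where
  hom := shiftMap n e.hom
  inv := shiftMap n e.inv
  hom_inv_id := congrArg (shiftMap n) e.hom_inv_id
  inv_hom_id := congrArg (shiftMap n) e.inv_hom_id

/-- The shift of a direct sum. -/
def shiftSum (n : ℤ) (M N : GrBimod) : (M.sum N).shift n ≅ (M.shift n).sum (N.shift n) :=
  isoSum (shiftMap n (inl M N)) (shiftMap n (inr M N)) (shiftMap n (fst M N))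
    (shiftMap n (snd M N)) rfl rfl rfl rfl (congrArg (shiftMap n) (sum_total M N))

/-- `M[n] ⊗ N ≅ (M ⊗ N)[n]`. -/
def shiftTens (n : ℤ) (M N : GrBimod) : (M.shift n).tens N ≅ (M.tens N).shift n :=
  tensIso (unitTens n M).symm (Iso.refl N) ≪≫ assoc _ M N ≪≫ unitTens n (M.tens N)

/-- `M ⊗ N[n] ≅ (M ⊗ N)[n]`. -/
def tensShift (n : ℤ) (M N : GrBimod) : M.tens (N.shift n) ≅ (M.tens N).shift n :=
  tensIso (Iso.refl M) (tensUnit n N).symm ≪≫ (assoc M N _).symm ≪≫ tensUnit n (M.tens N)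

/-- The tensor product of a bimodule with a retract. -/
def tensRetract (M : GrBimod) (r : Retract N P) : Retract (M.tens N) (M.tens P) where
  i := tensMap (𝟙 M) r.i
  r := tensMap (𝟙 M) r.r
  retract := by rw [tensMap_comp, r.retract, Category.comp_id, tensMap_id]

end GrBimod

open GrBimod

/-! ### Decomposable bimodules -/

section Dec

variable (s : ℂ ≃ₗ[ℂ] ℂ)

/-- Finite direct sums of shifts of rings of regular functions of segments. -/
inductive Dec : GrBimod → Prop
  | zero {M : GrBimod} (h : 𝟙 M = 0) : Dec M
  | cons {M N : GrBimod} (i n : ℕ) (m : ℤ) (hn : 0 < n) (hnd : n ≤ orderOf s)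
      (e : M ≅ ((O (seg s i n)).shift m).sum N) (hN : Dec N) : Dec M

variable {s} {M N : GrBimod}

lemma Dec.iso (h : Dec s M) (e : N ≅ M) : Dec s N := by
  induction h generalizing N with
  | zero h =>
    refine .zero ?_
    rw [← e.hom_inv_id, ← Category.id_comp e.inv, h, zero_comp, comp_zero]
  | cons i n m hn hnd e' hN _ => exact .cons i n m hn hnd (e ≪≫ e') hN

lemma Dec.sum (hM : Dec s M) (hN : Dec s N) : Dec s (M.sum N) := by
  induction hM with
  | zero h =>
    obtain ⟨e⟩ := zero_sum (N := N) h
    exact hN.iso e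
  | cons i n m hn hnd e' _ ih =>
    exact .cons i n m hn hnd (sumIso e' (Iso.refl N) ≪≫ sumAssoc _ _ N) ih

lemma Dec.shift (hM : Dec s M) (k : ℤ) : Dec s (M.shift k) := by
  induction hM with
  | zero h => exact .zero (congrArg (shiftMap k) h)
  | cons i n m hn hnd e' _ ih =>
    exact .cons i n (k + m) hn hnd
      (shiftIso k e' ≪≫ shiftSum k _ _ ≪≫ sumIso (shiftShift m k _) (Iso.refl _)) ih

lemma smul_id_of_scalar {f : M ⟶ M} {c : ℂ} (h : ∀ m, f.lin m = c • m) : f = c • 𝟙 M :=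
  hom_ext h

lemma Dec.retract (hM : Dec s M) (r : Retract N M) : Dec s N := by
  induction hM generalizing N with
  | zero h =>
    refine .zero ?_
    rw [← r.retract, ← Category.id_comp r.r, h, zero_comp, comp_zero]
  | cons i n m hn hnd e' _ ih =>
    have hP : ∀ f : (O (seg s i n)).shift m ⟶ (O (seg s i n)).shift m, ∃ c : ℂ, f = c • 𝟙 _ :=
      fun f => (O.end_scalar f).imp fun c hc => smul_id_of_scalar hc
    rcases retract_sum_brick hP (r.trans (Retract.ofIso e')) with ⟨⟨r'⟩⟩ | ⟨N', ⟨r'⟩, ⟨e⟩⟩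
    · exact ih r'
    · exact .cons i n m hn hnd e (ih r')

/-- The empty segment is allowed because it occurs when a single line is tensored with the
generator; its ring of functions is zero. -/
lemma Dec.seg {i n : ℕ} (hnd : n ≤ orderOf s) (m : ℤ) : Dec s ((O (seg s i n)).shift m) := by
  have h0 : 𝟙 zeroObj = 0 := id_zeroObj
  rcases Nat.eq_zero_or_pos n with rfl | hn
  · refine .zero (O.hom_ext ?_)
    exact O.mk_eq_zero.2 (mem_graphIdeal_seg.2 (by simp))
  · obtain ⟨e⟩ := sum_zero (M := (O (CyclicSoergel.seg s i n)).shift m) h0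
    exact .cons i n m hn hnd e.symm (.zero h0)

lemma Dec.tens_gen (hd : 1 < orderOf s) (hM : Dec s M) : Dec s (M.tens (O {1, s})) := by
  induction hM with
  | zero h =>
    refine .zero ?_
    rw [← tensMap_id, h, zero_tensMap]
  | cons i n m hn hnd e' _ ih =>
    have key : Dec s ((O (CyclicSoergel.seg s i n)).tens (O {1, s})) := by
      rcases hnd.lt_or_eq with h | h
      · obtain ⟨k, rfl⟩ : ∃ k, n = k + 1 := ⟨n - 1, by omega⟩
        obtain ⟨e⟩ := tens_gen_split rfl h (i := i)
        exact ((Dec.seg (by omega) 0).sum (Dec.seg (by omega) (-2))).iso e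
      · subst h
        obtain ⟨e⟩ := tens_gen_split_full rfl hd (i := i)
        exact ((Dec.seg le_rfl 0).sum (Dec.seg le_rfl (-2))).iso e
    refine (((key.shift m).iso (shiftTens m _ _)).sum ih).iso
      (tensIso e' (Iso.refl _) ≪≫ sumTens _ _ _)

/-- Showing that right multiplication by `N` preserves sums of segments, for all `M` at once, avoids
decomposing products of two arbitrary segments: a tensor product is handled by associativity, and
only the generator itself requires computation. -/
lemma Dec.tens (hd : 1 < orderOf s) (hM : Dec s M) (hN : InB s N) : Dec s (M.tens N) := by
  induction hN generalizing M with
  | unit =>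
    exact hM.iso (tensIso (Iso.refl M) (shiftZero GrBimod.unit).symm ≪≫ tensUnit 0 M ≪≫
      shiftZero M)
  | gen => exact hM.tens_gen hd
  | tens _ _ ih1 ih2 => exact (ih2 (ih1 hM)).iso (assoc M _ _).symm
  | zero =>
    refine .zero ?_
    rw [← tensMap_id, id_zeroObj, tensMap_zero]
  | sum _ _ ih1 ih2 => exact ((ih1 hM).sum (ih2 hM)).iso (tensSum M _ _)
  | shift n _ ih => exact ((ih hM).shift n).iso (tensShift n M _)
  | retract _ r ih => exact (ih hM).retract (tensRetract M r)

/-- The unit is the ring of regular functions of the diagonal. -/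
lemma unit_iso : Nonempty (GrBimod.unit ≅ (O (seg s 0 1)).shift 0) := by
  have hact : ∀ p (q : R), GrBimod.unit.act p q = (restr 1 p * q : R) := by
    intro p
    have : GrBimod.unit.act = (Algebra.lmul ℂ R).comp (restr 1) := by
      apply MvPolynomial.algHom_ext
      intro i
      refine LinearMap.ext fun (m : R) => ?_
      fin_cases i
      · refine (act_X0 (M := GrBimod.unit) m).trans ?_
        change (Polynomial.X * m : R) = restr 1 (MvPolynomial.X 0) * m
        simp [restr]
      · refine (act_X1 (M := GrBimod.unit) m).trans ?_
        change (Polynomial.X * m : R) = restr 1 (MvPolynomial.X 1) * m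
        simp [restr]
    intro q
    rw [this]; rfl
  have hmem : ∀ p, p ∈ graphIdeal (seg s 0 1) ↔ restr 1 p = 0 := fun p => by
    rw [mem_graphIdeal_seg]; simp
  let f : (O (seg s 0 1)).shift 0 ⟶ GrBimod.unit :=
    O.desc (M := GrBimod.unit) (seg s 0 1) 0 (1 : R) one_mem_Rgr (fun p hp => by
      rw [hact, (hmem p).1 hp]; exact zero_mul (M₀ := R) 1)
  have hf : ∀ p, f.lin ((O (seg s 0 1)).act p (O.one _)) = restr 1 p := fun p =>
    (O.desc_act_one _ _ _ _ p).trans ((hact p 1).trans (mul_one (M := R) _))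
  refine ⟨(isoOfBijective f ⟨?_, ?_⟩).symm⟩
  · rw [injective_iff_map_eq_zero]
    intro a h
    obtain ⟨p, rfl⟩ := O.exists_act (A := seg s 0 1) a
    exact O.act_one_eq_zero.2 ((hmem p).2 ((hf p).symm.trans h))
  · intro (q : R)
    refine ⟨_, (hf (Polynomial.aeval (MvPolynomial.X 1) q)).trans ?_⟩
    rw [← Polynomial.aeval_algHom_apply]
    simp [restr]
    rfl

/-! ### The objects of the category are the sums of shifted segments -/

lemma InB.iso (h : InB s M) (e : N ≅ M) : InB s N := h.retract (Retract.ofIso e)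

lemma InB.of_sum_left (h : InB s (M.sum N)) : InB s M :=
  h.retract ⟨inl M N, fst M N, inl_fst M N⟩

lemma InB.of_sum_right (h : InB s (M.sum N)) : InB s N :=
  h.retract ⟨inr M N, snd M N, inr_snd M N⟩

lemma InB.of_shift {n : ℤ} (h : InB s (M.shift n)) : InB s M :=
  (h.shift (-n)).iso ((shiftZero M).symm ≪≫ eqToIso (by rw [neg_add_cancel]) ≪≫
    (shiftShift n (-n) M).symm)

lemma InB.dec (hd : 1 < orderOf s) (h : InB s M) : Dec s M := by
  obtain ⟨e⟩ := unit_iso (s := s)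
  have hu : Dec s GrBimod.unit := (Dec.seg hd.le 0).iso e
  exact (hu.tens hd h).iso (tensIso (shiftZero GrBimod.unit).symm (Iso.refl M) ≪≫
    unitTens 0 M ≪≫ shiftZero M).symm

/-- Each splitting lengthens a segment at its end and also shortens it at its start. Starting from
the diagonal, a point grows to length 2, whose splitting contains the next point; this step needs `2
< d`. Every other segment then grows from its starting point. -/
lemma inB_seg (hd : 2 < orderOf s) {i n : ℕ} (hn : 0 < n) (hnd : n ≤ orderOf s) :
    InB s (O (seg s i n)) := by
  have grow : ∀ i n, n + 1 < orderOf s → InB s (O (seg s i (n + 1))) →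
      InB s (O (seg s i (n + 2))) ∧ InB s (O (seg s (i + 1) n)) := by
    intro i n h hB
    obtain ⟨e⟩ := tens_gen_split rfl h (i := i)
    have := (hB.tens .gen).iso e.symm
    exact ⟨this.of_sum_left.of_shift, this.of_sum_right.of_shift⟩
  have one : InB s (O (seg s i 1)) := by
    induction i with
    | zero =>
      obtain ⟨e⟩ := unit_iso (s := s)
      exact (InB.unit.iso e.symm).of_shift
    | succ i ih => exact (grow i 1 hd (grow i 0 (by omega) ih).1).2
  induction n with
  | zero => omega
  | succ n ih =>
    rcases Nat.eq_zero_or_pos n with rfl | hn0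
    · exact one
    · obtain ⟨k, rfl⟩ : ∃ k, n = k + 1 := ⟨n - 1, by omega⟩
      exact (grow i k (by omega) (ih hn0 (by omega))).1

lemma Dec.inB (hd : 2 < orderOf s) (h : Dec s M) : InB s M := by
  induction h with
  | zero h =>
    obtain ⟨e⟩ := iso_zeroObj_of_id_eq_zero h
    exact InB.zero.iso e
  | cons i n m hn hnd e _ ih => exact (((inB_seg hd hn hnd).shift m).sum ih).iso e

end Dec

/-! ### Indecomposable objects -/

section Indec

variable {s : ℂ ≃ₗ[ℂ] ℂ} {A : Set (ℂ ≃ₗ[ℂ] ℂ)}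

lemma O.id_ne_zero (hA : A.Nonempty) (n : ℤ) : 𝟙 ((O A).shift n) ≠ 0 := fun h =>
  O.one_ne_zero hA (congrArg
    (fun f : (O A).shift n ⟶ (O A).shift n => (f.lin (O.one A) : (O A).carrier)) h)

lemma O.idem (hA : A.Nonempty) {n : ℤ} {f : (O A).shift n ⟶ (O A).shift n} (hf : f ≫ f = f) :
    f = 0 ∨ f = 𝟙 _ := by
  obtain ⟨c, hc⟩ := O.end_scalar f
  have h1 : f = c • 𝟙 _ := smul_id_of_scalar hc
  have h2 : (c * c) • O.one A = c • O.one A := by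
    have h : f.lin (f.lin (O.one A)) = f.lin (O.one A) := congrArg
      (fun f : (O A).shift n ⟶ (O A).shift n => f.lin (O.one A)) hf
    have h' : f.lin (c • O.one A) = c • O.one A :=
      (congrArg f.lin (hc (O.one A))).symm.trans (h.trans (hc _))
    rw [mul_smul]
    exact (hc (c • O.one A)).symm.trans h'
  have h3 : (c * c - c) • O.one A = 0 := by rw [sub_smul, h2, sub_self]
  have h4 := (smul_eq_zero.1 h3).resolve_right (O.one_ne_zero hA)
  have h5 : c * (c - 1) = 0 := by linear_combination h4
  rcases mul_eq_zero.1 h5 with h | h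
  · left; rw [h1, h, zero_smul]
  · right; rw [h1, sub_eq_zero.1 h, one_smul]

lemma isZero_iff {X : B s} : IsZero X ↔ 𝟙 X.obj = 0 := by
  rw [IsZero.iff_id_eq_zero]
  exact ⟨fun h => congrArg (fun f : X ⟶ X => f.hom) h, fun h => ObjectProperty.hom_ext _ h⟩

/-- The direct sum is the biproduct. -/
lemma bSum_iso (X Y : B s) : Nonempty (bSum X Y ≅ X ⊞ Y) := by
  let b : BinaryBicone X Y :=
    { pt := bSum X Y
      fst := ObjectProperty.homMk (GrBimod.fst X.obj Y.obj)
      snd := ObjectProperty.homMk (GrBimod.snd X.obj Y.obj)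
      inl := ObjectProperty.homMk (GrBimod.inl X.obj Y.obj)
      inr := ObjectProperty.homMk (GrBimod.inr X.obj Y.obj)
      inl_fst := rfl
      inl_snd := rfl
      inr_fst := rfl
      inr_snd := rfl }
  have hb : b.IsBilimit :=
    isBinaryBilimitOfTotal b (ObjectProperty.hom_ext _ (GrBimod.sum_total X.obj Y.obj))
  exact ⟨biprod.uniqueUpToIso _ _ hb⟩

/-- A decomposition defines the idempotent projecting onto its first summand. If it is `0` the first
summand vanishes, if it is the identity the second one does. -/
lemma indecomposable_of_idem {C : Type*} [Category C] [Preadditive C] [HasBinaryBiproducts C]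
    {X : C} (h0 : ¬ IsZero X) (h : ∀ f : X ⟶ X, f ≫ f = f → f = 0 ∨ f = 𝟙 X) :
    Indecomposable X := by
  refine ⟨h0, fun Y Z a => ?_⟩
  rcases h (a.hom ≫ biprod.fst ≫ biprod.inl ≫ a.inv) (by simp) with h1 | h1
  · left
    rw [IsZero.iff_id_eq_zero]
    have := congrArg (fun f => biprod.inl ≫ a.inv ≫ f ≫ a.hom ≫ biprod.fst) h1
    simpa using this
  · right
    rw [IsZero.iff_id_eq_zero]
    have := congrArg (fun f => biprod.inr ≫ a.inv ≫ f ≫ a.hom ≫ biprod.snd) h1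
    simpa using this.symm

lemma indecomposable_O (hA : A.Nonempty) {n : ℤ} {X : B s} (e : X.obj ≅ (O A).shift n) :
    Indecomposable X := by
  refine indecomposable_of_idem (fun h => O.id_ne_zero hA n ?_) fun f hf => ?_
  · rw [← e.inv_hom_id, ← Category.id_comp e.hom, isZero_iff.1 h, zero_comp, comp_zero]
  · have hf' : f.hom ≫ f.hom = f.hom := congrArg (fun f : X ⟶ X => f.hom) hf
    have hf'' : f.hom = e.hom ≫ (e.inv ≫ f.hom ≫ e.hom) ≫ e.inv := by simp
    rcases O.idem hA (f := e.inv ≫ f.hom ≫ e.hom) (by simp [reassoc_of% hf']) with h | h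
    · left
      refine ObjectProperty.hom_ext _ ?_
      rw [hf'', h, zero_comp, comp_zero]; rfl
    · right
      refine ObjectProperty.hom_ext _ ?_
      rw [hf'', h, Category.id_comp, e.hom_inv_id]; rfl

lemma exists_seg_of_indecomposable (hd : 2 < orderOf s) {X : B s} (h : Indecomposable X) :
    ∃ (i n : ℕ) (m : ℤ), 0 < n ∧ n ≤ orderOf s ∧
      Nonempty (X.obj ≅ (O (seg s i n)).shift m) := by
  cases X.property.dec (by omega : 1 < orderOf s) with
  | zero h0 => exact absurd (isZero_iff.2 h0) h.1
  | @cons _ N i n m hn hnd e hN =>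
    let Y : B s := bShift m ⟨O (seg s i n), inB_seg hd hn hnd⟩
    let Z : B s := ⟨N, hN.inB hd⟩
    obtain ⟨b⟩ := bSum_iso Y Z
    have hX : X ≅ bSum Y Z := ObjectProperty.isoMk _ e
    rcases h.2 Y Z (hX ≪≫ b) with h1 | h1
    · exact absurd (isZero_iff.1 h1) (O.id_ne_zero (seg_nonempty hn) m)
    · obtain ⟨e'⟩ := sum_zero (M := (O (seg s i n)).shift m) (isZero_iff.1 h1)
      exact ⟨i, n, m, hn, hnd, ⟨e ≪≫ e'⟩⟩

/-! ### Isomorphisms between the rings of regular functions -/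

lemma lin_injective_of_iso {M N : GrBimod} (e : M ≅ N) : Function.Injective e.hom.lin := by
  refine Function.LeftInverse.injective (g := e.inv.lin) fun m => ?_
  rw [← comp_lin, e.hom_inv_id, id_lin]

lemma lin_surjective_of_iso {M N : GrBimod} (e : M ≅ N) : Function.Surjective e.hom.lin := by
  refine Function.RightInverse.surjective (g := e.inv.lin) fun m => ?_
  rw [← comp_lin, e.inv_hom_id, id_lin]

/-- The generator lies in degree `-n` and has nonzero image, whereas the target is zero below degree
`-n'`. -/
lemma shift_le_of_iso {A A' : Set (ℂ ≃ₗ[ℂ] ℂ)} (hA : A.Nonempty) {n n' : ℤ}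
    (e : (O A).shift n ≅ (O A').shift n') : n ≤ n' := by
  by_contra h
  have h1 : e.hom.lin (O.one A) ∈ (O A').gr (-n + n') := e.hom.map_gr (O.one_mem_shift n)
  have h2 := O.gr_neg (by omega) h1
  exact O.one_ne_zero hA (lin_injective_of_iso e (h2.trans (map_zero e.hom.lin).symm))

/-- The ideal is the annihilator of the bimodule, and annihilators pass to images under surjective
morphisms. -/
lemma graphIdeal_le_of_iso {A A' : Set (ℂ ≃ₗ[ℂ] ℂ)} {n n' : ℤ}
    (e : (O A).shift n ≅ (O A').shift n') : graphIdeal A ≤ graphIdeal A' := by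
  intro p hp
  rw [← O.act_one_eq_zero]
  obtain ⟨m, hm⟩ := lin_surjective_of_iso e (O.one A')
  obtain ⟨q, rfl⟩ := O.exists_act (A := A) m
  have h1 := lin_act e.hom p ((O A).act q (O.one A))
  rw [hm, shift_act, shift_act] at h1
  rw [← h1, ← act_mul, mul_comm, act_mul, O.act_one_eq_zero.2 hp, map_zero]
  exact map_zero e.hom.lin

end Indec

/-! ### Dimensions of spaces of morphisms -/

section HomDim

variable {s : ℂ ≃ₗ[ℂ] ℂ} {M N : GrBimod}

/-- The elements of degree `k` annihilated by the ideal of the union of the graphs, that is the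
space of morphisms from `𝒪(A)[-k]`. -/
def homSub (A : Set (ℂ ≃ₗ[ℂ] ℂ)) (k : ℤ) (M : GrBimod) : Submodule ℂ M.carrier :=
  M.gr k ⊓ ⨅ p ∈ graphIdeal A, LinearMap.ker (M.act p)

variable (A : Set (ℂ ≃ₗ[ℂ] ℂ)) (k : ℤ)

lemma mem_homSub {A : Set (ℂ ≃ₗ[ℂ] ℂ)} {k : ℤ} {m : M.carrier} :
    m ∈ homSub A k M ↔ m ∈ M.gr k ∧ ∀ p ∈ graphIdeal A, M.act p m = 0 := by
  simp [homSub]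

/-- The linear equivalence underlying an isomorphism. -/
def linEquivOfIso (e : M ≅ N) : M.carrier ≃ₗ[ℂ] N.carrier :=
  LinearEquiv.ofBijective e.hom.lin ⟨lin_injective_of_iso e, lin_surjective_of_iso e⟩

lemma homSub_iso (e : M ≅ N) :
    (homSub A k M).map (linEquivOfIso e).toLinearMap = homSub A k N := by
  have key : ∀ {M N : GrBimod} (f : M ⟶ N) {m}, m ∈ homSub A k M → f.lin m ∈ homSub A k N := by
    intro M N f m hm
    rw [mem_homSub] at hm ⊢
    exact ⟨f.map_gr hm.1, fun p hp => by rw [← lin_act, hm.2 p hp, map_zero]⟩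
  refine le_antisymm ?_ fun n hn => ⟨e.inv.lin n, key e.inv hn, ?_⟩
  · rintro _ ⟨m, hm, rfl⟩
    exact key e.hom hm
  · change e.hom.lin (e.inv.lin n) = n
    rw [← comp_lin, e.inv_hom_id, id_lin]

/-- The dimension of the space of morphisms from `𝒪(A)[-k]`. -/
def homDim (M : GrBimod) : ℕ := Module.finrank ℂ (homSub A k M)

lemma homDim_iso (e : M ≅ N) : homDim A k M = homDim A k N := by
  rw [homDim, homDim, ← homSub_iso A k e, LinearEquiv.finrank_map_eq]

/-- The space of morphisms to a direct sum. -/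
def homSubSum (M N : GrBimod) :
    homSub A k (M.sum N) ≃ₗ[ℂ] (homSub A k M × homSub A k N) where
  toFun z := (⟨z.1.1, mem_homSub.2 ⟨(mem_homSub.1 z.2).1.1, fun p hp =>
      congrArg Prod.fst ((sum_act p z.1.1 z.1.2).symm.trans ((mem_homSub.1 z.2).2 p hp))⟩⟩,
    ⟨z.1.2, mem_homSub.2 ⟨(mem_homSub.1 z.2).1.2, fun p hp =>
      congrArg Prod.snd ((sum_act p z.1.1 z.1.2).symm.trans ((mem_homSub.1 z.2).2 p hp))⟩⟩)
  map_add' _ _ := rfl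
  map_smul' _ _ := rfl
  invFun z := ⟨(z.1.1, z.2.1), mem_homSub.2 ⟨⟨(mem_homSub.1 z.1.2).1, (mem_homSub.1 z.2.2).1⟩,
    fun p hp => (sum_act p z.1.1 z.2.1).trans
      (Prod.ext ((mem_homSub.1 z.1.2).2 p hp) ((mem_homSub.1 z.2.2).2 p hp))⟩⟩
  left_inv _ := rfl
  right_inv _ := rfl

lemma homDim_sum [Module.Finite ℂ (homSub A k M)] [Module.Finite ℂ (homSub A k N)] :
    homDim A k (M.sum N) = homDim A k M + homDim A k N := by
  rw [homDim, (homSubSum A k M N).finrank_eq, Module.finrank_prod]; rfl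

lemma finite_homSub_O (B : Set (ℂ ≃ₗ[ℂ] ℂ)) : Module.Finite ℂ (homSub A k (O B)) :=
  Submodule.finiteDimensional_of_le (S₂ := (O B).gr k) inf_le_left

lemma Dec.finite_homSub (h : Dec s M) : Module.Finite ℂ (homSub A k M) := by
  induction h with
  | @zero M h =>
    have : Subsingleton M.carrier := by
      refine subsingleton_of_forall_eq 0 fun m => ?_
      exact congrArg (fun f : M ⟶ M => f.lin m) h
    infer_instance
  | @cons M N i n m hn hnd e _ ih =>
    have h1 : Module.Finite ℂ (homSub A k ((O (CyclicSoergel.seg s i n)).shift m)) :=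
      -- Degree `k` of the shift by `m` is degree `k + m` of the bimodule itself.
      finite_homSub_O A (k + m) _
    have h2 : Module.Finite ℂ (homSub A k (((O (CyclicSoergel.seg s i n)).shift m).sum N)) :=
      Module.Finite.equiv (homSubSum A k _ _).symm
    rw [← homSub_iso A k e.symm]
    exact Module.Finite.map _ _

lemma homDim_O_of_neg (B : Set (ℂ ≃ₗ[ℂ] ℂ)) (hk : k < 0) : homDim A k (O B) = 0 := by
  have : homSub A k (O B) = ⊥ := by
    rw [eq_bot_iff]
    intro m hm
    exact O.gr_neg hk (mem_homSub.1 hm).1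
  rw [homDim, this, finrank_bot]

lemma homDim_O_self {A : Set (ℂ ≃ₗ[ℂ] ℂ)} (hA : A.Nonempty) : homDim A 0 (O A) ≠ 0 := by
  have := finite_homSub_O A 0 A
  intro h
  rw [homDim, Submodule.finrank_eq_zero] at h
  have h1 : O.one A ∈ homSub A 0 (O A) :=
    mem_homSub.2 ⟨O.one_mem, fun p hp => O.act_one_eq_zero.2 hp⟩
  rw [h] at h1
  exact O.one_ne_zero hA h1

/-- A morphism of degree 0 sends `1` to a scalar. If the scalar is nonzero, the ideal of the source
must annihilate `1` in the target. -/
lemma subset_of_homDim_ne_zero {i n : ℕ} {B : Set (ℂ ≃ₗ[ℂ] ℂ)}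
    (h : homDim (seg s i n) 0 (O B) ≠ 0) : B ⊆ seg s i n := by
  refine subset_of_graphIdeal_le fun p hp => ?_
  by_contra hpB
  apply h
  have : homSub (seg s i n) 0 (O B) = ⊥ := by
    rw [eq_bot_iff]
    intro m hm
    rw [mem_homSub] at hm
    obtain ⟨c, rfl⟩ := O.gr_zero hm.1
    have h1 := hm.2 p hp
    rw [map_smul, smul_eq_zero] at h1
    rw [h1.resolve_right (fun h2 => hpB (O.act_one_eq_zero.1 h2)), zero_smul]
    exact Submodule.zero_mem _
  rw [homDim, this, finrank_bot]

/-- The dimension of a space of morphisms as a function on isomorphism classes. -/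
def homDimCl (a : IsoCl s) : ℤ :=
  Quotient.lift (fun X : B s => (homDim A k X.obj : ℤ))
    (fun _ _ (h : Nonempty _) => h.elim fun e =>
      congrArg Nat.cast (homDim_iso A k ((ObjectProperty.ι _).mapIso e))) a

/-- The dimension of a space of morphisms as a function on the split Grothendieck ring. -/
def homDimAW (hd : 1 < orderOf s) : AW s →+ ℤ :=
  AddMonoidHom.liftOfSurjective (toAW (s := s)).toAddMonoidHom toAW_surjective
    ⟨FreeAbelianGroup.lift (homDimCl A k), fun x hx => by
      have hx' : x ∈ splitRel s := (toAW_eq_zero_iff x).1 hx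
      refine (AddSubgroup.closure_le (K := (FreeAbelianGroup.lift (homDimCl A k)).ker)).2 ?_ hx'
      rintro _ ⟨X, Y, rfl⟩
      have := (X.property.dec hd).finite_homSub A k
      have := (Y.property.dec hd).finite_homSub A k
      change FreeAbelianGroup.lift (homDimCl A k) _ = 0
      rw [map_sub, map_add, FreeAbelianGroup.lift_apply_of, FreeAbelianGroup.lift_apply_of,
        FreeAbelianGroup.lift_apply_of, sub_eq_zero]
      exact (congrArg Nat.cast (homDim_sum A k)).trans (Nat.cast_add _ _)⟩

lemma homDimAW_aw (hd : 1 < orderOf s) (X : B s) : homDimAW A k hd (aw X) = homDim A k X.obj := by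
  refine (AddMonoidHom.liftOfRightInverse_comp_apply _ _ _ _ _).trans ?_
  exact FreeAbelianGroup.lift_apply_of _ _

end HomDim

/-! ### The split Grothendieck ring -/

section Grothendieck

variable {s : ℂ ≃ₗ[ℂ] ℂ}

/-- The dimension functions are additive but not linear over Laurent polynomials, so a multiple of a
class has to be spread out over its shifts. -/
lemma map_laurent_smul (φ : AW s →+ ℤ) (c : ℤ[T;T⁻¹]) (X : B s) :
    φ (c • aw X) = c.coeff.sum fun m r => r * φ (aw (bShift m X)) := by
  induction c using LaurentPolynomial.induction_on' with
  | add p q hp hq =>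
    rw [add_smul, map_add, hp, hq, AddMonoidAlgebra.coeff_add, Finsupp.sum_add_index']
    · simp
    · intros; ring
  | C_mul_T n a =>
    have h1 : (LaurentPolynomial.C a * LaurentPolynomial.T n : ℤ[T;T⁻¹]) =
        a • LaurentPolynomial.T n := (LaurentPolynomial.smul_eq_C_mul a _).symm
    rw [h1, smul_assoc, T_smul_aw, map_zsmul, ← h1, ← LaurentPolynomial.single_eq_C_mul_T,
      AddMonoidAlgebra.coeff_single, Finsupp.sum_single_index (by simp), smul_eq_mul]

lemma aw_iso {X Y : B s} (e : X.obj ≅ Y.obj) : aw X = aw Y := by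
  rw [aw, aw, cl_eq e]

lemma aw_sum (X Y : B s) : aw (bSum X Y) = aw X + aw Y := by
  rw [← sub_eq_zero, aw, aw, aw, ← map_add, ← map_sub, toAW_eq_zero_iff]
  exact AddSubgroup.subset_closure ⟨X, Y, rfl⟩

/-- For a zero object `X ⊕ X ≅ X`, so its class equals twice itself. -/
lemma aw_zero {X : B s} (h : 𝟙 X.obj = 0) : aw X = 0 := by
  obtain ⟨e⟩ := zero_sum (N := X.obj) h
  have h1 := aw_iso (X := bSum X X) (Y := X) e
  rwa [aw_sum, add_eq_left] at h1

variable (s) in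
/-- The labels of the indecomposable objects up to shift. -/
abbrev Lab : Type := (Fin (orderOf s) × Fin (orderOf s - 1)) ⊕ Unit

/-- The starting point of a segment. -/
def Lab.start : Lab s → ℕ := Sum.elim (fun x => x.1) (fun _ => 0)

/-- The length of a segment. -/
def Lab.len : Lab s → ℕ := Sum.elim (fun x => x.2 + 1) (fun _ => orderOf s)

/-- The segment of a label. -/
def Lab.seg (a : Lab s) : Set (ℂ ≃ₗ[ℂ] ℂ) := CyclicSoergel.seg s a.start a.len

lemma Lab.len_le (a : Lab s) : a.len ≤ orderOf s := by
  rcases a with ⟨i, k⟩ | _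
  · have := k.2
    simp only [Lab.len, Sum.elim_inl]
    omega
  · exact le_rfl

lemma Lab.len_pos (hd : 0 < orderOf s) (a : Lab s) : 0 < a.len := by
  rcases a with ⟨i, k⟩ | _
  · exact Nat.succ_pos _
  · exact hd

/-- Proper segments are separated by start and length. The full group, which has the same elements
for every start, carries a single label and differs from a proper segment by the element just past
the end of the latter. -/
lemma Lab.seg_injective (hd : 1 < orderOf s) : Function.Injective (Lab.seg (s := s)) := by
  have hfull : ∀ i n, n < orderOf s →
      CyclicSoergel.seg s i n ≠ CyclicSoergel.seg s 0 (orderOf s) := by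
    intro i n hn h
    have h1 : s ^ (i + n) ∈ CyclicSoergel.seg s i n := by
      rw [h, ← seg_full rfl (by omega) i]
      exact ⟨n, hn, rfl⟩
    rw [pow_mem_seg rfl hn.le hn] at h1
    omega
  rintro (⟨i, k⟩ | _) (⟨i', k'⟩ | _) h
  · have hk := k.2
    have hk' := k'.2
    have hn : (k : ℕ) + 1 < orderOf s := by omega
    have hn' : (k' : ℕ) + 1 < orderOf s := by omega
    obtain ⟨h1, h2⟩ := CyclicSoergel.seg_injective (s := s) rfl i.2 i'.2
      (Nat.succ_pos k) hn hn' h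
    rw [Fin.ext h1, Fin.ext (Nat.succ_injective h2)]
  · have hk := k.2
    exact absurd h (hfull i (k + 1) (by omega))
  · have hk' := k'.2
    exact absurd h.symm (hfull i' (k' + 1) (by omega))
  · rfl

lemma exists_lab (hd : 0 < orderOf s) {i n : ℕ} (hn : 0 < n) (hnd : n ≤ orderOf s) :
    ∃ a : Lab s, a.seg = seg s i n := by
  rcases hnd.lt_or_eq with h | rfl
  · refine ⟨.inl (⟨i % orderOf s, Nat.mod_lt _ hd⟩, ⟨n - 1, by omega⟩), ?_⟩
    change seg s (i % orderOf s) (n - 1 + 1) = _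
    rw [Nat.sub_add_cancel hn, seg_mod rfl]
  · exact ⟨.inr (), (seg_full rfl hd i).symm⟩

/-- The object with a given label. -/
def Lab.obj (hd : 2 < orderOf s) (a : Lab s) : B s :=
  ⟨O a.seg, inB_seg hd (a.len_pos (by omega)) a.len_le⟩

lemma span_lab (hd : 2 < orderOf s) :
    ⊤ ≤ Submodule.span ℤ[T;T⁻¹] (Set.range fun a : Lab s => aw (a.obj hd)) := by
  have key : ∀ {M : GrBimod}, Dec s M → ∀ h : InB s M,
      aw (⟨M, h⟩ : B s) ∈ Submodule.span ℤ[T;T⁻¹] (Set.range fun a : Lab s => aw (a.obj hd)) := by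
    intro M hM
    induction hM with
    | zero h0 =>
      intro h
      rw [aw_zero (X := ⟨_, h⟩) h0]
      exact Submodule.zero_mem _
    | @cons M N i n m hn hnd e hN ih =>
      intro h
      obtain ⟨a, ha⟩ := exists_lab (by omega) (i := i) hn hnd
      have e' : M ≅ ((O a.seg).shift m).sum N := ha ▸ e
      have h1 : aw (⟨M, h⟩ : B s) = aw (bSum (bShift m (a.obj hd)) ⟨N, hN.inB hd⟩) := aw_iso e'
      rw [h1, aw_sum, ← T_smul_aw]
      exact Submodule.add_mem _ (Submodule.smul_mem _ _ (Submodule.subset_span ⟨a, rfl⟩)) (ih _)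
  rintro x -
  obtain ⟨x, rfl⟩ := toAW_surjective x
  induction x using FreeAbelianGroup.induction_on with
  | zero => rw [map_zero]; exact Submodule.zero_mem _
  | of a =>
    obtain ⟨X, rfl⟩ := cl_surjective a
    exact key (X.property.dec (by omega)) X.property
  | neg a h => rw [map_neg]; exact Submodule.neg_mem _ h
  | add x y hx hy => rw [map_add]; exact Submodule.add_mem _ hx hy

/-- Given a nontrivial relation, let `K` be the largest exponent that occurs and `b` a minimal
segment among those with nonzero coefficient at `K`. Counting morphisms from the copy of `b` shifted
by `K` leaves only the coefficient of `b` at `K`, times a nonzero dimension. -/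
lemma linearIndependent_lab (hd : 2 < orderOf s) :
    LinearIndependent ℤ[T;T⁻¹] fun a : Lab s => aw (a.obj hd) := by
  classical
  rw [Fintype.linearIndependent_iff]
  intro c hc
  by_contra hne
  let S : Finset ℤ := Finset.univ.biUnion fun a => (c a).coeff.support
  have hS : S.Nonempty := by
    push Not at hne
    obtain ⟨a, ha⟩ := hne
    have : (c a).coeff ≠ 0 := fun h => ha (LaurentPolynomial.ext fun m => by rw [h]; rfl)
    obtain ⟨m, hm⟩ := Finsupp.support_nonempty_iff.2 this
    exact ⟨m, Finset.mem_biUnion.2 ⟨a, Finset.mem_univ a, hm⟩⟩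
  let K := S.max' hS
  have hK : ∀ a m, K < m → (c a).coeff m = 0 := by
    intro a m hm
    by_contra h
    have : m ∈ S := Finset.mem_biUnion.2 ⟨a, Finset.mem_univ a, Finsupp.mem_support_iff.2 h⟩
    exact absurd (S.le_max' m this) (not_le.2 hm)
  let U : Finset (Lab s) := Finset.univ.filter fun a => (c a).coeff K ≠ 0
  have hU : U.Nonempty := by
    obtain ⟨a, -, ha⟩ := Finset.mem_biUnion.1 (S.max'_mem hS)
    exact ⟨a, Finset.mem_filter.2 ⟨Finset.mem_univ a, Finsupp.mem_support_iff.1 ha⟩⟩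
  obtain ⟨b, hbU, hb⟩ := U.exists_minimalFor Lab.seg hU
  -- By the convention of `homDim`, the degree `-K` corresponds to morphisms from the shift by `K`.
  let φ := homDimAW b.seg (-K) (s := s) (by omega)
  have hterm : ∀ a, φ (c a • aw (a.obj hd)) = (c a).coeff K * homDim b.seg 0 (O a.seg) := by
    intro a
    rw [map_laurent_smul]
    have hval : ∀ m, φ (aw (bShift m (a.obj hd))) = homDim b.seg (-K + m) (O a.seg) :=
      fun m => homDimAW_aw _ _ _ _
    rw [Finsupp.sum, Finset.sum_eq_single K]
    · rw [hval, neg_add_cancel]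
    -- Exponents below `K` contribute no morphisms, for the target then has no elements in the
    -- required degree; exponents above `K` have zero coefficient.
    · intro m _ hm
      rcases lt_or_gt_of_ne hm with h | h
      · rw [hval, homDim_O_of_neg _ _ _ (by omega), Nat.cast_zero, mul_zero]
      · rw [hK a m h, zero_mul]
    · intro h
      rw [Finsupp.notMem_support_iff.1 h, zero_mul]
  have hsum := congrArg φ hc
  rw [map_zero, map_sum, Finset.sum_eq_single b, hterm] at hsum
  · have h1 : (homDim b.seg 0 (O b.seg) : ℤ) ≠ 0 :=
      Nat.cast_ne_zero.2 (homDim_O_self (seg_nonempty (b.len_pos (by omega))))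
    exact (Finset.mem_filter.1 hbU).2 ((mul_eq_zero.1 hsum).resolve_right h1)
  · intro a _ hab
    rw [hterm]
    by_cases ha : (c a).coeff K = 0
    · rw [ha, zero_mul]
    -- A nonzero morphism forces `a.seg ⊆ b.seg`, and minimality of `b` turns this into equality.
    · by_cases hz : homDim b.seg 0 (O a.seg) = 0
      · rw [hz, Nat.cast_zero, mul_zero]
      · have h1 : a.seg ⊆ b.seg := subset_of_homDim_ne_zero hz
        have h2 : b.seg ⊆ a.seg :=
          hb (Finset.mem_filter.2 ⟨Finset.mem_univ a, ha⟩) h1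
        exact absurd (Lab.seg_injective (by omega) (h1.antisymm h2)) hab
  · exact fun h => absurd (Finset.mem_univ b) h

/-- The basis of the split Grothendieck ring given by the indecomposable objects up to shift. -/
def basisLab (hd : 2 < orderOf s) : Module.Basis (Lab s) ℤ[T;T⁻¹] (AW s) :=
  Module.Basis.mk (linearIndependent_lab hd) (span_lab hd)

end Grothendieck

end CyclicSoergel

end

/-! ### Classification of the indecomposables and rank of the split Grothendieck ring -/

theorem theorem3 (d : ℕ) (hd : 2 < d) (s : ℂ ≃ₗ[ℂ] ℂ) (hs : orderOf s = d) :
    (∀ A, CyclicSoergel.CycConn s A → CyclicSoergel.InB s (CyclicSoergel.O A)) ∧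
    (∀ X : CyclicSoergel.B s, Indecomposable X ↔
      ∃ (A : Set (ℂ ≃ₗ[ℂ] ℂ)) (n : ℤ), CyclicSoergel.CycConn s A ∧
        Nonempty (X.obj ≅ (CyclicSoergel.O A).shift n)) ∧
    (∀ (A A' : Set (ℂ ≃ₗ[ℂ] ℂ)) (n n' : ℤ), CyclicSoergel.CycConn s A →
      CyclicSoergel.CycConn s A' →
      Nonempty ((CyclicSoergel.O A).shift n ≅ (CyclicSoergel.O A').shift n') →
      A = A' ∧ n = n') ∧
    Module.Free ℤ[T;T⁻¹] (CyclicSoergel.AW s) ∧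
    Module.finrank ℤ[T;T⁻¹] (CyclicSoergel.AW s) = d * (d - 1) + 1 := by
  subst hs
  have hconn := fun A => CyclicSoergel.cycConn_iff (s := s) (A := A) rfl (by omega)
  refine ⟨fun A hA => ?_, fun X => ⟨fun h => ?_, ?_⟩, ?_, .of_basis (CyclicSoergel.basisLab hd), ?_⟩
  · obtain ⟨i, n, hn, hnd, rfl⟩ := (hconn A).1 hA
    exact CyclicSoergel.inB_seg hd hn hnd
  · obtain ⟨i, n, m, hn, hnd, e⟩ := CyclicSoergel.exists_seg_of_indecomposable hd h
    exact ⟨_, m, (hconn _).2 ⟨i, n, hn, hnd, rfl⟩, e⟩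
  · rintro ⟨A, n, hA, ⟨e⟩⟩
    obtain ⟨i, n, hn, -, rfl⟩ := (hconn A).1 hA
    exact CyclicSoergel.indecomposable_O (CyclicSoergel.seg_nonempty hn) e
  · rintro A A' n n' hA hA' ⟨e⟩
    obtain ⟨i, l, hl, -, rfl⟩ := (hconn A).1 hA
    obtain ⟨i', l', hl', -, rfl⟩ := (hconn A').1 hA'
    exact ⟨(CyclicSoergel.subset_of_graphIdeal_le
        (CyclicSoergel.graphIdeal_le_of_iso e.symm)).antisymm
        (CyclicSoergel.subset_of_graphIdeal_le (CyclicSoergel.graphIdeal_le_of_iso e)),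
      le_antisymm (CyclicSoergel.shift_le_of_iso (CyclicSoergel.seg_nonempty hl) e)
        (CyclicSoergel.shift_le_of_iso (CyclicSoergel.seg_nonempty hl') e.symm)⟩
  · rw [Module.finrank_eq_card_basis (CyclicSoergel.basisLab hd)]
    simp
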